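/- A Fuchsian group is a finitely generated non-elementary discrete subgroup of $\mathrm{PSL}(2,\mathbb{R})$. For integers $g,k\ge 0$ and $n_1,\dots,n_k\ge 2$, a Fuchsian group $\Gamma$ is called co-compact with signature $(g;n_1,\dots,n_k)$ if it has a presentation with generators $a_1,b_1,\dots,a_g,b_g,x_1,\dots,x_k$ and relations $$x_1^{n_1}=\cdots=x_k^{n_k}=x_1\cdots x_k[a_1,b_1]\cdots[a_g,b_g]=1,\qquad [a,b]=a^{-1}b^{-1}ab.$$ If $k=0$ (there are no periods $n_i$), it is called a Fuchsian surface group. An epimorphism from $\Gamma$ to a finite group is surface-kernel if its kernel is a Fuchsian surface group. Theorem. Let $\Gamma$ be a co-compact Fuchsian group with signature $(g;n_1,\dots,n_k)$, let $\mathfrak{n}=\mathrm{lcm}(n_1,\dots,n_k)$ (so $\mathfrak{n}=1$ if $k=0$), and let $n\ge 1$ be an integer. If $\mathfrak{n}\nmid n$, there is no surface-kernel epimorphism from $\Gamma$ to the cyclic group $\mathbb{Z}_n$ of order $n$. If $\mathfrak{n}\mid n$, the number of surface-kernel epimorphisms from $\Gamma$ to $\mathbb{Z}_n$ is finite and equal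 to $$\frac{n^{2g}}{\mathfrak{n}}\prod_{i=1}^{k}\varphi(n_i)\prod_{p\mid \frac{n}{\mathfrak{n}}}\left(1-\frac{1}{p^{2g}}\right)\prod_{p\mid\mathfrak{n}}\left(1-\frac{(-1)^{e_p-1}}{(p-1)^{e_p-1}}\right),$$ where the last two products run over the prime divisors $p$ of $n/\mathfrak{n}$ and of $\mathfrak{n}$, respectively, $\varphi$ is Euler's function, and $e_p=\#\{i: 1\le i\le k,\ p\nmid \mathfrak{n}/n_i\}$. -/

import Mathlib

open scoped MatrixGroups UpperHalfPlane LinearAlgebra.Projectivization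

/-- The preimage in `SL(2, ℝ)` of a subgroup of `PSL(2, ℝ) = SL(2, ℝ) / {±1}`. -/
def preimageSL (Γ : Subgroup PSL(2, ℝ)) : Subgroup SL(2, ℝ) :=
  Γ.comap (QuotientGroup.mk' (Subgroup.center SL(2, ℝ)))

/-- A subgroup of `PSL(2, ℝ)` is elementary if it has a finite orbit in the closed hyperbolic
plane, that is, in the upper half-plane `ℍ` (on which `PSL(2, ℝ)` acts through representatives in
`SL(2, ℝ)`, by Möbius transformations) or in its boundary circle, the real projective line. -/
def IsElementary (Γ : Subgroup PSL(2, ℝ)) : Prop :=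
  (∃ z : ℍ, (MulAction.orbit (preimageSL Γ) z).Finite) ∨
    ∃ p : ℙ ℝ (Fin 2 → ℝ), (MulAction.orbit Γ p).Finite

/-- A Fuchsian group: a finitely generated non-elementary discrete subgroup of `PSL(2, ℝ)`
(with the quotient topology of the matrix topology on `SL(2, ℝ)`). -/
structure IsFuchsian (Γ : Subgroup PSL(2, ℝ)) : Prop where
  fg : Γ.FG
  nonelementary : ¬ IsElementary Γ
  discrete : DiscreteTopology Γ

/-- The names `a₁, b₁, …, a_g, b_g, x₁, …, x_k` of the canonical generators. -/
inductive SignatureGen (g k : ℕ) : Type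
  | a (i : Fin g) : SignatureGen g k
  | b (i : Fin g) : SignatureGen g k
  | x (i : Fin k) : SignatureGen g k

namespace SignatureGen

/-- The word `x₁ ⋯ x_k [a₁, b₁] ⋯ [a_g, b_g]`, where `[a, b] = a⁻¹ b⁻¹ a b`. -/
def longRelator (g k : ℕ) : FreeGroup (SignatureGen g k) :=
  (List.ofFn fun i : Fin k => FreeGroup.of (x i)).prod *
    (List.ofFn fun i : Fin g =>
      (FreeGroup.of (a i))⁻¹ * (FreeGroup.of (b i))⁻¹ *
        FreeGroup.of (a i) * FreeGroup.of (b i)).prod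

/-- The relators `x₁ ^ n₁, …, x_k ^ n_k` and `x₁ ⋯ x_k [a₁, b₁] ⋯ [a_g, b_g]`. -/
def relators (g : ℕ) {k : ℕ} (period : Fin k → ℕ) : Set (FreeGroup (SignatureGen g k)) :=
  insert (longRelator g k) (Set.range fun i : Fin k => FreeGroup.of (x i) ^ period i)

end SignatureGen

/-- `Γ` is a co-compact Fuchsian group with signature `(g; n₁, …, n_k)`: a Fuchsian group, all
`n_i` are at least `2`, and `Γ` has the presentation
`⟨a₁, b₁, …, a_g, b_g, x₁, …, x_k | x₁ ^ n₁ = ⋯ = x_k ^ n_k = x₁ ⋯ x_k [a₁, b₁] ⋯ [a_g, b_g] = 1⟩`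
(no parabolic and no boundary generators). -/
structure IsCocompactFuchsian (Γ : Subgroup PSL(2, ℝ)) (g : ℕ) {k : ℕ} (period : Fin k → ℕ) :
    Prop where
  fuchsian : IsFuchsian Γ
  two_le_period : ∀ i, 2 ≤ period i
  presentation : Nonempty (PresentedGroup (SignatureGen.relators g period) ≃* Γ)

/-- A (co-compact) Fuchsian surface group: one whose signature has no periods. -/
def IsFuchsianSurfaceGroup (Γ : Subgroup PSL(2, ℝ)) : Prop :=
  ∃ g : ℕ, IsCocompactFuchsian Γ g (Fin.elim0 : Fin 0 → ℕ)

/-- An epimorphism from a Fuchsian group to a group `G` is surface-kernel if its kernel, as a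
subgroup of `PSL(2, ℝ)`, is a Fuchsian surface group. -/
structure IsSurfaceKernelEpi {Γ : Subgroup PSL(2, ℝ)} {G : Type*} [Group G] (φ : Γ →* G) :
    Prop where
  surjective : Function.Surjective φ
  surface_kernel : IsFuchsianSurfaceGroup (φ.ker.map Γ.subtype)

/-- `e_p = #{i : p ∤ N / n_i}`, where `N = lcm(n₁, …, n_k)`. -/
def periodCount {k : ℕ} (period : Fin k → ℕ) (p : ℕ) : ℕ :=
  (Finset.univ.filter fun i : Fin k => ¬ p ∣ Finset.univ.lcm period / period i).card

/-! A homomorphism from `Γ` to `ℤ/n` is surface-kernel exactly when it is onto and preserves the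
order of every elliptic generator `x_i` (`isSurfaceKernelEpi_iff`). Given this, the count is
elementary. In an abelian target the commutators disappear from the long relator, so a homomorphism
is a free choice of images of the `a_i`, `b_i` together with images `z_i` of the `x_i` such that
`z_i ^ n_i = 1` and the product of the `z_i` is 1. Preservation of orders concerns only the `z_i`
and forces each `n_i` to divide `n`. The `z_i` then generate the subgroup of order `N = lcm n_i`, so
surjectivity becomes a condition on the `a_i`, `b_i` alone: for no prime `p` dividing `n / N` do
they all lie in the subgroup of index `p`. Hence the epimorphisms form a product set
(`image_genImages`). Its handle factor is counted by inclusion–exclusion (`card_tuples_not_mem`).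
Its elliptic factor is the coefficient of 1 in a product of sums of elements of order `n_i` in the
group algebra (`card_tuples_eq`). This product splits over primes into combinations of two subgroup
sums.

Preservation of orders is necessary because surface groups are torsion-free
(`SurfaceGroup.eq_one_of_pow_eq_one`): in positive genus they embed in an extension of `ℤ` by a free
group. It is also needed that `x_i` has order exactly `n_i` in the presented group
(`IsCocompactFuchsian.orderOf_of_x`). Explicit representations show this, except in genus 0 with
fewer than three periods, where the group is finite and therefore elementary.

Sufficiency is covering theory in combinatorial form. Glue a polygon for the long relator to a cone
disc for each `x_i`. If orders are preserved, the cone discs lift to ordinary discs, and the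
`n`-sheeted cyclic cover is a connected closed oriented surface glued from polygons, with the kernel
as its fundamental group (`gaugePresents_kerGen`). The classification of surfaces then applies: glue
all faces into one, contract edges joining different vertices, extract handles until no letter is
left (`GaugePresents.mulEquiv_surfaceGroup`). A cover has several vertices, so fundamental groups
are described up to gauge, with one group element per vertex, instead of by a spanning tree.
Finally, a subgroup of finite index in a Fuchsian group is again Fuchsian
(`IsFuchsian.of_relIndex`). -/

/-! ### Signed letters, words and vertex labellings -/

/-- The formal inverse of a signed letter. -/
def flipLetter {α : Type*} (s : α × Bool) : α × Bool := (s.1, !s.2)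

@[simp] lemma flipLetter_flipLetter {α : Type*} (s : α × Bool) :
    flipLetter (flipLetter s) = s := by simp [flipLetter]

lemma flipLetter_ne {α : Type*} (s : α × Bool) : flipLetter s ≠ s := by
  rcases s with ⟨a, b⟩
  cases b <;> simp [flipLetter]

lemma flipLetter_injective {α : Type*} : Function.Injective (flipLetter (α := α)) :=
  Function.LeftInverse.injective flipLetter_flipLetter

lemma eq_or_eq_flipLetter {α : Type*} {s t : α × Bool} (h : s.1 = t.1) :
    s = t ∨ s = flipLetter t := by
  rcases s with ⟨a, b⟩
  rcases t with ⟨c, d⟩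
  obtain rfl : a = c := h
  cases b <;> cases d <;> simp [flipLetter]

/-- The value of a signed letter under an assignment of group elements to the letters. -/
def letterVal {α H : Type*} [Group H] (h : α → H) (s : α × Bool) : H :=
  if s.2 then h s.1 else (h s.1)⁻¹

@[simp] lemma letterVal_flipLetter {α H : Type*} [Group H] (h : α → H) (s : α × Bool) :
    letterVal h (flipLetter s) = (letterVal h s)⁻¹ := by
  rcases s with ⟨a, b⟩
  cases b <;> simp [letterVal, flipLetter]

lemma map_letterVal {α H H' : Type*} [Group H] [Group H'] (θ : H →* H') (h : α → H)
    (s : α × Bool) : θ (letterVal h s) = letterVal (fun a => θ (h a)) s := by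
  rcases s with ⟨a, b⟩
  cases b <;> simp [letterVal]

/-- The value of a word under an assignment of group elements to the letters. -/
def wordVal {α H : Type*} [Group H] (h : α → H) (w : List (α × Bool)) : H :=
  (w.map (letterVal h)).prod

@[simp] lemma wordVal_nil {α H : Type*} [Group H] (h : α → H) : wordVal h [] = 1 := rfl

@[simp] lemma wordVal_cons {α H : Type*} [Group H] (h : α → H) (s : α × Bool)
    (w : List (α × Bool)) : wordVal h (s :: w) = letterVal h s * wordVal h w := by
  simp [wordVal]

@[simp] lemma wordVal_append {α H : Type*} [Group H] (h : α → H) (w w' : List (α × Bool)) :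
    wordVal h (w ++ w') = wordVal h w * wordVal h w' := by
  simp [wordVal]

lemma wordVal_congr {α H : Type*} [Group H] {h h' : α → H} {w : List (α × Bool)}
    (hw : ∀ s ∈ w, letterVal h s = letterVal h' s) : wordVal h w = wordVal h' w := by
  simp only [wordVal]
  rw [List.map_congr_left hw]

lemma map_wordVal {α H H' : Type*} [Group H] [Group H'] (θ : H →* H') (h : α → H) (h' : α → H')
    (w : List (α × Bool)) (hw : ∀ s ∈ w, θ (letterVal h s) = letterVal h' s) :
    θ (wordVal h w) = wordVal h' w := by
  simp only [wordVal, map_list_prod, List.map_map]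
  rw [List.map_congr_left (g := letterVal h')]
  simpa using hw

lemma wordVal_mem {α H : Type*} [Group H] (M : Subgroup H) (h : α → H)
    (w : List (α × Bool)) (hw : ∀ s ∈ w, letterVal h s ∈ M) : wordVal h w ∈ M := by
  apply Subgroup.list_prod_mem
  intro x hx
  obtain ⟨s, hs, rfl⟩ := List.mem_map.1 hx
  exact hw s hs

/-- Change the assignment so that the signed letter `e` gets the value `c`. -/
noncomputable def setLetter {α H : Type*} [Group H] (h : α → H) (e : α × Bool) (c : H) : α → H :=
  open Classical in Function.update h e.1 (if e.2 then c else c⁻¹)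

@[simp] lemma letterVal_setLetter_self {α H : Type*} [Group H] (h : α → H) (e : α × Bool) (c : H) :
    letterVal (setLetter h e c) e = c := by
  rcases e with ⟨a, b⟩
  cases b <;> simp [letterVal, setLetter]

lemma letterVal_setLetter_of_ne {α H : Type*} [Group H] (h : α → H) {e s : α × Bool} (c : H)
    (h1 : s ≠ e) (h2 : s ≠ flipLetter e) : letterVal (setLetter h e c) s = letterVal h s := by
  have : s.1 ≠ e.1 := fun hs => (eq_or_eq_flipLetter hs).elim h1 h2
  simp [letterVal, setLetter, this]

/-- `IsLabelledPath f v w u`: with `f s` the label of the source of the signed letter `s`, the word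
`w` is a path from a vertex labelled `v` to a vertex labelled `u`. -/
def IsLabelledPath {α V : Type*} (f : α × Bool → V) : V → List (α × Bool) → V → Prop
  | v, [], u => v = u
  | v, s :: w, u => f s = v ∧ IsLabelledPath f (f (flipLetter s)) w u

section paths
variable {α V : Type*}

@[simp] lemma isLabelledPath_nil (f : α × Bool → V) (v u : V) :
    IsLabelledPath f v [] u ↔ v = u := Iff.rfl

@[simp] lemma isLabelledPath_cons (f : α × Bool → V) (v u : V) (s : α × Bool)
    (w : List (α × Bool)) :
    IsLabelledPath f v (s :: w) u ↔ f s = v ∧ IsLabelledPath f (f (flipLetter s)) w u := Iff.rfl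

lemma isLabelledPath_append (f : α × Bool → V) (v u : V) (w w' : List (α × Bool)) :
    IsLabelledPath f v (w ++ w') u ↔ ∃ m, IsLabelledPath f v w m ∧ IsLabelledPath f m w' u := by
  induction w generalizing v with
  | nil => simp
  | cons s w ih => simp [ih, and_assoc]

lemma isLabelledPath_congr {f f' : α × Bool → V} {w : List (α × Bool)}
    (hw : ∀ s ∈ w, f s = f' s ∧ f (flipLetter s) = f' (flipLetter s)) (v u : V) :
    IsLabelledPath f v w u ↔ IsLabelledPath f' v w u := by
  induction w generalizing v with
  | nil => simp
  | cons s w ih =>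
    have h := hw s (by simp)
    simp [h.1, h.2, ih (fun s hs => hw s (by simp [hs]))]

lemma IsLabelledPath.comp {W : Type*} {f : α × Bool → V} (c : V → W) {v u : V}
    {w : List (α × Bool)} (hw : IsLabelledPath f v w u) :
    IsLabelledPath (fun s => c (f s)) (c v) w (c u) := by
  induction w generalizing v with
  | nil => simpa using congrArg c hw
  | cons s w ih => exact ⟨congrArg c hw.1, ih hw.2⟩

/-- Two labellings can be read along the same word at once. This composes gauges, and it pairs a
labelling with a colouring of the vertices. -/
lemma IsLabelledPath.map₂ {W X : Type*} {f : α × Bool → V} {f' : α × Bool → W} (c : V → W → X)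
    {v u : V} {v' u' : W} {w : List (α × Bool)} (hw : IsLabelledPath f v w u)
    (hw' : IsLabelledPath f' v' w u') :
    IsLabelledPath (fun s => c (f s) (f' s)) (c v v') w (c u u') := by
  induction w generalizing v v' with
  | nil =>
    have h1 : v = u := hw
    have h2 : v' = u' := hw'
    simp [h1, h2]
  | cons s w ih => exact ⟨by simp [hw.1, hw'.1], ih hw.2 hw'.2⟩

lemma isLabelledPath_const {f : α × Bool → V} {v : V} {w : List (α × Bool)}
    (hw : ∀ s ∈ w, f s = v ∧ f (flipLetter s) = v) : IsLabelledPath f v w v := by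
  induction w with
  | nil => simp
  | cons s w ih =>
    have h := hw s (by simp)
    simp [h.1, h.2, ih (fun s hs => hw s (by simp [hs]))]

lemma IsLabelledPath.eq_of_flat {f : α × Bool → V} {v u : V} {w : List (α × Bool)}
    (hw : IsLabelledPath f v w u) (hf : ∀ s ∈ w, f (flipLetter s) = f s) :
    ∀ s ∈ w, f s = v := by
  induction w generalizing v with
  | nil => simp
  | cons s w ih =>
    have h1 : f (flipLetter s) = v := (hf s (by simp)).trans hw.1
    intro t ht
    rcases List.mem_cons.1 ht with rfl | ht
    · exact hw.1
    · have := hw.2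
      rw [h1] at this
      exact ih this (fun s hs => hf s (by simp [hs])) t ht

/-- The product of a gauged assignment along a labelled path telescopes. -/
lemma IsLabelledPath.gauge_mem {K : Type*} [Group K] (M : Subgroup K) {g : α × Bool → K}
    {k : α → K} {v u : K} {w : List (α × Bool)} (hw : IsLabelledPath g v w u)
    (hM : ∀ s ∈ w, g s * letterVal k s * (g (flipLetter s))⁻¹ ∈ M) :
    v * wordVal k w * u⁻¹ ∈ M := by
  induction w generalizing v with
  | nil =>
    have : v = u := hw
    simp [this, M.one_mem]
  | cons s w ih =>
    have h1 := hM s (by simp)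
    have h2 := ih hw.2 (fun s hs => hM s (by simp [hs]))
    rw [hw.1] at h1
    have := M.mul_mem h1 h2
    simpa [mul_assoc] using this

/-- Change a labelling at the two ends of a letter. -/
noncomputable def setEnds (f : α × Bool → V) (e : α × Bool) (x y : V) : α × Bool → V :=
  open Classical in fun s => if s = flipLetter e then y else if s = e then x else f s

lemma setEnds_self (f : α × Bool → V) (e : α × Bool) (x y : V) : setEnds f e x y e = x := by
  simp [setEnds, (flipLetter_ne e).symm]

lemma setEnds_flip (f : α × Bool → V) (e : α × Bool) (x y : V) :
    setEnds f e x y (flipLetter e) = y := by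
  simp [setEnds]

lemma setEnds_of_ne (f : α × Bool → V) {e s : α × Bool} (x y : V) (h1 : s ≠ e)
    (h2 : s ≠ flipLetter e) : setEnds f e x y s = f s := by
  simp [setEnds, h1, h2]

lemma isLabelledPath_setEnds (f : α × Bool → V) {e : α × Bool} (x y : V) {w : List (α × Bool)}
    (h1 : e ∉ w) (h2 : flipLetter e ∉ w) (v u : V) :
    IsLabelledPath (setEnds f e x y) v w u ↔ IsLabelledPath f v w u := by
  apply isLabelledPath_congr
  intro s hs
  have h3 : s ≠ e := fun h => h1 (h ▸ hs)
  have h4 : s ≠ flipLetter e := fun h => h2 (h ▸ hs)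
  refine ⟨setEnds_of_ne _ _ _ h3 h4, setEnds_of_ne _ _ _ ?_ ?_⟩
  · exact fun h => h4 (by rw [← h, flipLetter_flipLetter])
  · exact fun h => h3 (flipLetter_injective h)

end paths

/-! ### Words in which every letter occurs with its inverse -/

/-- No signed letter occurs twice, and with each signed letter its inverse occurs. -/
structure IsQuadratic {α : Type*} (w : List (α × Bool)) : Prop where
  nodup : w.Nodup
  flip_mem : ∀ s ∈ w, flipLetter s ∈ w

lemma IsQuadratic.perm {α : Type*} {w w' : List (α × Bool)} (h : IsQuadratic w)
    (hp : w.Perm w') : IsQuadratic w' :=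
  ⟨hp.nodup_iff.1 h.nodup, fun s hs => hp.mem_iff.1 (h.flip_mem s (hp.mem_iff.2 hs))⟩

lemma IsQuadratic.of_cons_cons {α : Type*} {w : List (α × Bool)} {e : α × Bool}
    (h : IsQuadratic (e :: flipLetter e :: w)) :
    IsQuadratic w ∧ e ∉ w ∧ flipLetter e ∉ w := by
  have h1 := h.nodup
  simp only [List.nodup_cons, List.mem_cons, not_or] at h1
  refine ⟨⟨h1.2.2, fun s hs => ?_⟩, h1.1.2, h1.2.1⟩
  have h2 := h.flip_mem s (by simp [hs])
  simp only [List.mem_cons] at h2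
  rcases h2 with h2 | h2 | h2
  · rw [← h2, flipLetter_flipLetter] at h1; exact absurd hs h1.2.1
  · rw [flipLetter_injective h2] at hs; exact absurd hs h1.1.2
  · exact h2

lemma IsQuadratic.ne_of_mem {α : Type*} {w : List (α × Bool)} {e : α × Bool}
    (h1 : e ∉ w) (h2 : flipLetter e ∉ w) {s : α × Bool} (hs : s ∈ w) :
    s ≠ e ∧ s ≠ flipLetter e :=
  ⟨fun h => h1 (h ▸ hs), fun h => h2 (h ▸ hs)⟩

/-- A vertex labelling is closed if every face is a closed path. -/
def IsClosedLabelling {α V : Type*} (fs : List (List (α × Bool))) (g : α × Bool → V) : Prop :=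
  ∀ w ∈ fs, ∃ v, IsLabelledPath g v w v

/-- `K`, with the elements `k`, is the fundamental group of the surface glued from the faces `fs`,
up to the choice of a path from the base point to each vertex. -/
structure GaugePresents {α K : Type} [Group K] (fs : List (List (α × Bool))) (k : α → K) :
    Prop where
  rel : ∀ w ∈ fs, wordVal k w = 1
  gen : ∀ (M : Subgroup K) (g : α × Bool → K), IsClosedLabelling fs g →
    (∀ s ∈ fs.flatten, g s * letterVal k s * (g (flipLetter s))⁻¹ ∈ M) → M = ⊤
  univ : ∀ (H : Type) [Group H] (h : α → H), (∀ w ∈ fs, wordVal h w = 1) →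
    ∃ (θ : K →* H) (g : α × Bool → H), IsClosedLabelling fs g ∧
      ∀ s ∈ fs.flatten, letterVal h s = g s * θ (letterVal k s) * (g (flipLetter s))⁻¹

/-- Faces that share letters are constantly labelled together. -/
def IsFaceConnected {α : Type*} (fs : List (List (α × Bool))) : Prop :=
  ∀ f : α → Prop, (∀ w ∈ fs, ∀ s ∈ w, ∀ t ∈ w, f s.1 → f t.1) →
    ∀ s ∈ fs.flatten, ∀ t ∈ fs.flatten, f s.1 → f t.1

section faces
variable {α K : Type} [Group K]

/-- An empty face gives no relation, contains no edge and is closed for every labelling; the order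
and repetition of the faces play no role either. -/
lemma GaugePresents.of_faces {fs fs' : List (List (α × Bool))} {k : α → K}
    (h : GaugePresents fs k) (hf : ∀ w, w ≠ [] → (w ∈ fs ↔ w ∈ fs')) : GaugePresents fs' k := by
  have hflat : ∀ s, s ∈ fs.flatten ↔ s ∈ fs'.flatten := by
    intro s
    simp only [List.mem_flatten]
    constructor
    · rintro ⟨w, hw, hs⟩
      exact ⟨w, (hf w (List.ne_nil_of_mem hs)).1 hw, hs⟩
    · rintro ⟨w, hw, hs⟩
      exact ⟨w, (hf w (List.ne_nil_of_mem hs)).2 hw, hs⟩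
  have hclosed : ∀ {H : Type} [Group H] (g : α × Bool → H),
      IsClosedLabelling fs g ↔ IsClosedLabelling fs' g := by
    intro H _ g
    constructor
    · intro hg w hw
      by_cases hn : w = []
      · exact ⟨1, by simp [hn]⟩
      · exact hg w ((hf w hn).2 hw)
    · intro hg w hw
      by_cases hn : w = []
      · exact ⟨1, by simp [hn]⟩
      · exact hg w ((hf w hn).1 hw)
  have hrel : ∀ {H : Type} [Group H] (k : α → H),
      (∀ w ∈ fs, wordVal k w = 1) ↔ (∀ w ∈ fs', wordVal k w = 1) := by
    intro H _ g
    constructor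
    · intro hg w hw
      by_cases hn : w = []
      · simp [hn]
      · exact hg w ((hf w hn).2 hw)
    · intro hg w hw
      by_cases hn : w = []
      · simp [hn]
      · exact hg w ((hf w hn).1 hw)
  refine ⟨(hrel k).1 h.rel, fun M g hg hM => ?_, fun H _ u hu => ?_⟩
  · exact h.gen M g ((hclosed g).2 hg) fun s hs => hM s ((hflat s).1 hs)
  · obtain ⟨θ, g, h1, h2⟩ := h.univ H u ((hrel u).2 hu)
    exact ⟨θ, g, (hclosed g).1 h1, fun s hs => h2 s ((hflat s).2 hs)⟩

/-- Two faces that share a letter can be glued along it. -/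
lemma GaugePresents.merge {P Q R S : List (α × Bool)} {e : α × Bool}
    {fs : List (List (α × Bool))} {k : α → K}
    (hq : IsQuadratic ((P ++ e :: Q) :: (R ++ flipLetter e :: S) :: fs).flatten)
    (h : GaugePresents ((P ++ e :: Q) :: (R ++ flipLetter e :: S) :: fs) k) :
    GaugePresents ((R ++ (Q ++ (P ++ S))) :: fs) k := by
  have hperm : ((P ++ e :: Q) :: (R ++ flipLetter e :: S) :: fs).flatten.Perm
      (e :: flipLetter e :: ((R ++ (Q ++ (P ++ S))) :: fs).flatten) := by
    classical
    rw [List.perm_iff_count]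
    intro x
    simp [List.count_cons]
    omega
  obtain ⟨-, he, he'⟩ := (hq.perm hperm).of_cons_cons
  have hne := fun {s} => IsQuadratic.ne_of_mem he he' (s := s)
  simp only [List.flatten_cons, List.mem_append, not_or] at he he'
  obtain ⟨⟨heR, heQ, heP, heS⟩, hefs⟩ := he
  obtain ⟨⟨heR', heQ', heP', heS'⟩, hefs'⟩ := he'
  have hfs1 : ∀ w ∈ fs, e ∉ w ∧ flipLetter e ∉ w := fun w hw =>
    ⟨fun hh => hefs (List.mem_flatten.2 ⟨w, hw, hh⟩),
      fun hh => hefs' (List.mem_flatten.2 ⟨w, hw, hh⟩)⟩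
  have r1 := h.rel _ (by simp : (P ++ e :: Q) ∈ _)
  have r2 := h.rel _ (by simp : (R ++ flipLetter e :: S) ∈ _)
  simp only [wordVal_append, wordVal_cons, letterVal_flipLetter] at r1 r2
  -- The first face determines the shared letter; substituted into the second one it yields the
  -- glued face `R Q P S`.
  have ke : letterVal k e = (wordVal k Q * wordVal k P)⁻¹ := by
    rw [eq_inv_iff_mul_eq_one, ← mul_assoc]
    have := congrArg (fun x => (wordVal k P)⁻¹ * x * wordVal k P) r1
    simpa [mul_assoc] using this
  refine ⟨?_, ?_, ?_⟩
  · intro w hw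
    rcases List.mem_cons.1 hw with rfl | hw
    · rw [ke] at r2
      simpa [mul_assoc] using r2
    · exact h.rel w (by simp [hw])
  · intro M g hg hM
    obtain ⟨v, hv⟩ := hg _ (by simp : (R ++ (Q ++ (P ++ S))) ∈ _)
    simp only [isLabelledPath_append] at hv
    obtain ⟨m1, hR, m2, hQ, m3, hP, hS⟩ := hv
    have hM' : ∀ s, (s ∈ R ∨ s ∈ Q ∨ s ∈ P ∨ s ∈ S) →
        g s * letterVal k s * (g (flipLetter s))⁻¹ ∈ M := by
      intro s hs
      apply hM
      simp only [List.flatten_cons, List.mem_append]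
      exact Or.inl hs
    have hgP := hP.gauge_mem M (k := k) (fun s hs => hM' s (by simp [hs]))
    have hgQ := hQ.gauge_mem M (k := k) (fun s hs => hM' s (by simp [hs]))
    have hge : m3 * letterVal k e * m1⁻¹ ∈ M := by
      have := M.inv_mem (M.mul_mem hgQ hgP)
      rw [ke]
      simpa [mul_assoc] using this
    -- The restored edge runs from the end of `P` to the start of `Q`, and these vertices carry the
    -- labels `m3` and `m1` in the glued face.
    refine h.gen M (setEnds g e m3 m1) ?_ ?_
    · intro w hw
      rcases List.mem_cons.1 hw with rfl | hw
      · refine ⟨m2, ?_⟩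
        rw [isLabelledPath_append]
        refine ⟨m3, (isLabelledPath_setEnds _ _ _ heP heP' _ _).2 hP, ?_⟩
        rw [isLabelledPath_cons, setEnds_self, setEnds_flip]
        exact ⟨rfl, (isLabelledPath_setEnds _ _ _ heQ heQ' _ _).2 hQ⟩
      rcases List.mem_cons.1 hw with rfl | hw
      · refine ⟨v, ?_⟩
        rw [isLabelledPath_append]
        refine ⟨m1, (isLabelledPath_setEnds _ _ _ heR heR' _ _).2 hR, ?_⟩
        rw [isLabelledPath_cons, flipLetter_flipLetter, setEnds_self, setEnds_flip]
        exact ⟨rfl, (isLabelledPath_setEnds _ _ _ heS heS' _ _).2 hS⟩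
      · obtain ⟨u, hu⟩ := hg w (by simp [hw])
        exact ⟨u, (isLabelledPath_setEnds _ _ _ (hfs1 w hw).1 (hfs1 w hw).2 _ _).2 hu⟩
    · intro s hs
      rw [hperm.mem_iff, List.mem_cons, List.mem_cons] at hs
      rcases hs with rfl | rfl | hs
      · rw [setEnds_self, setEnds_flip]; exact hge
      · rw [flipLetter_flipLetter, setEnds_self, setEnds_flip]
        simpa [mul_assoc] using M.inv_mem hge
      · have h3 := hne hs
        rw [setEnds_of_ne _ _ _ h3.1 h3.2, setEnds_of_ne _ _ _ _ _]
        · exact hM s hs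
        · exact fun h => h3.2 (by rw [← h, flipLetter_flipLetter])
        · exact fun h => h3.1 (flipLetter_injective h)
  · intro H _ u hu
    have hv : ∀ (w : List (α × Bool)), e ∉ w → flipLetter e ∉ w →
        wordVal (setLetter u e (wordVal u Q * wordVal u P)⁻¹) w = wordVal u w := by
      intro w h1 h2
      apply wordVal_congr
      intro s hs
      have := IsQuadratic.ne_of_mem h1 h2 hs
      exact letterVal_setLetter_of_ne _ _ this.1 this.2
    have hu1 := hu _ (by simp : (R ++ (Q ++ (P ++ S))) ∈ _)
    simp only [wordVal_append] at hu1
    obtain ⟨θ, g, hg, hθ⟩ := h.univ H (setLetter u e (wordVal u Q * wordVal u P)⁻¹) (by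
      intro w hw
      rcases List.mem_cons.1 hw with rfl | hw
      · rw [wordVal_append, wordVal_cons, hv P heP heP', hv Q heQ heQ', letterVal_setLetter_self]
        group
      rcases List.mem_cons.1 hw with rfl | hw
      · simp only [wordVal_append, wordVal_cons, letterVal_flipLetter, letterVal_setLetter_self,
          hv R heR heR', hv S heS heS', inv_inv, mul_assoc]
        exact hu1
      · rw [hv w (hfs1 w hw).1 (hfs1 w hw).2]
        exact hu w (by simp [hw]))
    refine ⟨θ, g, ?_, ?_⟩
    · intro w hw
      rcases List.mem_cons.1 hw with rfl | hw
      · obtain ⟨v, hv1⟩ := hg (P ++ e :: Q) (by simp)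
        obtain ⟨v', hv2⟩ := hg (R ++ flipLetter e :: S) (by simp)
        simp only [isLabelledPath_append, isLabelledPath_cons, flipLetter_flipLetter] at hv1 hv2
        obtain ⟨m, hP, hm, hQ⟩ := hv1
        obtain ⟨m', hR, hm', hS⟩ := hv2
        subst hm hm'
        refine ⟨v', ?_⟩
        simp only [isLabelledPath_append]
        exact ⟨_, hR, _, hQ, _, hP, hS⟩
      · exact hg w (by simp [hw])
    · intro s hs
      have h3 := hne hs
      rw [← hθ s (by rw [hperm.mem_iff]; simp only [List.mem_cons, hs, or_true]),
        letterVal_setLetter_of_ne _ _ h3.1 h3.2]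

lemma IsFaceConnected.merge {P Q R S : List (α × Bool)} {e : α × Bool}
    {fs : List (List (α × Bool))}
    (h : IsFaceConnected ((P ++ e :: Q) :: (R ++ flipLetter e :: S) :: fs))
    (hq : IsQuadratic ((P ++ e :: Q) :: (R ++ flipLetter e :: S) :: fs).flatten) :
    IsFaceConnected ((R ++ (Q ++ (P ++ S))) :: fs) := by
  classical
  have hperm : ((P ++ e :: Q) :: (R ++ flipLetter e :: S) :: fs).flatten.Perm
      (e :: flipLetter e :: ((R ++ (Q ++ (P ++ S))) :: fs).flatten) := by
    rw [List.perm_iff_count]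
    intro x
    simp [List.count_cons]
    omega
  obtain ⟨-, he, he'⟩ := (hq.perm hperm).of_cons_cons
  have hne : ∀ s ∈ ((R ++ (Q ++ (P ++ S))) :: fs).flatten, s.1 ≠ e.1 := by
    intro s hs hse
    have := IsQuadratic.ne_of_mem he he' hs
    exact (eq_or_eq_flipLetter hse).elim this.1 this.2
  intro f hf s hs t ht hfs
  set B := R ++ (Q ++ (P ++ S)) with hB
  -- The removed letter receives the common value of `f` on the glued face, so `f'` is constant on
  -- both original faces.
  set f' : α → Prop := Function.update f e.1 (∃ s ∈ B, f s.1) with hf'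
  have hfe : f' e.1 ↔ ∃ s ∈ B, f s.1 := by simp [hf']
  have hfn : ∀ s ∈ (B :: fs).flatten, (f' s.1 ↔ f s.1) := by
    intro s hs
    simp [hf', Function.update_of_ne (hne s hs)]
  have hBB : ∀ s ∈ B, (f' s.1 ↔ ∃ s ∈ B, f s.1) := by
    intro s hs
    rw [hfn s (by simp [hs])]
    exact ⟨fun h => ⟨s, hs, h⟩, fun ⟨t, ht, h⟩ => hf B (by simp) t ht s hs h⟩
  have key := h f' (by
    intro w hw s hs t ht hst
    rcases List.mem_cons.1 hw with rfl | hw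
    · have : ∀ s ∈ P ++ e :: Q, (f' s.1 ↔ ∃ s ∈ B, f s.1) := by
        intro s hs
        simp only [List.mem_append, List.mem_cons] at hs
        rcases hs with hs | rfl | hs
        · exact hBB s (by simp [hB, hs])
        · exact hfe
        · exact hBB s (by simp [hB, hs])
      rw [this t ht, ← this s hs]; exact hst
    rcases List.mem_cons.1 hw with rfl | hw
    · have : ∀ s ∈ R ++ flipLetter e :: S, (f' s.1 ↔ ∃ s ∈ B, f s.1) := by
        intro s hs
        simp only [List.mem_append, List.mem_cons] at hs
        rcases hs with hs | rfl | hs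
        · exact hBB s (by simp [hB, hs])
        · exact hfe
        · exact hBB s (by simp [hB, hs])
      rw [this t ht, ← this s hs]; exact hst
    · rw [hfn t (List.mem_flatten.2 ⟨w, by simp [hw], ht⟩)]
      rw [hfn s (List.mem_flatten.2 ⟨w, by simp [hw], hs⟩)] at hst
      exact hf w (by simp [hw]) s hs t ht hst)
  have := key s (by rw [hperm.mem_iff]; simp only [List.mem_cons, hs, or_true])
    t (by rw [hperm.mem_iff]; simp only [List.mem_cons, ht, or_true])
  rw [hfn s hs, hfn t ht] at this
  exact this hfs

/-- As long as a nonempty face lacks the inverse of one of its letters, that inverse lies in another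
face and the two can be glued. Each step lowers the number of faces. -/
lemma GaugePresents.exists_single_face (fs : List (List (α × Bool))) (k : α → K)
    (hq : IsQuadratic fs.flatten) (hc : IsFaceConnected fs) (h : GaugePresents fs k) :
    ∃ w, IsQuadratic w ∧ GaugePresents [w] k := by
  induction hn : fs.length generalizing fs with
  | zero =>
    obtain rfl := List.length_eq_zero_iff.1 hn
    exact ⟨[], ⟨by simp, by simp⟩, h.of_faces (by simp)⟩
  | succ n ih =>
    obtain ⟨w, rest, rfl⟩ := List.exists_cons_of_length_eq_add_one hn
    by_cases hw : w = []
    · subst hw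
      refine ih rest (by simpa using hq) ?_ (h.of_faces (by simp +contextual)) (by simpa using hn)
      intro f hf s hs t ht
      exact hc f (by simpa using hf) s (by simpa using hs) t (by simpa using ht)
    obtain ⟨s₀, hs₀⟩ := List.exists_mem_of_ne_nil w hw
    have hnd : w.Nodup ∧ rest.flatten.Nodup ∧ w.Disjoint rest.flatten := by
      have := hq.nodup
      rwa [List.flatten_cons, List.nodup_append'] at this
    -- A face closed under inversion shares no letter with the others, so connectedness leaves no
    -- letter outside it.
    by_cases hcl : ∀ e ∈ w, flipLetter e ∈ w
    · have hrest : ∀ w' ∈ rest, w' = [] := by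
        intro w' hw'
        by_contra hne
        obtain ⟨t, ht⟩ := List.exists_mem_of_ne_nil w' hne
        have htr : t ∈ rest.flatten := List.mem_flatten.2 ⟨w', hw', ht⟩
        have hmem : ∀ s, (∃ t ∈ w, t.1 = s.1) → s ∈ w := by
          rintro s ⟨t, ht, hts⟩
          rcases eq_or_eq_flipLetter hts with rfl | rfl
          · exact ht
          · simpa using hcl _ ht
        have := hc (fun a => ∃ t ∈ w, t.1 = a) (by
          intro u hu s hs t ht hst
          rcases List.mem_cons.1 hu with rfl | hu
          · exact ⟨t, ht, rfl⟩
          · exact absurd (List.mem_flatten.2 ⟨u, hu, hs⟩) (hnd.2.2 (hmem s hst)))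
          s₀ (by simp [hs₀]) t (by simp only [List.flatten_cons, List.mem_append, htr, or_true])
          ⟨s₀, hs₀, rfl⟩
        exact hnd.2.2 (hmem t this) htr
      refine ⟨w, ⟨hnd.1, hcl⟩, h.of_faces ?_⟩
      intro u hu
      simp only [List.mem_cons, List.not_mem_nil, or_false, or_iff_left_iff_imp]
      exact fun hur => absurd (hrest u hur) hu
    · push Not at hcl
      obtain ⟨e, hew, he⟩ := hcl
      have he2 : flipLetter e ∈ rest.flatten := by
        have := hq.flip_mem e (by simp [hew])
        rw [List.flatten_cons, List.mem_append] at this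
        exact this.resolve_left he
      obtain ⟨w', hw', hew'⟩ := List.mem_flatten.1 he2
      obtain ⟨P, Q, rfl⟩ := List.append_of_mem hew
      obtain ⟨R, S, rfl⟩ := List.append_of_mem hew'
      obtain ⟨l1, l2, rfl⟩ := List.append_of_mem hw'
      have hp : ((P ++ e :: Q) :: (l1 ++ (R ++ flipLetter e :: S) :: l2)).Perm
          ((P ++ e :: Q) :: (R ++ flipLetter e :: S) :: (l1 ++ l2)) :=
        List.Perm.cons _ List.perm_middle
      have hq' := hq.perm hp.flatten
      have hc' : IsFaceConnected ((P ++ e :: Q) :: (R ++ flipLetter e :: S) :: (l1 ++ l2)) := by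
        intro f hf s hs t ht
        exact hc f (fun w hw => hf w (hp.mem_iff.1 hw)) s (hp.flatten.mem_iff.2 hs) t
          (hp.flatten.mem_iff.2 ht)
      have h' : GaugePresents ((P ++ e :: Q) :: (R ++ flipLetter e :: S) :: (l1 ++ l2)) k :=
        h.of_faces fun w _ => hp.mem_iff
      have hperm : ((P ++ e :: Q) :: (R ++ flipLetter e :: S) :: (l1 ++ l2)).flatten.Perm
          (e :: flipLetter e :: ((R ++ (Q ++ (P ++ S))) :: (l1 ++ l2)).flatten) := by
        classical
        rw [List.perm_iff_count]
        intro x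
        simp [List.count_cons]
        omega
      refine ih _ (hq'.perm hperm).of_cons_cons.1 (hc'.merge hq') (h'.merge hq') ?_
      simp at hn ⊢
      omega

end faces

/-! ### Contracting edges between different vertices -/

lemma wordVal_gauge {α K : Type*} [Group K] {g : α × Bool → K} {k k' : α → K} {v u : K}
    {w : List (α × Bool)} (hw : IsLabelledPath g v w u)
    (hk : ∀ s ∈ w, letterVal k' s = g s * letterVal k s * (g (flipLetter s))⁻¹) :
    wordVal k' w = v * wordVal k w * u⁻¹ := by
  induction w generalizing v with
  | nil =>
    have : v = u := hw
    simp [this]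
  | cons s w ih =>
    rw [wordVal_cons, wordVal_cons, ih hw.2 (fun s hs => hk s (by simp [hs])), hk s (by simp),
      hw.1]
    group

/-- The target of each letter is the source of the next, so the difference of the two sums
telescopes. -/
lemma IsLabelledPath.sum_eq {α : Type*} {f : α × Bool → ℤ} {v u : ℤ} {w : List (α × Bool)}
    (hw : IsLabelledPath f v w u) :
    (w.map fun s => f (flipLetter s)).sum - (w.map f).sum = u - v := by
  induction w generalizing v with
  | nil =>
    have : v = u := hw
    simp [this]
  | cons s w ih =>
    have := ih hw.2
    have h1 := hw.1
    simp only [List.map_cons, List.sum_cons]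
    linarith

lemma IsQuadratic.map_flip_perm {α : Type*} {w : List (α × Bool)} (h : IsQuadratic w) :
    (w.map flipLetter).Perm w := by
  refine (List.perm_ext_iff_of_nodup (h.nodup.map flipLetter_injective) h.nodup).2 fun s => ?_
  rw [List.mem_map]
  constructor
  · rintro ⟨t, ht, rfl⟩
    exact h.flip_mem t ht
  · intro hs
    exact ⟨flipLetter s, h.flip_mem s hs, by simp⟩

/-- A closed labelling of the contracted word gives both ends of the rest of the word the same
label, if the contracted edge joins different vertices. -/
lemma IsQuadratic.eq_of_contract {α V : Type*} {P Q R : List (α × Bool)}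
    (h : IsQuadratic (P ++ (Q ++ R))) {f : α × Bool → V} {v a b : V}
    (hP : IsLabelledPath f v P a) (hQ : IsLabelledPath f a Q b) (hR : IsLabelledPath f b R v)
    {f₀ : α × Bool → Bool} {v₀ p q : Bool} (hpq : p ≠ q) (hP₀ : IsLabelledPath f₀ v₀ P p)
    (hQ₀ : IsLabelledPath f₀ q Q q) (hR₀ : IsLabelledPath f₀ p R v₀) : a = b := by
  classical
  -- Count passages through the vertex labelled `(a, p)`. Inverse letters exchange sources and
  -- targets, so the total change along the word is 0. The path jumps from `(a, p)` to `(a, q)`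
  -- after `P` and from `(b, q)` to `(b, p)` after `Q`; as `p ≠ q`, the count balances only if `b =
  -- a`.
  let c : V → Bool → ℤ := fun x y => (if x = a then 1 else 0) * (if y = p then 1 else 0)
  have sP := (hP.map₂ c hP₀).sum_eq
  have sQ := (hQ.map₂ c hQ₀).sum_eq
  have sR := (hR.map₂ c hR₀).sum_eq
  have key := (h.map_flip_perm.map fun s => c (f s) (f₀ s)).sum_eq
  simp only [List.map_append, List.sum_append, List.map_map, Function.comp_def] at key
  have hca : c a p = 1 := by simp [c]
  have hqa : c a q = 0 := by simp [c, hpq.symm]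
  have hqb : c b q = 0 := by simp [c, hpq.symm]
  have : c b p = 1 := by linarith
  by_contra hne
  simp [c, Ne.symm hne] at this

section contract
variable {α K : Type} [Group K]

/-- Contracting an edge with two different ends does not change the fundamental group. The
two-colouring `f₀` separates these ends, which permits a gauge that makes the value of the edge
trivial. -/
lemma GaugePresents.contract {P Q R : List (α × Bool)} {e : α × Bool} {k : α → K}
    (hq : IsQuadratic (P ++ e :: (Q ++ flipLetter e :: R)))
    (h : GaugePresents [P ++ e :: (Q ++ flipLetter e :: R)] k) {f₀ : α × Bool → Bool} {v₀ : Bool}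
    (hf₀ : IsLabelledPath f₀ v₀ (P ++ e :: (Q ++ flipLetter e :: R)) v₀)
    (he₀ : f₀ e ≠ f₀ (flipLetter e)) :
    IsQuadratic (P ++ (Q ++ R)) ∧ ∃ k' : α → K, GaugePresents [P ++ (Q ++ R)] k' := by
  have hperm : (P ++ e :: (Q ++ flipLetter e :: R)).Perm
      (e :: flipLetter e :: (P ++ (Q ++ R))) := by
    classical
    rw [List.perm_iff_count]
    intro x
    simp [List.count_cons]
    omega
  obtain ⟨hq', he, he'⟩ := (hq.perm hperm).of_cons_cons
  have hne := fun {s} => IsQuadratic.ne_of_mem he he' (s := s)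
  simp only [List.mem_append, not_or] at he he'
  obtain ⟨heP, heQ, heR⟩ := he
  obtain ⟨heP', heQ', heR'⟩ := he'
  refine ⟨hq', ?_⟩
  -- Regauging by `c` at every vertex coloured like the source of `e`, and by 1 elsewhere, turns the
  -- value of `e` into 1.
  set c := (letterVal k e)⁻¹ with hc
  set γ : α × Bool → K := fun s => if f₀ s = f₀ e then c else 1 with hγ
  have hγe : γ e = c := by simp [hγ]
  have hγe' : γ (flipLetter e) = 1 := by simp [hγ, he₀.symm]
  have hγp : IsLabelledPath γ (if v₀ = f₀ e then c else 1) (P ++ e :: (Q ++ flipLetter e :: R))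
      (if v₀ = f₀ e then c else 1) := hf₀.comp (fun x => if x = f₀ e then c else 1)
  set k' : α → K := fun a => γ (a, true) * k a * (γ (a, false))⁻¹ with hk'
  have hk : ∀ s, letterVal k' s = γ s * letterVal k s * (γ (flipLetter s))⁻¹ := by
    rintro ⟨a, b⟩
    cases b <;> simp [letterVal, hk', flipLetter, mul_assoc]
  have hke : letterVal k' e = 1 := by rw [hk, hγe, hγe', hc]; simp
  simp only [isLabelledPath_append, isLabelledPath_cons, flipLetter_flipLetter] at hf₀
  obtain ⟨p, hP₀, hp, q, hQ₀, hq₀, hR₀⟩ := hf₀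
  subst hp hq₀
  refine ⟨k', ?_, ?_, ?_⟩
  · intro w hw
    obtain rfl := List.mem_singleton.1 hw
    have := wordVal_gauge hγp (fun s _ => hk s)
    rw [h.rel _ (List.mem_singleton_self _)] at this
    simpa [hke] using this
  · intro M g hg hM
    obtain ⟨v, hv⟩ := hg _ (List.mem_singleton_self _)
    simp only [isLabelledPath_append] at hv
    obtain ⟨a, hP, b, hQ, hR⟩ := hv
    -- Both ends of the removed edge get the same label, so the edge can be put back with equal ends
    -- and trivial value.
    obtain rfl := hq'.eq_of_contract hP hQ hR he₀ hP₀ hQ₀ hR₀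
    have hclosed : IsLabelledPath (setEnds g e a a) v (P ++ e :: (Q ++ flipLetter e :: R)) v := by
      simp only [isLabelledPath_append, isLabelledPath_cons, flipLetter_flipLetter, setEnds_self,
        setEnds_flip, isLabelledPath_setEnds _ _ _ heP heP', isLabelledPath_setEnds _ _ _ heQ heQ',
        isLabelledPath_setEnds _ _ _ heR heR']
      exact ⟨a, hP, rfl, a, hQ, rfl, hR⟩
    refine h.gen M (fun s => setEnds g e a a s * γ s) ?_ ?_
    · intro w hw
      obtain rfl := List.mem_singleton.1 hw
      exact ⟨_, hclosed.map₂ (· * ·) hγp⟩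
    · intro s hs
      have : setEnds g e a a s * γ s * letterVal k s *
          (setEnds g e a a (flipLetter s) * γ (flipLetter s))⁻¹ =
          setEnds g e a a s * letterVal k' s * (setEnds g e a a (flipLetter s))⁻¹ := by
        rw [hk]; group
      rw [this]
      rw [List.flatten_singleton, hperm.mem_iff, List.mem_cons, List.mem_cons] at hs
      rcases hs with rfl | rfl | hs
      · rw [setEnds_self, setEnds_flip, hke]
        simp [M.one_mem]
      · rw [flipLetter_flipLetter, setEnds_self, setEnds_flip, letterVal_flipLetter, hke]
        simp [M.one_mem]
      · have h3 := hne hs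
        rw [setEnds_of_ne _ _ _ h3.1 h3.2, setEnds_of_ne _ _ _ _ _]
        · exact hM s (by simpa using hs)
        · exact fun h => h3.2 (by rw [← h, flipLetter_flipLetter])
        · exact fun h => h3.1 (flipLetter_injective h)
  · intro H _ u hu
    have hu1 := hu _ (List.mem_singleton_self _)
    have hv : ∀ (w : List (α × Bool)), e ∉ w → flipLetter e ∉ w →
        wordVal (setLetter u e 1) w = wordVal u w := by
      intro w h1 h2
      apply wordVal_congr
      intro s hs
      have := IsQuadratic.ne_of_mem h1 h2 hs
      exact letterVal_setLetter_of_ne _ _ this.1 this.2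
    obtain ⟨θ, g, hg, hθ⟩ := h.univ H (setLetter u e 1) (by
      intro w hw
      obtain rfl := List.mem_singleton.1 hw
      simp only [wordVal_append] at hu1
      simpa [hv P heP heP', hv Q heQ heQ', hv R heR heR'] using hu1)
    have hg' : ∀ s ∈ P ++ e :: (Q ++ flipLetter e :: R), letterVal (setLetter u e 1) s =
        (g s * (θ (γ s))⁻¹) * θ (letterVal k' s) *
          (g (flipLetter s) * (θ (γ (flipLetter s)))⁻¹)⁻¹ := by
      intro s hs
      rw [hθ s (by simpa using hs), hk]
      simp only [map_mul, map_inv]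
      group
    have hge := hg' e (by simp)
    rw [letterVal_setLetter_self, hke, map_one, mul_one, eq_mul_inv_iff_mul_eq, one_mul] at hge
    refine ⟨θ, fun s => g s * (θ (γ s))⁻¹, ?_, ?_⟩
    · intro w hw
      obtain rfl := List.mem_singleton.1 hw
      obtain ⟨v, hv⟩ := hg _ (List.mem_singleton_self _)
      have := hv.map₂ (fun x y => x * (θ y)⁻¹) hγp
      simp only [isLabelledPath_append, isLabelledPath_cons, flipLetter_flipLetter] at this
      obtain ⟨a, hP, ha, b, hQ, hb, hR⟩ := this
      subst ha hb
      rw [hge] at hQ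
      refine ⟨v * (θ (if v₀ = f₀ e then c else 1))⁻¹, ?_⟩
      simp only [isLabelledPath_append]
      exact ⟨_, hP, _, hQ, hR⟩
    · intro s hs
      rw [List.flatten_singleton] at hs
      have h3 := hne hs
      rw [← hg' s (by rw [hperm.mem_iff]; simp only [List.mem_cons, hs, or_true]),
        letterVal_setLetter_of_ne _ _ h3.1 h3.2]

/-- Every closed labelling of the word is constant, that is, the surface glued from the word has
one vertex. -/
def IsRigid (w : List (α × Bool)) : Prop :=
  ∀ (f : α × Bool → Bool) (v : Bool), IsLabelledPath f v w v → ∀ s ∈ w, f s = v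

/-- Two colours suffice to test rigidity: compose any labelling with the indicator of one label. -/
lemma IsRigid.eq {V : Type*} {w : List (α × Bool)} (h : IsRigid w) {f : α × Bool → V} {v : V}
    (hw : IsLabelledPath f v w v) : ∀ s ∈ w, f s = v := by
  classical
  intro s hs
  have := h _ _ (hw.comp (fun x => decide (x = v))) s hs
  simpa using this

/-- If no closed two-colouring separates the ends of an edge, each one is constant along the word.
Otherwise the separated edge is contracted, and the word becomes shorter by two letters. -/
lemma GaugePresents.exists_rigid (w : List (α × Bool)) (k : α → K) (hq : IsQuadratic w)
    (h : GaugePresents [w] k) :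
    ∃ (w' : List (α × Bool)) (k' : α → K), IsQuadratic w' ∧ IsRigid w' ∧
      GaugePresents [w'] k' := by
  induction hn : w.length using Nat.strong_induction_on generalizing w k with
  | _ n ih =>
    by_cases hr : ∀ (f : α × Bool → Bool) (v : Bool), IsLabelledPath f v w v →
        ∀ s ∈ w, f (flipLetter s) = f s
    · exact ⟨w, k, hq, fun f v hf => hf.eq_of_flat (hr f v hf), h⟩
    · push Not at hr
      obtain ⟨f, v, hf, s, hs, hne⟩ := hr
      obtain ⟨P, e, Q, R, rfl, he⟩ : ∃ P e Q R, w = P ++ e :: (Q ++ flipLetter e :: R) ∧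
          f e ≠ f (flipLetter e) := by
        obtain ⟨A, B, rfl⟩ := List.append_of_mem hs
        have hs' := hq.flip_mem s hs
        simp only [List.mem_append, List.mem_cons, flipLetter_ne, false_or] at hs'
        rcases hs' with hs' | hs'
        · obtain ⟨P, Q, rfl⟩ := List.append_of_mem hs'
          exact ⟨P, flipLetter s, Q, B, by simp, by simpa using hne⟩
        · obtain ⟨Q, R, rfl⟩ := List.append_of_mem hs'
          exact ⟨A, s, Q, R, by simp, hne.symm⟩
      obtain ⟨hq', k', hk'⟩ := h.contract hq hf he
      refine ih _ ?_ _ _ hq' hk' rfl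
      simp at hn ⊢
      omega

end contract

/-! ### Extracting handles -/

/-- The commutator `x y x⁻¹ y⁻¹` of the `i`-th pair, multiplied over all `i`. -/
def handleProd {K : Type*} [Group K] {m : ℕ} (A B : Fin m → K) : K :=
  (List.ofFn fun i => A i * B i * (A i)⁻¹ * (B i)⁻¹).prod

lemma handleProd_cons {K : Type*} [Group K] {m : ℕ} (a b : K) (A B : Fin m → K) :
    handleProd (Fin.cons a A) (Fin.cons b B) = a * b * a⁻¹ * b⁻¹ * handleProd A B := by
  simp [handleProd, List.ofFn_succ]

/-- `K` is presented by the letters of `w` and `m` further pairs of generators, with the relation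
that `w` times the product of the commutators of the pairs is trivial. -/
structure HandlePresents {α K : Type} [Group K] (w : List (α × Bool)) (k : α → K) {m : ℕ}
    (A B : Fin m → K) : Prop where
  rel : wordVal k w * handleProd A B = 1
  gen : ∀ M : Subgroup K, (∀ s ∈ w, letterVal k s ∈ M) → (∀ i, A i ∈ M) → (∀ i, B i ∈ M) → M = ⊤
  univ : ∀ (H : Type) [Group H] (h : α → H) (A' B' : Fin m → H),
    wordVal h w * handleProd A' B' = 1 →
    ∃ θ : K →* H, (∀ s ∈ w, θ (letterVal k s) = letterVal h s) ∧ (∀ i, θ (A i) = A' i) ∧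
      ∀ i, θ (B i) = B' i

section handles
variable {α K : Type} [Group K]

/-- With a single vertex a gauge is a single group element, and conjugation by it can be absorbed in
the homomorphism. This turns the description up to gauge into an honest presentation. -/
lemma GaugePresents.handlePresents {w : List (α × Bool)} {k : α → K} (hr : IsRigid w)
    (h : GaugePresents [w] k) : HandlePresents w k (Fin.elim0 : Fin 0 → K) Fin.elim0 := by
  refine ⟨?_, ?_, ?_⟩
  · simpa [handleProd] using h.rel w (by simp)
  · intro M hM _ _
    refine h.gen M (fun _ => 1) ?_ ?_
    · exact fun w _ => ⟨1, isLabelledPath_const (by simp)⟩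
    · intro s hs
      simpa using hM s (by simpa using hs)
  · intro H _ u A' B' hu
    obtain ⟨θ, g, hg, hθ⟩ := h.univ H u (by simpa [handleProd] using hu)
    obtain ⟨v, hv⟩ := hg w (by simp)
    have hgv := hr.eq hv
    have hgv' : ∀ s ∈ w, g (flipLetter s) = v := by
      intro s hs
      obtain ⟨X, Y, rfl⟩ := List.append_of_mem hs
      simp only [isLabelledPath_append, isLabelledPath_cons] at hv
      obtain ⟨-, -, -, hY⟩ := hv
      rcases Y with _ | ⟨t, Y⟩
      · exact hY
      · rw [← hgv t (by simp)]
        exact hY.1.symm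
    refine ⟨(MulAut.conj v).toMonoidHom.comp θ, ?_, fun i => i.elim0, fun i => i.elim0⟩
    intro s hs
    rw [hθ s (by simpa using hs), hgv s hs, hgv' s hs]
    simp

lemma IsRigid.handle {P Q R S : List (α × Bool)} {a b : α × Bool}
    (hq : IsQuadratic (a :: (P ++ b :: (Q ++ flipLetter a :: (R ++ flipLetter b :: S)))))
    (h : IsRigid (a :: (P ++ b :: (Q ++ flipLetter a :: (R ++ flipLetter b :: S))))) :
    IsQuadratic (R ++ (Q ++ (P ++ S))) ∧ IsRigid (R ++ (Q ++ (P ++ S))) ∧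
      (∀ s ∈ R ++ (Q ++ (P ++ S)), (s ≠ a ∧ s ≠ flipLetter a) ∧ s ≠ b ∧ s ≠ flipLetter b) ∧
      b ≠ a ∧ b ≠ flipLetter a := by
  have hperm : (a :: (P ++ b :: (Q ++ flipLetter a :: (R ++ flipLetter b :: S)))).Perm
      (a :: flipLetter a :: b :: flipLetter b :: (R ++ (Q ++ (P ++ S)))) := by
    classical
    rw [List.perm_iff_count]
    intro x
    simp [List.count_cons]
    omega
  obtain ⟨hq1, ha, ha'⟩ := (hq.perm hperm).of_cons_cons
  obtain ⟨hq2, hb, hb'⟩ := hq1.of_cons_cons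
  have hne : ∀ s ∈ R ++ (Q ++ (P ++ S)),
      (s ≠ a ∧ s ≠ flipLetter a) ∧ s ≠ b ∧ s ≠ flipLetter b := by
    intro s hs
    refine ⟨?_, IsQuadratic.ne_of_mem hb hb' hs⟩
    exact IsQuadratic.ne_of_mem ha ha' (by simp only [List.mem_cons, hs, or_true])
  have hba : b ≠ a ∧ b ≠ flipLetter a := IsQuadratic.ne_of_mem ha ha' (by simp)
  have hba' : flipLetter b ≠ a ∧ flipLetter b ≠ flipLetter a :=
    IsQuadratic.ne_of_mem ha ha' (by simp)
  refine ⟨hq2, ?_, hne, hba⟩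
  intro f v hf s hs
  simp only [isLabelledPath_append] at hf
  obtain ⟨m1, hR, m2, hQ, m3, hP, hS⟩ := hf
  simp only [List.mem_cons, List.mem_append, not_or] at ha ha' hb hb'
  -- The ends of the reinserted edges are read off from the path along `R Q P S`: `a` runs from `v`
  -- to `m2` and `b` from `m3` to `m1`.
  set F := setEnds (setEnds f a v m2) b m3 m1 with hF
  have hFa : F a = v := by
    rw [hF, setEnds_of_ne _ _ _ hba.1.symm (fun h => hba'.1 h.symm), setEnds_self]
  have hFa' : F (flipLetter a) = m2 := by
    rw [hF, setEnds_of_ne _ _ _ hba.2.symm (fun h => hba'.2 h.symm), setEnds_flip]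
  have hFb : F b = m3 := by rw [hF, setEnds_self]
  have hFb' : F (flipLetter b) = m1 := by rw [hF, setEnds_flip]
  have hFp : ∀ w, (a ∉ w ∧ flipLetter a ∉ w ∧ b ∉ w ∧ flipLetter b ∉ w) → ∀ x y,
      (IsLabelledPath F x w y ↔ IsLabelledPath f x w y) := by
    rintro w ⟨h1, h2, h3, h4⟩ x y
    rw [hF, isLabelledPath_setEnds _ _ _ h3 h4, isLabelledPath_setEnds _ _ _ h1 h2]
  have key := h F v (by
    simp only [isLabelledPath_append, isLabelledPath_cons, flipLetter_flipLetter, hFa, hFa', hFb,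
      hFb', true_and]
    refine ⟨m3, (hFp P (by tauto) _ _).2 hP, rfl, m2, (hFp Q (by tauto) _ _).2 hQ, rfl, m1,
      (hFp R (by tauto) _ _).2 hR, rfl, (hFp S (by tauto) _ _).2 hS⟩) s
    (by rw [hperm.mem_iff]; simp only [List.mem_cons, hs, or_true])
  have h3 := hne s hs
  rwa [hF, setEnds_of_ne _ _ _ h3.2.1 h3.2.2, setEnds_of_ne _ _ _ h3.1.1 h3.1.2] at key

lemma HandlePresents.handle {P Q R S : List (α × Bool)} {a b : α × Bool} {k : α → K} {m : ℕ}
    {A B : Fin m → K}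
    (hne : ∀ s ∈ R ++ (Q ++ (P ++ S)), (s ≠ a ∧ s ≠ flipLetter a) ∧ s ≠ b ∧ s ≠ flipLetter b)
    (hba : b ≠ a ∧ b ≠ flipLetter a)
    (h : HandlePresents (a :: (P ++ b :: (Q ++ flipLetter a :: (R ++ flipLetter b :: S)))) k A B) :
    ∃ x y : K, HandlePresents (R ++ (Q ++ (P ++ S))) k (Fin.cons x A : Fin (m + 1) → K)
      (Fin.cons y B) := by
  simp only [List.mem_append] at hne
  set p := wordVal k P with hp
  set q := wordVal k Q with hq
  set r := wordVal k R with hr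
  set t := wordVal k S with ht
  -- `x` and `y` are chosen so that `a p b q a⁻¹ r b⁻¹ t = r q p t (x y x⁻¹ y⁻¹)`. Both
  -- substitutions are invertible over `p, q, r, t`, so they only change generators.
  set x := (r * q * p * t)⁻¹ * letterVal k a * p * t with hx
  set y := t⁻¹ * letterVal k b * q * p * t with hy
  have hxa : letterVal k a = r * q * p * t * x * t⁻¹ * p⁻¹ := by rw [hx]; group
  have hyb : letterVal k b = t * y * t⁻¹ * p⁻¹ * q⁻¹ := by rw [hy]; group
  refine ⟨x, y, ?_, ?_, ?_⟩
  · have := h.rel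
    simp only [wordVal_cons, wordVal_append, letterVal_flipLetter, ← hp, ← hq, ← hr, ← ht, hxa,
      hyb] at this
    rw [handleProd_cons]
    simp only [wordVal_append, ← hp, ← hq, ← hr, ← ht]
    rw [← this]
    group
  · intro M hM hA hB
    have hmem : ∀ w : List (α × Bool), (∀ s ∈ w, s ∈ R ++ (Q ++ (P ++ S))) → wordVal k w ∈ M :=
      fun w hw => wordVal_mem M k w fun s hs => hM s (hw s hs)
    have hpM : p ∈ M := hmem P (by simp +contextual)
    have hqM : q ∈ M := hmem Q (by simp +contextual)
    have hrM : r ∈ M := hmem R (by simp +contextual)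
    have htM : t ∈ M := hmem S (by simp +contextual)
    have hxM : x ∈ M := by simpa using hA 0
    have hyM : y ∈ M := by simpa using hB 0
    have haM : letterVal k a ∈ M := by
      rw [hxa]
      exact M.mul_mem (M.mul_mem (M.mul_mem (M.mul_mem (M.mul_mem (M.mul_mem hrM hqM) hpM) htM)
        hxM) (M.inv_mem htM)) (M.inv_mem hpM)
    have hbM : letterVal k b ∈ M := by
      rw [hyb]
      exact M.mul_mem (M.mul_mem (M.mul_mem (M.mul_mem htM hyM) (M.inv_mem htM)) (M.inv_mem hpM))
        (M.inv_mem hqM)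
    refine h.gen M ?_ (fun i => by simpa using hA i.succ) (fun i => by simpa using hB i.succ)
    intro s hs
    simp only [List.mem_cons, List.mem_append] at hs
    rcases hs with rfl | hs | rfl | hs | rfl | hs | rfl | hs
    · exact haM
    · exact hM s (by simp [hs])
    · exact hbM
    · exact hM s (by simp [hs])
    · simpa using haM
    · exact hM s (by simp [hs])
    · simpa using hbM
    · exact hM s (by simp [hs])
  · intro H _ u A' B' hu
    set p' := wordVal u P with hp'
    set q' := wordVal u Q with hq'
    set r' := wordVal u R with hr'
    set t' := wordVal u S with ht'
    set u' := setLetter (setLetter u a (r' * q' * p' * t' * A' 0 * t'⁻¹ * p'⁻¹)) b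
      (t' * B' 0 * t'⁻¹ * p'⁻¹ * q'⁻¹) with hu'
    have hs : ∀ s, (s ∈ R ∨ s ∈ Q ∨ s ∈ P ∨ s ∈ S) → letterVal u' s = letterVal u s := by
      intro s hs
      have := hne s hs
      rw [hu', letterVal_setLetter_of_ne _ _ this.2.1 this.2.2,
        letterVal_setLetter_of_ne _ _ this.1.1 this.1.2]
    have ha : letterVal u' a = r' * q' * p' * t' * A' 0 * t'⁻¹ * p'⁻¹ := by
      rw [hu', letterVal_setLetter_of_ne _ _ hba.1.symm, letterVal_setLetter_self]
      exact fun h => hba.2 (by rw [h, flipLetter_flipLetter])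
    have hb : letterVal u' b = t' * B' 0 * t'⁻¹ * p'⁻¹ * q'⁻¹ := by
      rw [hu', letterVal_setLetter_self]
    have eP : wordVal u' P = p' := wordVal_congr fun s h => hs s (by simp [h])
    have eQ : wordVal u' Q = q' := wordVal_congr fun s h => hs s (by simp [h])
    have eR : wordVal u' R = r' := wordVal_congr fun s h => hs s (by simp [h])
    have eS : wordVal u' S = t' := wordVal_congr fun s h => hs s (by simp [h])
    obtain ⟨θ, h1, h2, h3⟩ := h.univ H u' (fun i => A' i.succ) (fun i => B' i.succ) (by
      have e1 : handleProd A' B' = A' 0 * B' 0 * (A' 0)⁻¹ * (B' 0)⁻¹ *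
          handleProd (fun i => A' i.succ) (fun i => B' i.succ) := by
        simp [handleProd, List.ofFn_succ]
      rw [e1] at hu
      simp only [wordVal_append, ← hp', ← hq', ← hr', ← ht'] at hu
      simp only [wordVal_cons, wordVal_append, letterVal_flipLetter, eP, eQ, eR, eS, ha, hb]
      rw [← hu]
      group)
    have θP : θ p = p' := by
      rw [hp, map_wordVal θ k u' P (fun s h => h1 s (by simp [h])), eP]
    have θQ : θ q = q' := by
      rw [hq, map_wordVal θ k u' Q (fun s h => h1 s (by simp [h])), eQ]
    have θR : θ r = r' := by
      rw [hr, map_wordVal θ k u' R (fun s h => h1 s (by simp [h])), eR]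
    have θS : θ t = t' := by
      rw [ht, map_wordVal θ k u' S (fun s h => h1 s (by simp [h])), eS]
    have θa := h1 a (by simp)
    have θb := h1 b (by simp)
    refine ⟨θ, ?_, ?_, ?_⟩
    · intro s hs'
      simp only [List.mem_append] at hs'
      rw [← hs s hs']
      apply h1
      simp only [List.mem_cons, List.mem_append]
      tauto
    · intro i
      refine Fin.cases ?_ (fun i => ?_) i
      · simp only [Fin.cons_zero, hx, map_mul, map_inv, θP, θQ, θR, θS, θa, ha]
        group
      · simpa using h2 i
    · intro i
      refine Fin.cases ?_ (fun i => ?_) i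
      · simp only [Fin.cons_zero, hy, map_mul, map_inv, θP, θQ, θS, θb, hb]
        group
      · simpa using h3 i

/-- In a rigid word some letter is linked with the first one. -/
lemma IsRigid.exists_linked {a : α × Bool} {w : List (α × Bool)} (hq : IsQuadratic (a :: w))
    (h : IsRigid (a :: w)) : ∃ P b Q R S,
      a :: w = a :: (P ++ b :: (Q ++ flipLetter a :: (R ++ flipLetter b :: S))) := by
  classical
  have ha : flipLetter a ∈ w := by
    have := hq.flip_mem a (by simp)
    simpa [flipLetter_ne] using this
  obtain ⟨X, Y, rfl⟩ := List.append_of_mem ha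
  by_cases hX : ∀ b ∈ X, flipLetter b ∈ X
  · exfalso
    have hnd := hq.nodup
    simp only [List.nodup_cons, List.nodup_append', List.mem_append, List.mem_cons, not_or] at hnd
    obtain ⟨⟨haX, -, haY⟩, hXn, ⟨haY', hYn⟩, hd⟩ := hnd
    rw [List.disjoint_cons_right] at hd
    have hY : ∀ b ∈ Y, b ∉ X ∧ flipLetter b ∉ X := fun b hb =>
      ⟨fun h => hd.2 h hb, fun h => hd.2 (by simpa using hX _ h) hb⟩
    -- If every edge between `a` and its inverse closes up there, this segment and the remainder
    -- have no vertex in common, and colouring them differently contradicts rigidity.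
    let f : α × Bool → Bool := fun s => decide (s ∈ X ∨ s = flipLetter a)
    have hfa : f a = false := by
      simp [f, haX, (flipLetter_ne a).symm]
    have hfa' : f (flipLetter a) = true := by simp [f]
    have := h f false (by
      simp only [isLabelledPath_cons, isLabelledPath_append, flipLetter_flipLetter, hfa, hfa',
        true_and]
      refine ⟨true, isLabelledPath_const ?_, rfl, isLabelledPath_const ?_⟩
      · intro s hs
        simp [f, hs, hX s hs]
      · intro s hs
        have h1 : s ≠ flipLetter a := fun h => haY' (h ▸ hs)
        have h2 : s ≠ a := fun h => haY (h ▸ hs)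
        simp [f, hY s hs, h1, flipLetter_injective.eq_iff, h2]) (flipLetter a) (by simp)
    rw [hfa'] at this
    exact absurd this (by simp)
  · push Not at hX
    obtain ⟨b, hb, hb'⟩ := hX
    have h1 := hq.flip_mem b (by simp [hb])
    have h2 : b ≠ a := by
      rintro rfl
      have := hq.nodup
      simp [hb] at this
    have h3 : b ≠ flipLetter a := by
      rintro rfl
      have := hq.nodup
      simp [List.nodup_append', hb] at this
    have h4 : flipLetter b ∈ Y := by
      simp only [List.mem_cons, List.mem_append, hb', false_or, flipLetter_injective.eq_iff,
        h2] at h1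
      rcases h1 with h1 | h1
      · exact absurd (by rw [← h1, flipLetter_flipLetter]) h3
      · exact h1
    obtain ⟨P, Q, rfl⟩ := List.append_of_mem hb
    obtain ⟨R, S, rfl⟩ := List.append_of_mem h4
    exact ⟨P, b, Q, R, S, by simp⟩

/-- Linked pairs exist as long as the word is nonempty. Extracting one removes four letters and
keeps the word quadratic and rigid. -/
lemma HandlePresents.exists_nil (w : List (α × Bool)) (k : α → K) {m : ℕ} (A B : Fin m → K)
    (hq : IsQuadratic w) (hr : IsRigid w) (h : HandlePresents w k A B) :
    ∃ (m' : ℕ) (A' B' : Fin m' → K), HandlePresents [] k A' B' := by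
  induction hn : w.length using Nat.strong_induction_on generalizing w m with
  | _ n ih =>
    rcases w with _ | ⟨a, w⟩
    · exact ⟨m, A, B, h⟩
    · obtain ⟨P, b, Q, R, S, hw⟩ := hr.exists_linked hq
      rw [hw] at hq hr h hn
      obtain ⟨hq', hr', hne, hba⟩ := hr.handle hq
      obtain ⟨x, y, h'⟩ := h.handle hne hba
      refine ih _ ?_ _ _ _ hq' hr' h' rfl
      simp at hn ⊢
      omega

open SignatureGen in
lemma HandlePresents.mulEquiv {k : α → K} {m : ℕ} {A B : Fin m → K}
    (h : HandlePresents [] k A B) :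
    Nonempty (PresentedGroup (relators m (Fin.elim0 : Fin 0 → ℕ)) ≃* K) := by
  let T := PresentedGroup (relators m (Fin.elim0 : Fin 0 → ℕ))
  -- Inverting the generators turns the convention `x y x⁻¹ y⁻¹` for commutators into `a⁻¹ b⁻¹ a b`.
  let F : SignatureGen m 0 → K
    | .a i => (A i)⁻¹
    | .b i => (B i)⁻¹
    | .x i => i.elim0
  have hF : ∀ r ∈ relators m (Fin.elim0 : Fin 0 → ℕ), FreeGroup.lift F r = 1 := by
    rintro r (rfl | ⟨i, -⟩)
    · have := h.rel
      simp only [wordVal_nil, one_mul, handleProd] at this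
      simp only [longRelator, map_mul, map_list_prod, List.map_ofFn, Function.comp_def,
        FreeGroup.lift_apply_of, map_inv, F, inv_inv]
      simpa using this
    · exact i.elim0
  have hT : handleProd (fun i => (PresentedGroup.of (SignatureGen.a i) : T)⁻¹)
      (fun i => (PresentedGroup.of (SignatureGen.b i) : T)⁻¹) = 1 := by
    have : (PresentedGroup.mk (relators m (Fin.elim0 : Fin 0 → ℕ))) (longRelator m 0) = 1 :=
      PresentedGroup.one_of_mem (Set.mem_insert _ _)
    simp only [longRelator, map_mul, map_list_prod, List.map_ofFn, Function.comp_def,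
      map_inv] at this
    simpa [handleProd, PresentedGroup.of] using this
  obtain ⟨θ, -, h2, h3⟩ := h.univ T (fun _ => 1) _ _ (by simpa using hT)
  refine ⟨MonoidHom.toMulEquiv (PresentedGroup.toGroup hF) θ ?_ ?_⟩
  · ext s
    rcases s with i | i | i
    · simp [F, h2]
    · simp [F, h3]
    · exact i.elim0
  · have := h.gen (MonoidHom.eqLocus ((PresentedGroup.toGroup hF).comp θ) (MonoidHom.id K))
      (by simp) (fun i => ?_) (fun i => ?_)
    · ext x
      have hx : x ∈ (⊤ : Subgroup K) := trivial
      rw [← this] at hx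
      exact hx
    · change PresentedGroup.toGroup hF (θ (A i)) = A i
      rw [h2, map_inv, PresentedGroup.toGroup.of]
      simp [F]
    · change PresentedGroup.toGroup hF (θ (B i)) = B i
      rw [h3, map_inv, PresentedGroup.toGroup.of]
      simp [F]

/-- The fundamental group of a connected closed oriented surface, glued from polygons, is a surface
group. -/
theorem GaugePresents.mulEquiv_surfaceGroup {fs : List (List (α × Bool))} {k : α → K}
    (hq : IsQuadratic fs.flatten) (hc : IsFaceConnected fs) (h : GaugePresents fs k) :
    ∃ m : ℕ,
      Nonempty (PresentedGroup (SignatureGen.relators m (Fin.elim0 : Fin 0 → ℕ)) ≃* K) := by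
  obtain ⟨w, hw, hk⟩ := h.exists_single_face fs k hq hc
  obtain ⟨w', k', hw', hr', hk'⟩ := hk.exists_rigid w k hw
  obtain ⟨m, A, B, hm⟩ := (hk'.handlePresents hr').exists_nil w' k' _ _ hw' hr'
  exact ⟨m, hm.mulEquiv⟩

end handles

/-! ### Lifting words to a cyclic cover -/

section lifts
variable {S : Type} {n : ℕ} (c : S → ZMod n)

/-- The change of sheet along a signed letter. -/
def letterShift (s : S × Bool) : ZMod n := if s.2 then c s.1 else -c s.1

/-- The change of sheet along a word. -/
def wordShift (w : List (S × Bool)) : ZMod n := (w.map (letterShift c)).sum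

/-- The lift of a signed letter that starts in the sheet `i`. -/
def liftLetter (i : ZMod n) (s : S × Bool) : (S × ZMod n) × Bool :=
  ((s.1, if s.2 then i else i - c s.1), s.2)

/-- The lift of a word that starts in the sheet `i`. -/
def liftWord : ZMod n → List (S × Bool) → List ((S × ZMod n) × Bool)
  | _, [] => []
  | i, s :: w => liftLetter c i s :: liftWord (i + letterShift c s) w

@[simp] lemma liftWord_nil (i : ZMod n) : liftWord c i [] = [] := rfl

@[simp] lemma liftWord_cons (i : ZMod n) (s : S × Bool) (w : List (S × Bool)) :
    liftWord c i (s :: w) = liftLetter c i s :: liftWord c (i + letterShift c s) w := rfl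

@[simp] lemma wordShift_nil : wordShift c [] = 0 := rfl

@[simp] lemma wordShift_cons (s : S × Bool) (w : List (S × Bool)) :
    wordShift c (s :: w) = letterShift c s + wordShift c w := by simp [wordShift]

lemma liftWord_append (i : ZMod n) (w w' : List (S × Bool)) :
    liftWord c i (w ++ w') = liftWord c i w ++ liftWord c (i + wordShift c w) w' := by
  induction w generalizing i with
  | nil => simp
  | cons s w ih => simp [ih, add_assoc]

lemma flipLetter_liftLetter (i : ZMod n) (s : S × Bool) :
    flipLetter (liftLetter c i s) = liftLetter c (i + letterShift c s) (flipLetter s) := by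
  rcases s with ⟨s, b⟩
  cases b <;> simp [liftLetter, flipLetter, letterShift, sub_eq_add_neg]

/-- Forget the sheet of a lifted letter. -/
def baseLetter (s : (S × ZMod n) × Bool) : S × Bool := (s.1.1, s.2)

@[simp] lemma baseLetter_liftLetter (i : ZMod n) (s : S × Bool) :
    baseLetter (liftLetter c i s) = s := rfl

lemma map_baseLetter_liftWord (i : ZMod n) (w : List (S × Bool)) :
    (liftWord c i w).map baseLetter = w := by
  induction w generalizing i with
  | nil => simp
  | cons s w ih => simp [ih]

lemma baseLetter_mem {i : ZMod n} {w : List (S × Bool)} {s : (S × ZMod n) × Bool}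
    (hs : s ∈ liftWord c i w) : baseLetter s ∈ w := by
  have := List.mem_map_of_mem (f := baseLetter) hs
  rwa [map_baseLetter_liftWord] at this

lemma nodup_liftWord {w : List (S × Bool)} (hw : w.Nodup) (i : ZMod n) :
    (liftWord c i w).Nodup :=
  List.Nodup.of_map baseLetter (by rwa [map_baseLetter_liftWord])

lemma liftLetter_injective {i j : ZMod n} {s : S × Bool}
    (h : liftLetter c i s = liftLetter c j s) : i = j := by
  rcases s with ⟨s, b⟩
  cases b <;> simpa [liftLetter] using h

lemma exists_liftLetter (s : (S × ZMod n) × Bool) : ∃ i, liftLetter c i (baseLetter s) = s := by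
  rcases s with ⟨⟨s, j⟩, b⟩
  cases b
  · exact ⟨j + c s, by simp [liftLetter, baseLetter]⟩
  · exact ⟨j, by simp [liftLetter, baseLetter]⟩

/-- A letter has only one position in the word, and the sheet reached there differs from the
starting sheet by a fixed shift. -/
lemma eq_of_mem_liftWord {w : List (S × Bool)} (hw : w.Nodup) {i j : ZMod n}
    {s : (S × ZMod n) × Bool} (hi : s ∈ liftWord c i w) (hj : s ∈ liftWord c j w) : i = j := by
  induction w generalizing i j with
  | nil => simp at hi
  | cons t w ih =>
    rw [List.nodup_cons] at hw
    rw [liftWord_cons, List.mem_cons] at hi hj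
    rcases hi with rfl | hi <;> rcases hj with hj | hj
    · exact liftLetter_injective c hj
    · exact absurd (baseLetter_mem c hj) hw.1
    · rw [hj] at hi
      exact absurd (baseLetter_mem c hi) hw.1
    · simpa using ih hw.2 hi hj

lemma exists_mem_liftWord {w : List (S × Bool)} {s : (S × ZMod n) × Bool}
    (hs : baseLetter s ∈ w) : ∃ i, s ∈ liftWord c i w := by
  obtain ⟨A, B, rfl⟩ := List.append_of_mem hs
  obtain ⟨i, hi⟩ := exists_liftLetter c s
  refine ⟨i - wordShift c A, ?_⟩
  rw [liftWord_append, liftWord_cons]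
  simp [hi]

lemma exists_offset {ws : List (List (S × Bool))} {u : List (S × Bool)} (hu : u ∈ ws) :
    ∃ o : ZMod n, ∀ i, ∀ s ∈ liftWord c (i + o) u, s ∈ liftWord c i ws.flatten := by
  obtain ⟨A, B, rfl⟩ := List.append_of_mem hu
  -- The offset of a block is the total shift of the blocks before it.
  refine ⟨wordShift c A.flatten, fun i s hs => ?_⟩
  simp [liftWord_append, hs]

lemma liftWord_replicate (i : ZMod n) (m : ℕ) (s : S × Bool) :
    liftWord c i (List.replicate m s) =
      (List.range m).map fun t => liftLetter c (i + t • letterShift c s) s := by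
  induction m generalizing i with
  | zero => simp
  | succ m ih =>
    rw [List.replicate_succ, liftWord_cons, ih, List.range_succ_eq_map, List.map_cons,
      List.map_map]
    congr 1
    · simp
    · refine List.map_congr_left fun t _ => ?_
      simp only [Function.comp_apply, Nat.succ_eq_add_one, succ_nsmul']
      rw [add_assoc]

lemma isLabelledPath_liftWord {V : Type*} {g : (S × ZMod n) × Bool → V} {G : ZMod n → V}
    (hg : ∀ i s, g (liftLetter c i s) = G i) (i : ZMod n) (w : List (S × Bool)) :
    IsLabelledPath g (G i) (liftWord c i w) (G (i + wordShift c w)) := by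
  induction w generalizing i with
  | nil => simp
  | cons s w ih =>
    rw [liftWord_cons, isLabelledPath_cons, flipLetter_liftLetter, hg, hg, wordShift_cons,
      ← add_assoc]
    exact ⟨rfl, ih _⟩

/-- A labelling of the lifted letters as a labelling of the letters by functions of the sheet. -/
def baseLabelling {V : Type*} (g : (S × ZMod n) × Bool → V) (s : S × Bool) : ZMod n → V :=
  fun i => g (liftLetter c i s)

lemma isLabelledPath_base {V : Type*} {g : (S × ZMod n) × Bool → V} {v u : ZMod n → V}
    {w : List (S × Bool)}
    (h : ∀ i, IsLabelledPath g (v i) (liftWord c i w) (u (i + wordShift c w))) :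
    IsLabelledPath (baseLabelling c g) v w u := by
  induction w generalizing v with
  | nil =>
    rw [isLabelledPath_nil]
    funext i
    simpa using h i
  | cons s w ih =>
    refine ⟨funext fun i => (h i).1, ih fun i => ?_⟩
    have := (h (i - letterShift c s)).2
    rwa [flipLetter_liftLetter, sub_add_cancel, wordShift_cons, ← add_assoc,
      sub_add_cancel] at this

/-- Along a power of one letter the source of each step is the target of the previous one; only the
first source has to be compared with the initial label `v`. -/
lemma labels_replicate {V : Type*} {g : (S × ZMod n) × Bool → V} {v u : V} {r : ZMod n} {m : ℕ}
    {s : S × Bool} (h : IsLabelledPath g v (liftWord c r (List.replicate m s)) u) :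
    (∀ t < m, baseLabelling c g s (r + t • letterShift c s) =
      if t = 0 then v else baseLabelling c g (flipLetter s) (r + t • letterShift c s)) ∧
    u = if m = 0 then v else baseLabelling c g (flipLetter s) (r + m • letterShift c s) := by
  induction m generalizing r v with
  | zero => exact ⟨by simp, by simpa using (id h : v = u).symm⟩
  | succ m ih =>
    rw [List.replicate_succ, liftWord_cons, isLabelledPath_cons, flipLetter_liftLetter] at h
    obtain ⟨h1, h2⟩ := ih h.2
    have e : ∀ t : ℕ, r + letterShift c s + t • letterShift c s =
        r + (t + 1) • letterShift c s := by
      intro t; rw [succ_nsmul']; abel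
    constructor
    · rintro (_ | t) ht
      · simpa [baseLabelling] using h.1
      · have := h1 t (by omega)
        rw [e] at this
        rw [this]
        rcases t with _ | t
        · simp [baseLabelling]
        · simp
    · rw [h2, e]
      rcases m with _ | m
      · simp [baseLabelling]
      · simp

end lifts

/-! ### The monodromy group of a cyclic cover with coefficients -/

/-- The wreath product of `H` with `ℤ/n`. -/
@[ext] structure SheetWreath (H : Type) (n : ℕ) : Type where
  fn : ZMod n → H
  shift : ZMod n

namespace SheetWreath
variable {H : Type} [Group H] {n : ℕ}

instance : Group (SheetWreath H n) where
  mul x y := ⟨fun i => x.fn i * y.fn (i + x.shift), x.shift + y.shift⟩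
  one := ⟨1, 0⟩
  inv x := ⟨fun i => (x.fn (i - x.shift))⁻¹, -x.shift⟩
  mul_assoc x y z := SheetWreath.ext
    (funext fun i => by
      change x.fn i * y.fn (i + x.shift) * z.fn (i + (x.shift + y.shift)) =
        x.fn i * (y.fn (i + x.shift) * z.fn (i + x.shift + y.shift))
      rw [mul_assoc, add_assoc]) (add_assoc _ _ _)
  one_mul x := SheetWreath.ext
    (funext fun i => by change 1 * x.fn (i + 0) = x.fn i; simp) (zero_add _)
  mul_one x := SheetWreath.ext
    (funext fun i => by change x.fn i * 1 = x.fn i; simp) (add_zero _)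
  inv_mul_cancel x := SheetWreath.ext
    (funext fun i => by
      change (x.fn (i - x.shift))⁻¹ * x.fn (i + -x.shift) = 1
      rw [← sub_eq_add_neg, inv_mul_cancel]) (neg_add_cancel _)

lemma mul_fn (x y : SheetWreath H n) (i : ZMod n) :
    (x * y).fn i = x.fn i * y.fn (i + x.shift) := rfl

lemma mul_shift (x y : SheetWreath H n) : (x * y).shift = x.shift + y.shift := rfl

@[simp] lemma one_fn (i : ZMod n) : (1 : SheetWreath H n).fn i = 1 := rfl

@[simp] lemma one_shift : (1 : SheetWreath H n).shift = 0 := rfl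

lemma inv_fn (x : SheetWreath H n) (i : ZMod n) : (x⁻¹).fn i = (x.fn (i - x.shift))⁻¹ := rfl

lemma inv_shift (x : SheetWreath H n) : (x⁻¹).shift = -x.shift := rfl

/-- The monodromy of a letter. -/
def gen {S : Type} (c : S → ZMod n) (h : S × ZMod n → H) (s : S) : SheetWreath H n :=
  ⟨fun i => h (s, i), c s⟩

variable {S : Type} (c : S → ZMod n) (h : S × ZMod n → H)

lemma letterVal_gen (s : S × Bool) : letterVal (gen c h) s =
    ⟨fun i => letterVal h (liftLetter c i s), letterShift c s⟩ := by
  rcases s with ⟨s, b⟩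
  cases b
  · exact SheetWreath.ext (funext fun i => by simp [letterVal, inv_fn, gen, liftLetter])
      (by simp [letterVal, inv_shift, gen, letterShift])
  · exact SheetWreath.ext (funext fun i => by simp [letterVal, gen, liftLetter])
      (by simp [letterVal, gen, letterShift])

/-- The coordinate `i` of the monodromy of a word is the value of its lift that starts in sheet `i`,
so a relation in the wreath product packages the relations of all its lifts. -/
lemma wordVal_gen (w : List (S × Bool)) : wordVal (gen c h) w =
    ⟨fun i => wordVal h (liftWord c i w), wordShift c w⟩ := by
  induction w with
  | nil => rfl
  | cons s w ih =>
    rw [wordVal_cons, ih, letterVal_gen]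
    exact SheetWreath.ext (funext fun i => by simp [mul_fn]) (by simp [mul_shift])

end SheetWreath

/-! ### The words of the standard presentation -/

namespace SignatureGen

/-- The factors of the long relator, as words. -/
def longBlocks (g k : ℕ) : List (List (SignatureGen g k × Bool)) :=
  (List.ofFn fun j : Fin k => [(x j, true)]) ++
    List.ofFn fun i : Fin g => [(a i, false), (b i, false), (a i, true), (b i, true)]

variable {g k : ℕ}

lemma wordVal_longBlocks {H : Type*} [Group H] (f : SignatureGen g k → H) :
    wordVal f (longBlocks g k).flatten = FreeGroup.lift f (longRelator g k) := by
  have key : ∀ ws : List (List (SignatureGen g k × Bool)),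
      wordVal f ws.flatten = (ws.map (wordVal f)).prod := by
    intro ws
    induction ws with
    | nil => simp
    | cons w ws ih => simp [ih]
  rw [key]
  simp [longBlocks, longRelator, List.map_ofFn, Function.comp_def, letterVal, map_list_prod,
    mul_assoc]

lemma nodup_longBlocks : (longBlocks g k).flatten.Nodup := by
  rw [List.nodup_flatten]
  constructor
  · intro w hw
    simp only [longBlocks, List.mem_append, List.mem_ofFn] at hw
    rcases hw with ⟨j, rfl⟩ | ⟨i, rfl⟩ <;> simp
  · rw [longBlocks, List.pairwise_append]
    refine ⟨?_, ?_, ?_⟩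
    · rw [List.pairwise_ofFn]
      intro i j hij
      simp [hij.ne']
    · rw [List.pairwise_ofFn]
      intro i j hij
      simp [List.disjoint_left, hij.ne]
    · intro u hu w hw
      simp only [List.mem_ofFn] at hu hw
      obtain ⟨j, rfl⟩ := hu
      obtain ⟨i, rfl⟩ := hw
      simp

lemma block_x_mem (j : Fin k) : [(x j, true)] ∈ longBlocks g k := by
  simp [longBlocks, List.mem_ofFn]

lemma block_ab_mem (i : Fin g) :
    [(a i, false), (b i, false), (a i, true), (b i, true)] ∈ longBlocks g k := by
  simp [longBlocks, List.mem_ofFn]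

lemma mem_longBlocks_true (s : SignatureGen g k) : (s, true) ∈ (longBlocks g k).flatten := by
  rw [List.mem_flatten]
  rcases s with i | i | j
  · exact ⟨_, block_ab_mem i, by simp⟩
  · exact ⟨_, block_ab_mem i, by simp⟩
  · exact ⟨_, block_x_mem j, by simp⟩

/-- The `x_j` occur only positively in the long relator; the faces around the cone points have to
supply their inverses. -/
lemma mem_longBlocks_false (s : SignatureGen g k) :
    (s, false) ∈ (longBlocks g k).flatten ↔ ∀ j, s ≠ x j := by
  rw [List.mem_flatten]
  constructor
  · rintro ⟨w, hw, hs⟩ j rfl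
    simp only [longBlocks, List.mem_append, List.mem_ofFn] at hw
    rcases hw with ⟨j, rfl⟩ | ⟨i, rfl⟩ <;> simp at hs
  · intro h
    rcases s with i | i | j
    · exact ⟨_, block_ab_mem i, by simp⟩
    · exact ⟨_, block_ab_mem i, by simp⟩
    · exact absurd rfl (h j)

/-- Walking along `a⁻¹ b⁻¹ a b` visits vertices that are forced to coincide, and an `x_j` is a loop
by hypothesis. Hence each block returns to its starting label. -/
lemma labelling_eq_of_longBlocks {V : Type*} {f : SignatureGen g k × Bool → V} {v : V}
    (hx : ∀ j, f (x j, false) = f (x j, true))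
    (h : IsLabelledPath f v (longBlocks g k).flatten v) : ∀ s, f s = v := by
  have key : ∀ (ws : List (List (SignatureGen g k × Bool))) (u : V),
      (∀ w ∈ ws, ∀ v u, IsLabelledPath f v w u → u = v ∧ ∀ s ∈ w, f s = v) →
      IsLabelledPath f v ws.flatten u → ∀ s ∈ ws.flatten, f s = v := by
    intro ws
    induction ws with
    | nil => simp
    | cons w ws ih =>
      intro u hw hp s hs
      rw [List.flatten_cons, isLabelledPath_append] at hp
      obtain ⟨m, h1, h2⟩ := hp
      obtain ⟨rfl, h3⟩ := hw w (by simp) _ _ h1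
      rw [List.flatten_cons, List.mem_append] at hs
      rcases hs with hs | hs
      · exact h3 s hs
      · exact ih u (fun w' hw' => hw w' (by simp [hw'])) h2 s hs
  have all := key _ v (by
    intro w hw v u hp
    simp only [longBlocks, List.mem_append, List.mem_ofFn] at hw
    rcases hw with ⟨j, rfl⟩ | ⟨i, rfl⟩
    · have h1 : f (x j, true) = v := hp.1
      have h2 : f (x j, false) = u := hp.2
      rw [hx] at h2
      exact ⟨h2.symm.trans h1, by simp [h1]⟩
    · obtain ⟨h1, h2, h3, h4, h5⟩ := hp
      simp only [flipLetter, Bool.not_false, Bool.not_true, isLabelledPath_nil] at h1 h2 h3 h4 h5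
      have h6 : f (b i, true) = v := h4.trans h1
      have h7 : f (a i, true) = v := h3.trans h6
      have h8 : f (b i, false) = v := h2.trans h7
      exact ⟨h5.symm.trans h8, by simp [h1, h6, h7, h8]⟩) h
  rintro ⟨s, b⟩
  cases b
  · by_cases hs : ∀ j, s ≠ x j
    · exact all _ ((mem_longBlocks_false s).2 hs)
    · push Not at hs
      obtain ⟨j, rfl⟩ := hs
      rw [hx]
      exact all _ (mem_longBlocks_true _)
  · exact all _ (mem_longBlocks_true s)

end SignatureGen

/-! ### The smooth cyclic covers of an orbifold -/

namespace SignatureGen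

section cover
variable {g k : ℕ} {period : Fin k → ℕ} {n : ℕ}

/-- The faces of the cyclic cover: the lifts of the long relator, and one lift of each power
`x_j ^ (-n_j)` for each of its cyclic orbits of sheets. -/
noncomputable def coverFaces [NeZero n] (c : SignatureGen g k → ZMod n) (period : Fin k → ℕ) :
    List (List ((SignatureGen g k × ZMod n) × Bool)) :=
  open Classical in
  ((Finset.univ : Finset (ZMod n)).toList.map fun i => liftWord c i (longBlocks g k).flatten) ++
    (Finset.univ : Finset (Σ j : Fin k, ZMod n ⧸ AddSubgroup.zmultiples (c (x j)))).toList.map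
      fun jq => liftWord c jq.2.out (List.replicate (period jq.1) (x jq.1, false))

variable {c : SignatureGen g k → ZMod n}

lemma mem_coverFaces [NeZero n] {w : List ((SignatureGen g k × ZMod n) × Bool)} :
    w ∈ coverFaces c period ↔ (∃ i, liftWord c i (longBlocks g k).flatten = w) ∨
      ∃ (j : Fin k) (q : ZMod n ⧸ AddSubgroup.zmultiples (c (x j))),
        liftWord c q.out (List.replicate (period j) (x j, false)) = w := by
  simp only [coverFaces, List.mem_append, List.mem_map, Finset.mem_toList, Finset.mem_univ,
    true_and, Sigma.exists]

/-- A coset of the subgroup generated by `c (x j)` is exhausted by `period j` steps of `-c (x j)`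
from its representative, the shift of the letter read by the power face. -/
lemma exists_out_add [NeZero n] (hc : ∀ j, addOrderOf (c (x j)) = period j) (j : Fin k)
    (i : ZMod n) :
    ∃ t < period j,
      i = (QuotientAddGroup.mk i : ZMod n ⧸ AddSubgroup.zmultiples (c (x j))).out +
        t • letterShift c (x j, false) := by
  set q : ZMod n ⧸ AddSubgroup.zmultiples (c (x j)) := QuotientAddGroup.mk i
  have h : -q.out + i ∈ AddSubgroup.zmultiples (c (x j)) := by
    rw [← QuotientAddGroup.eq, QuotientAddGroup.out_eq']
  have h' : -q.out + i ∈ AddSubgroup.zmultiples (-c (x j)) := by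
    rwa [AddSubgroup.zmultiples_neg]
  have hfin : IsOfFinAddOrder (-c (x j)) := isOfFinAddOrder_of_finite _
  rw [← hfin.mem_multiples_iff_mem_zmultiples, hfin.mem_multiples_iff_mem_range_addOrderOf] at h'
  simp only [Finset.mem_image, Finset.mem_range, addOrderOf_neg, hc] at h'
  obtain ⟨t, ht, hti⟩ := h'
  refine ⟨t, ht, ?_⟩
  simp only [letterShift, Bool.false_eq_true, if_false]
  rw [hti]
  abel

lemma mem_flatten_coverFaces [NeZero n] (hc : ∀ j, addOrderOf (c (x j)) = period j)
    (s : (SignatureGen g k × ZMod n) × Bool) : s ∈ (coverFaces c period).flatten := by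
  rw [List.mem_flatten]
  by_cases hs : baseLetter s ∈ (longBlocks g k).flatten
  · obtain ⟨i, hi⟩ := exists_mem_liftWord c hs
    exact ⟨_, mem_coverFaces.2 (Or.inl ⟨i, rfl⟩), hi⟩
  · obtain ⟨⟨s, i⟩, b⟩ := s
    cases b
    · simp only [baseLetter, mem_longBlocks_false, not_forall, not_not] at hs
      obtain ⟨j, rfl⟩ := hs
      obtain ⟨t, ht, hi⟩ := exists_out_add hc j (i + c (x j))
      refine ⟨_, mem_coverFaces.2 (Or.inr ⟨j, QuotientAddGroup.mk (i + c (x j)), rfl⟩), ?_⟩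
      rw [liftWord_replicate, List.mem_map]
      refine ⟨t, List.mem_range.2 ht, ?_⟩
      rw [← hi]
      simp [liftLetter]
    · exact absurd (mem_longBlocks_true s) hs

/-- The lifts of the long relator contain the lifted `a`, `b` with both signs and the lifted `x_j`
positively; the power faces contain the inverses of the latter. No letter repeats in a power face,
because `c (x j)` has order `period j`. -/
lemma isQuadratic_coverFaces [NeZero n] (hc : ∀ j, addOrderOf (c (x j)) = period j) :
    IsQuadratic (coverFaces c period).flatten := by
  classical
  refine ⟨?_, fun s _ => mem_flatten_coverFaces hc _⟩
  rw [List.nodup_flatten]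
  constructor
  · intro w hw
    rcases mem_coverFaces.1 hw with ⟨i, rfl⟩ | ⟨j, q, rfl⟩
    · exact nodup_liftWord c nodup_longBlocks i
    · rw [liftWord_replicate]
      refine List.Nodup.map_on ?_ List.nodup_range
      intro t ht t' ht' h
      have := add_left_cancel (liftLetter_injective c h)
      rw [List.mem_range] at ht ht'
      have ho : addOrderOf (letterShift c (x j, false)) = period j := by
        simp [letterShift, hc]
      rw [← ho] at ht ht'
      exact nsmul_injOn_Iio_addOrderOf ht ht' this
  · rw [coverFaces, List.pairwise_append]
    refine ⟨?_, ?_, ?_⟩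
    · rw [List.pairwise_map]
      refine (Finset.nodup_toList _).imp ?_
      intro i j hij s hi hj
      exact hij (eq_of_mem_liftWord c nodup_longBlocks hi hj)
    · rw [List.pairwise_map]
      refine (Finset.nodup_toList _).imp ?_
      rintro ⟨j, q⟩ ⟨j', q'⟩ hne s hs hs'
      simp only [liftWord_replicate, List.mem_map] at hs hs'
      obtain ⟨t, -, rfl⟩ := hs
      obtain ⟨t', -, ht'⟩ := hs'
      have hj : j = j' := by simpa [liftLetter] using (congrArg (fun s => s.1.1) ht').symm
      subst hj
      refine hne ?_
      have := liftLetter_injective c ht'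
      have hq : q = q' := by
        rw [← QuotientAddGroup.out_eq' q, ← QuotientAddGroup.out_eq' q', QuotientAddGroup.eq]
        have h2 : -q.out + q'.out =
            (t : ℤ) • letterShift c (x j, false) - (t' : ℤ) • letterShift c (x j, false) := by
          rw [natCast_zsmul, natCast_zsmul, eq_sub_iff_add_eq, add_assoc, this]
          abel
        rw [h2, ← sub_smul]
        simp only [letterShift, Bool.false_eq_true, if_false, smul_neg]
        exact neg_mem (AddSubgroup.zsmul_mem_zmultiples _ _)
      rw [hq]
    · intro u hu w hw s hs hs'
      simp only [List.mem_map] at hu hw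
      obtain ⟨i, -, rfl⟩ := hu
      obtain ⟨⟨j, q⟩, -, rfl⟩ := hw
      have h1 := baseLetter_mem c hs
      have h2 := List.eq_of_mem_replicate (baseLetter_mem c hs')
      rw [h2, mem_longBlocks_false] at h1
      exact h1 j rfl

/-! ### Homomorphisms to `ℤ/n` and the relations of the lifted faces -/

variable (ψ : PresentedGroup (relators g period) →* Multiplicative (ZMod n))

lemma closure_of_presented (g : ℕ) {k : ℕ} (period : Fin k → ℕ) :
    Subgroup.closure (Set.range (PresentedGroup.of : SignatureGen g k →
      PresentedGroup (relators g period))) = ⊤ :=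
  PresentedGroup.closure_range_of _

/-- The image in `ℤ/n` of a generator. -/
def genImage (s : SignatureGen g k) : ZMod n := (ψ (PresentedGroup.of s)).toAdd

lemma toAdd_wordVal (w : List (SignatureGen g k × Bool)) :
    (ψ (wordVal PresentedGroup.of w)).toAdd = wordShift (genImage ψ) w := by
  induction w with
  | nil => simp
  | cons s w ih =>
    rw [wordVal_cons, map_mul, toAdd_mul, ih, wordShift_cons]
    congr 1
    rcases s with ⟨s, b⟩
    cases b <;> simp [letterVal, letterShift, genImage]

lemma wordVal_of (w : List (SignatureGen g k × Bool)) :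
    wordVal (PresentedGroup.of : SignatureGen g k → PresentedGroup (relators g period)) w =
      PresentedGroup.mk _ (wordVal FreeGroup.of w) := by
  refine (map_wordVal (PresentedGroup.mk (relators g period)) FreeGroup.of _ w ?_).symm
  intro s _
  rw [map_letterVal]
  rfl

lemma wordVal_of_longBlocks :
    wordVal (PresentedGroup.of : SignatureGen g k → PresentedGroup (relators g period))
      (longBlocks g k).flatten = 1 := by
  rw [wordVal_of, wordVal_longBlocks]
  refine PresentedGroup.one_of_mem ?_
  have : FreeGroup.lift FreeGroup.of (longRelator g k) = longRelator g k :=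
    FreeGroup.lift_of_apply _
  rw [this]
  exact Set.mem_insert _ _

lemma of_x_pow (j : Fin k) :
    (PresentedGroup.of (x j) : PresentedGroup (relators g period)) ^ period j = 1 :=
  PresentedGroup.one_of_mem (Set.mem_insert_of_mem _ ⟨j, rfl⟩)

lemma wordVal_replicate {H : Type*} [Group H] (f : SignatureGen g k → H) (j : Fin k) (m : ℕ) :
    wordVal f (List.replicate m (x j, false)) = ((f (x j)) ^ m)⁻¹ := by
  simp [wordVal, letterVal]

lemma wordVal_of_face [NeZero n] {w : List ((SignatureGen g k × ZMod n) × Bool)}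
    (hw : w ∈ coverFaces (genImage ψ) period) :
    ∃ (i : ZMod n) (u : List (SignatureGen g k × Bool)), w = liftWord (genImage ψ) i u ∧
      wordVal (PresentedGroup.of : SignatureGen g k → PresentedGroup (relators g period)) u = 1 ∧
      wordShift (genImage ψ) u = 0 := by
  rcases mem_coverFaces.1 hw with ⟨i, rfl⟩ | ⟨j, q, rfl⟩
  · refine ⟨i, _, rfl, wordVal_of_longBlocks, ?_⟩
    rw [← toAdd_wordVal, wordVal_of_longBlocks, map_one, toAdd_one]
  · have : wordVal (PresentedGroup.of : SignatureGen g k → PresentedGroup (relators g period))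
        (List.replicate (period j) (x j, false)) = 1 := by
      rw [wordVal_replicate, of_x_pow, inv_one]
    refine ⟨_, _, rfl, this, ?_⟩
    rw [← toAdd_wordVal, this, map_one, toAdd_one]

variable {ψ}

lemma isFaceConnected_coverFaces [NeZero n] (hψ : Function.Surjective ψ)
    (hc : ∀ j, addOrderOf (genImage ψ (x j)) = period j) :
    IsFaceConnected (coverFaces (genImage ψ) period) := by
  set c := genImage ψ with hcdef
  intro f hf
  have hf' : ∀ w ∈ coverFaces c period, ∀ s ∈ w, ∀ t ∈ w, (f s.1 ↔ f t.1) :=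
    fun w hw s hs t ht => ⟨hf w hw s hs t ht, hf w hw t ht s hs⟩
  set p : ZMod n → Prop := fun i => ∃ s ∈ liftWord c i (longBlocks g k).flatten, f s.1 with hp
  have hpi : ∀ i, ∀ s ∈ liftWord c i (longBlocks g k).flatten, (f s.1 ↔ p i) := by
    intro i s hs
    exact ⟨fun h => ⟨s, hs, h⟩, fun ⟨t, ht, h⟩ =>
      (hf' _ (mem_coverFaces.2 (Or.inl ⟨i, rfl⟩)) t ht s hs).1 h⟩
  have hblock : ∀ u ∈ longBlocks g k, ∃ o : ZMod n, ∀ i, ∀ s ∈ liftWord c i u,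
      (f s.1 ↔ p (i - o)) := by
    intro u hu
    obtain ⟨o, ho⟩ := exists_offset c hu
    exact ⟨o, fun i s hs => hpi _ s (ho _ s (by rwa [sub_add_cancel]))⟩
  have hstep : ∀ s i, p i ↔ p (i + c s) := by
    intro s i
    -- The long faces of sheets `i` and `i + c s` are adjacent: along a lift of `b_j` if `s = a_j`,
    -- along a lift of `a_j` if `s = b_j`, and through a common power face if `s = x_j`.
    -- Surjectivity then connects all sheets.
    rcases s with j | j | j
    · obtain ⟨o, ho⟩ := hblock _ (block_ab_mem j)
      have h1 := ho (i + o) ((b j, i + o - c (b j)), true) (by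
        simp [liftLetter, letterShift]; abel)
      have h2 := ho (i + c (a j) + o) ((b j, i + o - c (b j)), false) (by
        simp [liftLetter, letterShift]; abel)
      rw [add_sub_cancel_right] at h1 h2
      rw [← h1, ← h2]
    · obtain ⟨o, ho⟩ := hblock _ (block_ab_mem j)
      have h1 := ho (i + o) ((a j, i + o - c (a j)), false) (by
        simp [liftLetter])
      have h2 := ho (i + c (b j) + o) ((a j, i + o - c (a j)), true) (by
        simp [liftLetter, letterShift]; abel)
      rw [add_sub_cancel_right] at h1 h2
      rw [← h1, ← h2]
    · obtain ⟨o, ho⟩ := hblock _ (block_x_mem j)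
      have h1 := ho (i + o) ((x j, i + o), true) (by simp [liftLetter])
      have h2 := ho (i + c (x j) + o) ((x j, i + c (x j) + o), true) (by simp [liftLetter])
      rw [add_sub_cancel_right] at h1 h2
      rw [← h1, ← h2]
      have hmem : ∀ i, ((x j, i), false) ∈ liftWord c
          (QuotientAddGroup.mk i : ZMod n ⧸ AddSubgroup.zmultiples (c (x j))).out
          (List.replicate (period j) (x j, false)) := by
        intro i
        obtain ⟨t, ht, hi⟩ := exists_out_add hc j (i + c (x j))
        have hq : (QuotientAddGroup.mk i : ZMod n ⧸ AddSubgroup.zmultiples (c (x j))) =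
            QuotientAddGroup.mk (i + c (x j)) := by
          rw [QuotientAddGroup.eq, neg_add_cancel_left]
          exact AddSubgroup.mem_zmultiples _
        rw [hq, liftWord_replicate, List.mem_map]
        refine ⟨t, List.mem_range.2 ht, ?_⟩
        rw [← hi]
        simp [liftLetter]
      have hq : (QuotientAddGroup.mk (i + o) : ZMod n ⧸ AddSubgroup.zmultiples (c (x j))) =
          QuotientAddGroup.mk (i + c (x j) + o) := by
        rw [QuotientAddGroup.eq]
        have : -(i + o) + (i + c (x j) + o) = c (x j) := by abel
        rw [this]
        exact AddSubgroup.mem_zmultiples _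
      have h3 := hmem (i + c (x j) + o)
      rw [← hq] at h3
      exact hf' _ (mem_coverFaces.2 (Or.inr ⟨j, QuotientAddGroup.mk (i + o), rfl⟩))
        ((x j, i + o), false) (hmem (i + o)) ((x j, i + c (x j) + o), false) h3
  have hall : ∀ i j, p i ↔ p j := by
    have hgam : ∀ γ, ∀ i, p i ↔ p (i + (ψ γ).toAdd) := by
      intro γ
      have hγ : γ ∈ Subgroup.closure (Set.range (PresentedGroup.of : SignatureGen g k →
          PresentedGroup (relators g period))) := by
        rw [closure_of_presented]; trivial
      induction hγ using Subgroup.closure_induction with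
      | mem y hy =>
        obtain ⟨s, rfl⟩ := hy
        exact hstep s
      | one => simp
      | mul y z _ _ hy hz =>
        intro i
        rw [map_mul, toAdd_mul, ← add_assoc, ← hz, ← hy]
      | inv y _ hy =>
        intro i
        rw [hy (i + _), map_inv, toAdd_inv, neg_add_cancel_right]
    intro i j
    obtain ⟨γ, hγ⟩ := hψ (Multiplicative.ofAdd (j - i))
    have := hgam γ i
    rwa [hγ, toAdd_ofAdd, add_sub_cancel] at this
  have hfall : ∀ s : (SignatureGen g k × ZMod n) × Bool, f s.1 ↔ p 0 := by
    intro s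
    obtain ⟨i, hi⟩ := exists_mem_liftWord c (s := (s.1, true)) (mem_longBlocks_true s.1.1)
    exact (hpi i _ hi).trans (hall i 0)
  intro s _ t _
  rw [hfall s, hfall t]
  exact id

/-! ### Reidemeister–Schreier for the kernel -/

/-- The Schreier generators of the kernel, for a choice `t` of representatives of the sheets. -/
def kerGen (ψ : PresentedGroup (relators g period) →* Multiplicative (ZMod n))
    {t : ZMod n → PresentedGroup (relators g period)} (ht : ∀ i, ψ (t i) = Multiplicative.ofAdd i)
    (s : SignatureGen g k × ZMod n) : ψ.ker :=
  ⟨t s.2 * PresentedGroup.of s.1 * (t (s.2 + genImage ψ s.1))⁻¹, by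
    rw [MonoidHom.mem_ker, map_mul, map_mul, map_inv, ht, ht, ofAdd_add]
    simp [genImage]⟩

lemma coe_letterVal_kerGen {t : ZMod n → PresentedGroup (relators g period)}
    (ht : ∀ i, ψ (t i) = Multiplicative.ofAdd i) (i : ZMod n) (s : SignatureGen g k × Bool) :
    ((letterVal (kerGen ψ ht) (liftLetter (genImage ψ) i s) : ψ.ker) :
      PresentedGroup (relators g period)) =
      t i * letterVal PresentedGroup.of s * (t (i + letterShift (genImage ψ) s))⁻¹ := by
  rcases s with ⟨s, b⟩
  cases b <;> simp [letterVal, liftLetter, kerGen, letterShift, mul_assoc, sub_eq_add_neg]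

lemma coe_wordVal_kerGen {t : ZMod n → PresentedGroup (relators g period)}
    (ht : ∀ i, ψ (t i) = Multiplicative.ofAdd i) (i : ZMod n)
    (w : List (SignatureGen g k × Bool)) :
    ((wordVal (kerGen ψ ht) (liftWord (genImage ψ) i w) : ψ.ker) :
      PresentedGroup (relators g period)) =
      t i * wordVal PresentedGroup.of w * (t (i + wordShift (genImage ψ) w))⁻¹ := by
  induction w generalizing i with
  | nil => simp
  | cons s w ih =>
    rw [liftWord_cons, wordVal_cons, Subgroup.coe_mul, coe_letterVal_kerGen, ih, wordVal_cons,
      wordShift_cons, ← add_assoc]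
    group

/-- The cover has one vertex in each sheet. Regarded as a labelling of the base with values in
functions of the sheet, a closed labelling is constant along the long relator. -/
lemma baseLabelling_eq [NeZero n] {c : SignatureGen g k → ZMod n}
    (hc : ∀ j, addOrderOf (c (x j)) = period j) (hlong : wordShift c (longBlocks g k).flatten = 0)
    {V : Type*} {G : (SignatureGen g k × ZMod n) × Bool → V}
    (hG : IsClosedLabelling (coverFaces c period) G) :
    ∃ v : ZMod n → V, ∀ i s, G (liftLetter c i s) = v i := by
  choose v hv using fun i => hG _ (mem_coverFaces.2 (Or.inl ⟨i, rfl⟩))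
  have hpath : IsLabelledPath (baseLabelling c G) v (longBlocks g k).flatten v := by
    refine isLabelledPath_base c fun i => ?_
    rw [hlong, add_zero]
    exact hv i
  -- Each lift of `x_j` ends where the next one on the same power face begins. For the first letter
  -- this is the closing of the face, which returns to its starting sheet after `period j` steps.
  have hx : ∀ j, baseLabelling c G (x j, false) = baseLabelling c G (x j, true) := by
    intro j
    funext i
    obtain ⟨t, ht, hi⟩ := exists_out_add hc j i
    obtain ⟨u, hu⟩ := hG _ (mem_coverFaces.2 (Or.inr
      ⟨j, (QuotientAddGroup.mk i : ZMod n ⧸ AddSubgroup.zmultiples (c (x j))), rfl⟩))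
    obtain ⟨h1, h2⟩ := labels_replicate c hu
    have hm : period j ≠ 0 := by omega
    have ho : period j • letterShift c (x j, false) = 0 := by
      rw [← hc j]
      simp only [letterShift, Bool.false_eq_true, if_false, smul_neg, addOrderOf_nsmul_eq_zero,
        neg_zero]
    rw [if_neg hm, ho, add_zero] at h2
    have h3 := h1 t ht
    rw [← hi] at h3
    rw [h3]
    split_ifs with h0
    · rw [h2]
      rw [h0, zero_smul, add_zero] at hi
      rw [← hi]
      rfl
    · rfl
  have := labelling_eq_of_longBlocks hx hpath
  exact ⟨v, fun i s => congrFun (this s) i⟩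

lemma wordShift_longBlocks (ψ : PresentedGroup (relators g period) →* Multiplicative (ZMod n)) :
    wordShift (genImage ψ) (longBlocks g k).flatten = 0 := by
  rw [← toAdd_wordVal, wordVal_of_longBlocks, map_one, toAdd_one]

/-- An assignment that satisfies the relations of the faces gives a homomorphism to the wreath
product. -/
lemma exists_sheetWreath_hom [NeZero n] (hc : ∀ j, addOrderOf (genImage ψ (x j)) = period j)
    {H : Type} [Group H] {h : SignatureGen g k × ZMod n → H}
    (hh : ∀ w ∈ coverFaces (genImage ψ) period, wordVal h w = 1) :
    ∃ Θ : PresentedGroup (relators g period) →* SheetWreath H n,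
      (∀ s, Θ (PresentedGroup.of s) = SheetWreath.gen (genImage ψ) h s) ∧
      ∀ γ, (Θ γ).shift = (ψ γ).toAdd := by
  set c := genImage ψ with hcdef
  have hrel : ∀ r ∈ relators g period, FreeGroup.lift (SheetWreath.gen c h) r = 1 := by
    rintro r (rfl | ⟨j, rfl⟩)
    · rw [← wordVal_longBlocks, SheetWreath.wordVal_gen]
      refine SheetWreath.ext (funext fun i => ?_) (wordShift_longBlocks ψ)
      exact hh _ (mem_coverFaces.2 (Or.inl ⟨i, rfl⟩))
    · simp only [map_pow, FreeGroup.lift_apply_of]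
      set X := SheetWreath.gen c h (x j) with hX
      have hY := SheetWreath.wordVal_gen c h (List.replicate (period j) (x j, false))
      rw [wordVal_replicate, ← hX] at hY
      rw [← inv_eq_one, hY]
      -- The hypothesis covers only one lift of the power per orbit of sheets. Since `X` commutes
      -- with its power, triviality of the coordinate in one sheet passes to the neighbouring sheet
      -- of the orbit.
      have hcomm : X * (X ^ period j)⁻¹ = (X ^ period j)⁻¹ * X :=
        ((Commute.refl X).pow_right _).inv_right
      rw [hY] at hcomm
      have hshift : wordShift c (List.replicate (period j) (x j, false)) = 0 := by
        have : period j • c (x j) = 0 := by rw [← hc j]; exact addOrderOf_nsmul_eq_zero _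
        simp [wordShift, letterShift] at this ⊢
        exact this
      set F : ZMod n → H := fun i =>
        wordVal h (liftWord c i (List.replicate (period j) (x j, false)))
        with hF
      have hFc : ∀ i, F i = 1 ↔ F (i + c (x j)) = 1 := by
        intro i
        have h1 := congrFun (congrArg SheetWreath.fn hcomm) i
        simp only [SheetWreath.mul_fn, hshift, add_zero] at h1
        change X.fn i * F (i + c (x j)) = F i * X.fn i at h1
        constructor
        · intro h2
          rw [h2, one_mul] at h1
          exact mul_eq_left.1 h1
        · intro h2
          rw [h2, mul_one] at h1
          exact (mul_eq_right.1 h1.symm)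
      have hFt : ∀ (m : ℕ) i, F i = 1 ↔ F (i + m • letterShift c (x j, false)) = 1 := by
        intro m
        induction m with
        | zero => simp
        | succ m ih =>
          intro i
          rw [ih i, succ_nsmul, hFc (i + (m • _ + _))]
          simp only [letterShift, Bool.false_eq_true, if_false]
          rw [← add_assoc, neg_add_cancel_right]
      refine SheetWreath.ext (funext fun i => ?_) hshift
      obtain ⟨t, -, hi⟩ := exists_out_add hc j i
      change F i = 1
      rw [hi, ← hFt]
      exact hh _ (mem_coverFaces.2 (Or.inr ⟨j, _, rfl⟩))
  refine ⟨PresentedGroup.toGroup hrel, fun s => PresentedGroup.toGroup.of hrel, ?_⟩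
  intro γ
  have hγ : γ ∈ Subgroup.closure (Set.range (PresentedGroup.of : SignatureGen g k →
      PresentedGroup (relators g period))) := by
    rw [closure_of_presented]; trivial
  induction hγ using Subgroup.closure_induction with
  | mem y hy =>
    obtain ⟨s, rfl⟩ := hy
    rw [PresentedGroup.toGroup.of]
    rfl
  | one => simp
  | mul y z _ _ hy hz => rw [map_mul, map_mul, SheetWreath.mul_shift, hy, hz, toAdd_mul]
  | inv y _ hy => rw [map_inv, map_inv, SheetWreath.inv_shift, hy, toAdd_inv]

/-- Relations of the faces are lifted relations of `Γ`. Generation is a telescoping along words in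
the original generators. For the universal property, an assignment on the cover induces a
homomorphism of the whole group to a wreath product, and the kernel acts there without changing
sheets. -/
lemma gaugePresents_kerGen [NeZero n] (hc : ∀ j, addOrderOf (genImage ψ (x j)) = period j)
    {t : ZMod n → PresentedGroup (relators g period)}
    (ht : ∀ i, ψ (t i) = Multiplicative.ofAdd i) :
    GaugePresents (coverFaces (genImage ψ) period) (kerGen ψ ht) := by
  refine ⟨?_, ?_, ?_⟩
  · intro w hw
    obtain ⟨i, u, rfl, h1, h2⟩ := wordVal_of_face ψ hw
    apply Subtype.ext
    rw [coe_wordVal_kerGen, h1, h2]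
    simp
  · intro M G hG hM
    obtain ⟨v, hv⟩ := baseLabelling_eq hc (wordShift_longBlocks ψ) hG
    have key : ∀ γ i, (v i : PresentedGroup (relators g period)) * t i * γ *
        ((v (i + (ψ γ).toAdd) : PresentedGroup (relators g period)) * t (i + (ψ γ).toAdd))⁻¹ ∈
          M.map ψ.ker.subtype := by
      intro γ
      have hγ : γ ∈ Subgroup.closure (Set.range (PresentedGroup.of : SignatureGen g k →
          PresentedGroup (relators g period))) := by
        rw [closure_of_presented]; trivial
      induction hγ using Subgroup.closure_induction with
      | mem y hy =>
        obtain ⟨s, rfl⟩ := hy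
        intro i
        have := hM (liftLetter (genImage ψ) i (s, true)) (mem_flatten_coverFaces hc _)
        rw [flipLetter_liftLetter, hv, hv] at this
        refine ⟨_, this, ?_⟩
        simp only [map_mul, map_inv, Subgroup.coe_subtype, coe_letterVal_kerGen]
        simp only [letterVal, letterShift, if_true, genImage]
        group
      | one =>
        intro i
        simp [one_mem]
      | mul y z _ _ hy hz =>
        intro i
        have := mul_mem (hy i) (hz (i + (ψ y).toAdd))
        rw [map_mul, toAdd_mul, ← add_assoc]
        convert this using 1
        group
      | inv y _ hy =>
        intro i
        have := inv_mem (hy (i + (ψ y⁻¹).toAdd))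
        rw [map_inv, toAdd_inv, neg_add_cancel_right] at this
        rw [map_inv, toAdd_inv]
        convert this using 1
        group
    rw [eq_top_iff]
    rintro ⟨κ, hκ⟩ -
    have hκ' : ψ κ = 1 := hκ
    -- Applying `key` to the conjugate of `κ` by `y⁻¹` in the sheet 0 cancels the gauge and leaves
    -- `κ` itself.
    set y := (v 0 : PresentedGroup (relators g period)) * t 0 with hy
    have := key (y⁻¹ * κ * y) 0
    have h0 : ψ (y⁻¹ * κ * y) = 1 := by
      rw [map_mul, map_mul, hκ', mul_one, ← map_mul, inv_mul_cancel, map_one]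
    rw [h0, toAdd_one, add_zero, ← hy] at this
    have e : y * (y⁻¹ * κ * y) * y⁻¹ = κ := by group
    rw [e] at this
    obtain ⟨m, hm, hmκ⟩ := this
    have : m = ⟨κ, hκ⟩ := Subtype.ext hmκ
    rwa [← this]
  · intro H _ h hh
    obtain ⟨Θ, hΘ, hshift⟩ := exists_sheetWreath_hom hc hh
    have hs0 : ∀ κ : ψ.ker, (Θ κ).shift = 0 := by
      intro κ
      rw [hshift, MonoidHom.mem_ker.1 κ.2, toAdd_one]
    -- On elements with trivial shift the coordinate at sheet 0 is multiplicative.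
    let θ : ψ.ker →* H :=
      { toFun := fun κ => (Θ κ).fn 0
        map_one' := by simp
        map_mul' := fun κ κ' => by
          rw [Subgroup.coe_mul, map_mul, SheetWreath.mul_fn, hs0, add_zero] }
    have htshift : ∀ i, (Θ (t i)).shift = i := by
      intro i
      rw [hshift, ht, toAdd_ofAdd]
    have hθ : ∀ s, h s = ((Θ (t s.2)).fn 0)⁻¹ * θ (kerGen ψ ht s) *
        (((Θ (t (s.2 + genImage ψ s.1))).fn 0)⁻¹)⁻¹ := by
      intro s
      change _ = _ * (Θ (t s.2 * PresentedGroup.of s.1 * (t (s.2 + genImage ψ s.1))⁻¹)).fn 0 * _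
      rw [map_mul, map_mul, map_inv, SheetWreath.mul_fn, SheetWreath.mul_fn, SheetWreath.mul_shift,
        SheetWreath.inv_fn, htshift, htshift, hΘ]
      simp [SheetWreath.gen, mul_assoc]
    let G : (SignatureGen g k × ZMod n) × Bool → H := fun s =>
      ((Θ (t (if s.2 then s.1.2 else s.1.2 + genImage ψ s.1.1))).fn 0)⁻¹
    have hG : ∀ i s, G (liftLetter (genImage ψ) i s) = ((Θ (t i)).fn 0)⁻¹ := by
      rintro i ⟨s, b⟩
      cases b <;> simp [G, liftLetter]
    refine ⟨θ, G, ?_, ?_⟩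
    · intro w hw
      obtain ⟨i, u, rfl, -, h2⟩ := wordVal_of_face ψ hw
      have := isLabelledPath_liftWord (genImage ψ) hG i u
      rw [h2, add_zero] at this
      exact ⟨_, this⟩
    · rintro ⟨s, b⟩ -
      cases b
      · simp only [letterVal, flipLetter, G, map_inv, Bool.false_eq_true, if_false, Bool.not_false,
          if_true]
        rw [hθ s]
        group
      · simp only [letterVal, flipLetter, G, Bool.false_eq_true, if_false, Bool.not_true, if_true]
        exact hθ s

/-- The kernel of an epimorphism onto a cyclic group that preserves the orders of the `x_j` is a
surface group. -/
theorem exists_ker_mulEquiv [NeZero n] (hψ : Function.Surjective ψ)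
    (hc : ∀ j, orderOf (ψ (PresentedGroup.of (x j))) = period j) :
    ∃ m : ℕ, Nonempty (PresentedGroup (relators m (Fin.elim0 : Fin 0 → ℕ)) ≃* ψ.ker) := by
  have hc' : ∀ j, addOrderOf (genImage ψ (x j)) = period j := hc
  choose t ht using fun i => hψ (Multiplicative.ofAdd i)
  exact (gaugePresents_kerGen hc' ht).mulEquiv_surfaceGroup (isQuadratic_coverFaces hc')
    (isFaceConnected_coverFaces hψ hc')

end cover

end SignatureGen

/-! ### Surface groups are torsion-free -/

namespace SurfaceGroup
open SignatureGen

/-- The free group on one handle generator and on the translates of the other generators. -/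
abbrev Base (m : ℕ) : Type := FreeGroup (Option (Fin m × Bool × ℤ))

/-- The product of the commutators of the `i`-th translates. -/
def translateProd (m : ℕ) (i : ℤ) : Base m :=
  (List.ofFn fun j : Fin m =>
    (FreeGroup.of (some (j, true, i)))⁻¹ * (FreeGroup.of (some (j, false, i)))⁻¹ *
      FreeGroup.of (some (j, true, i)) * FreeGroup.of (some (j, false, i))).prod

/-- The translation `b ↦ b W₀`, `s_i ↦ s_{i+1}`. -/
def translateHom (m : ℕ) : Base m →* Base m :=
  FreeGroup.lift fun
    | none => FreeGroup.of none * translateProd m 0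
    | some (j, e, i) => FreeGroup.of (some (j, e, i + 1))

/-- The inverse of `translateHom`. -/
def translateInvHom (m : ℕ) : Base m →* Base m :=
  FreeGroup.lift fun
    | none => FreeGroup.of none * (translateProd m (-1))⁻¹
    | some (j, e, i) => FreeGroup.of (some (j, e, i - 1))

lemma translateHom_prod (m : ℕ) (i : ℤ) :
    translateHom m (translateProd m i) = translateProd m (i + 1) := by
  simp [translateProd, translateHom, map_list_prod, List.map_ofFn, Function.comp_def]

lemma translateInvHom_prod (m : ℕ) (i : ℤ) :
    translateInvHom m (translateProd m i) = translateProd m (i - 1) := by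
  simp [translateProd, translateInvHom, map_list_prod, List.map_ofFn, Function.comp_def]

/-- The translation as an automorphism. -/
def translate (m : ℕ) : MulAut (Base m) :=
  MonoidHom.toMulEquiv (translateHom m) (translateInvHom m)
    (by
      ext s
      rcases s with _ | ⟨j, e, i⟩
      · have h1 : translateHom m (FreeGroup.of none) = FreeGroup.of none * translateProd m 0 := by
          simp [translateHom]
        have h2 : translateInvHom m (FreeGroup.of none) =
            FreeGroup.of none * (translateProd m (-1))⁻¹ := by
          simp [translateInvHom]
        simp [h1, h2, translateInvHom_prod]
      · simp [translateHom, translateInvHom])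
    (by
      ext s
      rcases s with _ | ⟨j, e, i⟩
      · have h1 : translateHom m (FreeGroup.of none) = FreeGroup.of none * translateProd m 0 := by
          simp [translateHom]
        have h2 : translateInvHom m (FreeGroup.of none) =
            FreeGroup.of none * (translateProd m (-1))⁻¹ := by
          simp [translateInvHom]
        simp [h1, h2, translateHom_prod]
      · simp [translateHom, translateInvHom])

/-- The surface group as an extension of `ℤ` by a free group. -/
abbrev Ext (m : ℕ) : Type :=
  Base m ⋊[zpowersHom (MulAut (Base m)) (translate m)] Multiplicative ℤ

/-- The generators in the extension. -/
def extGen (m : ℕ) : SignatureGen (m + 1) 0 → Ext m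
  | .a i => Fin.cases (SemidirectProduct.inr (Multiplicative.ofAdd (-1)))
      (fun j => SemidirectProduct.inl (FreeGroup.of (some (j, true, 0)))) i
  | .b i => Fin.cases (SemidirectProduct.inl (FreeGroup.of none))
      (fun j => SemidirectProduct.inl (FreeGroup.of (some (j, false, 0)))) i
  | .x i => i.elim0

lemma lift_longRelator_succ {m : ℕ} {H : Type*} [Group H] (f : SignatureGen (m + 1) 0 → H) :
    FreeGroup.lift f (longRelator (m + 1) 0) = (f (a 0))⁻¹ * (f (b 0))⁻¹ * f (a 0) * f (b 0) *
      (List.ofFn fun j : Fin m => (f (a j.succ))⁻¹ * (f (b j.succ))⁻¹ * f (a j.succ) *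
        f (b j.succ)).prod := by
  simp [longRelator, List.ofFn_succ, map_list_prod, List.map_ofFn, Function.comp_def]

/-- The long relator says `a₀⁻¹ b₀ a₀ = b₀ W`, with `W` the product of the other commutators.
Conjugation by `a₀⁻¹` is thus the translation, which is why `a₀` goes to the generator `-1` of `ℤ`.
-/
lemma lift_extGen (m : ℕ) : ∀ r ∈ relators (m + 1) (Fin.elim0 : Fin 0 → ℕ),
    FreeGroup.lift (extGen m) r = 1 := by
  rintro r (rfl | ⟨i, -⟩)
  · rw [lift_longRelator_succ]
    have h1 : (List.ofFn fun j : Fin m => (extGen m (a j.succ))⁻¹ * (extGen m (b j.succ))⁻¹ *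
        extGen m (a j.succ) * extGen m (b j.succ)).prod =
          SemidirectProduct.inl (translateProd m 0) := by
      simp [extGen, translateProd, map_list_prod, List.map_ofFn, Function.comp_def]
    have h2 := SemidirectProduct.inl_aut (φ := zpowersHom (MulAut (Base m)) (translate m))
      (Multiplicative.ofAdd 1) (FreeGroup.of none)
    have h3 : (zpowersHom (MulAut (Base m)) (translate m) (Multiplicative.ofAdd 1))
        (FreeGroup.of none) = FreeGroup.of none * translateProd m 0 := by
      simp [translate, translateHom]
    rw [h3, map_mul] at h2
    rw [h1]
    simp only [extGen, Fin.cases_zero, ofAdd_neg, map_inv, inv_inv]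
    have h4 : SemidirectProduct.inl (translateProd m 0) =
        (SemidirectProduct.inl (FreeGroup.of none))⁻¹ * (SemidirectProduct.inr
          (Multiplicative.ofAdd 1) * SemidirectProduct.inl (FreeGroup.of none) *
            SemidirectProduct.inr (Multiplicative.ofAdd 1)⁻¹ : Ext m) := by
      rw [← h2, inv_mul_cancel_left]
    rw [h4, map_inv]
    group
  · exact i.elim0

/-- The surface group of genus `m + 1`. -/
abbrev Surf (m : ℕ) : Type := PresentedGroup (relators (m + 1) (Fin.elim0 : Fin 0 → ℕ))

/-- The free group in the surface group. -/
def baseHom (m : ℕ) : Base m →* Surf m :=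
  FreeGroup.lift fun
    | none => PresentedGroup.of (b 0)
    | some (j, e, i) => (PresentedGroup.of (a 0)) ^ (-i) *
        (if e then PresentedGroup.of (a j.succ) else PresentedGroup.of (b j.succ)) *
          (PresentedGroup.of (a 0)) ^ i

lemma baseHom_prod_zero (m : ℕ) : PresentedGroup.of (b 0) * baseHom m (translateProd m 0) =
    (PresentedGroup.of (a 0) : Surf m)⁻¹ * PresentedGroup.of (b 0) * PresentedGroup.of (a 0) := by
  have h1 : (PresentedGroup.mk (relators (m + 1) (Fin.elim0 : Fin 0 → ℕ)))
      (longRelator (m + 1) 0) = 1 := PresentedGroup.one_of_mem (Set.mem_insert _ _)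
  have h2 : PresentedGroup.mk (relators (m + 1) (Fin.elim0 : Fin 0 → ℕ)) =
      FreeGroup.lift PresentedGroup.of := by
    ext s; simp [PresentedGroup.of]
  rw [h2, lift_longRelator_succ] at h1
  have h3 : baseHom m (translateProd m 0) = (List.ofFn fun j : Fin m =>
      (PresentedGroup.of (a j.succ))⁻¹ * (PresentedGroup.of (b j.succ))⁻¹ *
        PresentedGroup.of (a j.succ) * PresentedGroup.of (b j.succ)).prod := by
    simp [translateProd, baseHom, map_list_prod, List.map_ofFn, Function.comp_def]
  rw [h3]
  rw [← eq_inv_mul_iff_mul_eq, ← mul_right_inj ((PresentedGroup.of (a 0) : Surf m)⁻¹ *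
    (PresentedGroup.of (b 0))⁻¹ * PresentedGroup.of (a 0) * PresentedGroup.of (b 0)), h1]
  group

lemma baseHom_translate (m : ℕ) (y : Base m) : baseHom m (translate m y) =
    (PresentedGroup.of (a 0))⁻¹ * baseHom m y * PresentedGroup.of (a 0) := by
  have : (baseHom m).comp (translateHom m) =
      (MulAut.conj (PresentedGroup.of (a 0) : Surf m)⁻¹).toMonoidHom.comp (baseHom m) := by
    ext s
    rcases s with _ | ⟨j, e, i⟩
    · have h1 : translateHom m (FreeGroup.of none) = FreeGroup.of none * translateProd m 0 := by
        simp [translateHom]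
      have h2 : baseHom m (FreeGroup.of none) = PresentedGroup.of (b 0) := by simp [baseHom]
      simp only [MonoidHom.comp_apply, h1, map_mul, h2, baseHom_prod_zero]
      simp
    · simp only [translateHom, baseHom, MonoidHom.comp_apply, FreeGroup.lift_apply_of,
        MulEquiv.coe_toMonoidHom, MulAut.conj_apply]
      group
  have := DFunLike.congr_fun this y
  change baseHom m (translateHom m y) = _
  simpa using this

lemma baseHom_zpow (m : ℕ) (z : ℤ) (y : Base m) : baseHom m ((translate m ^ z) y) =
    (PresentedGroup.of (a 0)) ^ (-z) * baseHom m y * (PresentedGroup.of (a 0)) ^ z := by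
  induction z using Int.induction_on generalizing y with
  | zero => simp
  | succ i ih =>
    rw [zpow_add_one, MulAut.mul_apply, ih, baseHom_translate]
    group
  | pred i ih =>
    have h := baseHom_translate m ((translate m)⁻¹ y)
    rw [MulAut.apply_inv_self] at h
    rw [zpow_sub_one, MulAut.mul_apply, ih]
    have h' : baseHom m ((translate m)⁻¹ y) =
        PresentedGroup.of (a 0) * baseHom m y * (PresentedGroup.of (a 0))⁻¹ := by
      rw [h]; group
    rw [h']
    group

/-- The extension maps back to the surface group. -/
def extHom (m : ℕ) : Ext m →* Surf m :=
  SemidirectProduct.lift (baseHom m) (zpowersHom _ (PresentedGroup.of (a 0))⁻¹) (by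
    intro z
    ext y
    simp only [MonoidHom.comp_apply, MulEquiv.coe_toMonoidHom, MulAut.conj_apply,
      zpowersHom_apply, baseHom_zpow]
    simp)

/-- Only a left inverse is needed: torsion-freeness passes to subgroups. -/
lemma injective_toExt (m : ℕ) : Function.Injective (PresentedGroup.toGroup (lift_extGen m)) := by
  have : (extHom m).comp (PresentedGroup.toGroup (lift_extGen m)) = MonoidHom.id _ := by
    ext s
    simp only [MonoidHom.comp_apply, PresentedGroup.toGroup.of, MonoidHom.id_apply]
    rcases s with i | i | i
    · refine Fin.cases ?_ (fun j => ?_) i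
      · simp [extGen, extHom]
      · simp [extGen, extHom, baseHom]
    · refine Fin.cases ?_ (fun j => ?_) i
      · simp [extGen, extHom, baseHom]
      · simp [extGen, extHom, baseHom]
    · exact i.elim0
  intro y z h
  have := DFunLike.congr_fun this
  rw [← MonoidHom.id_apply _ y, ← this y, MonoidHom.comp_apply, h, ← MonoidHom.comp_apply, this z]
  rfl

/-- Surface groups have no torsion. -/
theorem eq_one_of_pow_eq_one {m : ℕ}
    (y : PresentedGroup (relators m (Fin.elim0 : Fin 0 → ℕ))) {t : ℕ} (ht : t ≠ 0)
    (hy : y ^ t = 1) : y = 1 := by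
  rcases m with _ | m
  · have h := closure_of_presented 0 (Fin.elim0 : Fin 0 → ℕ)
    have he : IsEmpty (SignatureGen 0 0) := ⟨fun s => by rcases s with i | i | i <;> exact i.elim0⟩
    rw [Set.range_eq_empty, Subgroup.closure_empty] at h
    have : y ∈ (⊥ : Subgroup (PresentedGroup (relators 0 (Fin.elim0 : Fin 0 → ℕ)))) := by
      rw [h]; trivial
    exact Subgroup.mem_bot.1 this
  · apply injective_toExt m
    rw [map_one]
    have h1 := congrArg (PresentedGroup.toGroup (lift_extGen m)) hy
    rw [map_pow, map_one] at h1
    set z := PresentedGroup.toGroup (lift_extGen m) y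
    -- Torsion dies in the quotient `ℤ`, hence lies in the free normal subgroup, which has none.
    have h2 := congrArg SemidirectProduct.rightHom h1
    rw [map_pow, map_one] at h2
    have h3 : SemidirectProduct.rightHom z = 1 := by
      have : t • (SemidirectProduct.rightHom z).toAdd = 0 := by
        rw [← toAdd_pow, h2, toAdd_one]
      exact (smul_eq_zero.1 this).resolve_left ht
    have h4 : z ∈ (SemidirectProduct.rightHom :
        Ext m →* Multiplicative ℤ).ker := h3
    rw [← SemidirectProduct.range_inl_eq_ker_rightHom] at h4
    obtain ⟨u, hu⟩ := h4
    rw [← hu] at h1 ⊢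
    rw [← map_pow, ← map_one SemidirectProduct.inl, SemidirectProduct.inl_inj] at h1
    rw [(pow_eq_one_iff_left ht).1 h1, map_one]

end SurfaceGroup

/-! ### The order of the canonical elliptic generators -/

lemma List.prod_ofFn_telescope {H : Type*} [Group H] {k : ℕ} (f : Fin k → H)
    (P : ℕ → H) (h : ∀ j : Fin k, P (j + 1) = P j * f j) :
    (List.ofFn f).prod = (P 0)⁻¹ * P k := by
  induction k with
  | zero => simp
  | succ k ih =>
    rw [List.ofFn_succ', List.concat_eq_append, List.prod_append,
      ih (fun j => f j.castSucc) (fun j => by simpa using h j.castSucc)]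
    have := h (Fin.last k)
    simp only [Fin.val_last] at this
    rw [this]
    simp [mul_assoc]

/-- Powers of a matrix with eigenvalues `l`, `m`, with the denominator `l - m` cleared. If `l ^ n =
m ^ n`, the term with `M` vanishes and the power is scalar. -/
lemma Matrix.sub_smul_pow_of_sq {R : Type*} [CommRing R] (M : Matrix (Fin 2) (Fin 2) R)
    (l m : R) (hM : M * M = (l + m) • M - (l * m) • (1 : Matrix (Fin 2) (Fin 2) R)) (n : ℕ) :
    (l - m) • M ^ n = (l ^ n - m ^ n) • M -
      (l ^ n * m - l * m ^ n) • (1 : Matrix (Fin 2) (Fin 2) R) := by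
  induction n with
  | zero => simp only [pow_zero]; module
  | succ n ih =>
    rw [pow_succ, ← smul_mul_assoc, ih, sub_mul, smul_mul_assoc, hM, smul_mul_assoc, one_mul,
      smul_sub, smul_smul, smul_smul]
    module

lemma Matrix.pow_eq_smul_one {K : Type*} [Field K] (M : Matrix (Fin 2) (Fin 2) K)
    {l m : K} (hlm : l ≠ m) (htr : M 0 0 + M 1 1 = l + m)
    (hdet : M 0 0 * M 1 1 - M 0 1 * M 1 0 = l * m) {n : ℕ} (hn : l ^ n = m ^ n) :
    M ^ n = l ^ n • (1 : Matrix (Fin 2) (Fin 2) K) := by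
  have hM : M * M = (l + m) • M - (l * m) • (1 : Matrix (Fin 2) (Fin 2) K) := by
    rw [← htr, ← hdet]
    ext i j
    fin_cases i <;> fin_cases j <;> simp [Matrix.mul_apply, Fin.sum_univ_two] <;> ring
  have h := Matrix.sub_smul_pow_of_sq M l m hM n
  have h2 : (l - m) • M ^ n = (l - m) • (l ^ n • (1 : Matrix (Fin 2) (Fin 2) K)) := by
    rw [h, ← hn, smul_smul, sub_self, zero_smul, zero_sub, ← neg_smul]
    congr 1
    ring
  exact smul_right_injective _ (sub_ne_zero.2 hlm) h2

/-- There are groups with elements `X Y Z = 1` with `X` of order divisible by `l`, `Y ^ m = 1` and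
`Z ^ n = 1`: inside `PGL(2, ℂ)`. -/
lemma exists_triangle {l m n : ℕ} (hl : 2 ≤ l) (hm : 2 ≤ m) (hn : 2 ≤ n) :
    ∃ (H : Type) (_ : Group H) (X Y Z : H), X * Y * Z = 1 ∧ X ^ l = 1 ∧ Y ^ m = 1 ∧ Z ^ n = 1 ∧
      ∀ t : ℕ, X ^ t = 1 → l ∣ t := by
  obtain ⟨ζ, hζ⟩ : ∃ ζ : ℂ, IsPrimitiveRoot ζ l := ⟨_, Complex.isPrimitiveRoot_exp l (by omega)⟩
  obtain ⟨η, hη⟩ : ∃ ζ : ℂ, IsPrimitiveRoot ζ m := ⟨_, Complex.isPrimitiveRoot_exp m (by omega)⟩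
  obtain ⟨θ, hθ⟩ : ∃ ζ : ℂ, IsPrimitiveRoot ζ n := ⟨_, Complex.isPrimitiveRoot_exp n (by omega)⟩
  have hζ1 : ζ ≠ 1 := hζ.ne_one (by omega)
  have hη1 : η ≠ 1 := hη.ne_one (by omega)
  have hθ1 : θ ≠ 1 := hθ.ne_one (by omega)
  have hζ0 : ζ ≠ 0 := hζ.ne_zero (by omega)
  have hη0 : η ≠ 0 := hη.ne_zero (by omega)
  have hθ0 : θ ≠ 0 := hθ.ne_zero (by omega)
  -- The eigenvalues of `X Y` shall be `μ` and `μ θ`, whose ratio has order `n`. Their product must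
  -- equal the determinant `ζ η`.
  obtain ⟨μ, hμ⟩ : ∃ μ : ℂ, μ ^ 2 = ζ * η / θ := IsAlgClosed.exists_pow_nat_eq _ two_pos
  have hμ2 : μ * μ * θ = ζ * η := by rw [← pow_two, hμ]; field_simp
  have hμ0 : μ ≠ 0 := by
    rintro rfl
    rw [zero_mul, zero_mul] at hμ2
    exact mul_ne_zero hζ0 hη0 hμ2.symm
  -- With diagonal `p, s` of `Y` and `p + s = 1 + η`, this solves `ζ p + s = μ (1 + θ)`, the trace
  -- condition for `X Y`. The entries of `MY` off the diagonal make its determinant `η`, so its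
  -- eigenvalues are 1 and `η`.
  set p := (μ * (1 + θ) - (1 + η)) / (ζ - 1) with hp
  have hp' : p * (ζ - 1) = μ * (1 + θ) - (1 + η) := div_mul_cancel₀ _ (sub_ne_zero.2 hζ1)
  set s := 1 + η - p with hs
  let MX : Matrix (Fin 2) (Fin 2) ℂ := !![ζ, 0; 0, 1]
  let MY : Matrix (Fin 2) (Fin 2) ℂ := !![p, p * s - η; 1, s]
  have hX : MX.det ≠ 0 := by simpa [MX, Matrix.det_fin_two] using hζ0
  have hY : MY.det ≠ 0 := by
    have : MY.det = η := by simp [MY, Matrix.det_fin_two]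
    rwa [this]
  let X := Matrix.GeneralLinearGroup.mkOfDetNeZero MX hX
  let Y := Matrix.GeneralLinearGroup.mkOfDetNeZero MY hY
  let C := Subgroup.center (GL (Fin 2) ℂ)
  have hXp : ∀ t : ℕ, MX ^ t = !![ζ ^ t, 0; 0, 1] := by
    intro t
    induction t with
    | zero => ext i j; fin_cases i <;> fin_cases j <;> simp
    | succ t ih =>
      rw [pow_succ, ih]
      ext i j
      fin_cases i <;> fin_cases j <;> simp [MX, Matrix.mul_apply, Fin.sum_univ_two, pow_succ]
  have hXl : X ^ l = 1 := by
    apply Units.ext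
    change MX ^ l = 1
    rw [hXp, hζ.pow_eq_one]
    ext i j; fin_cases i <;> fin_cases j <;> simp
  have hYm : Y ^ m = 1 := by
    apply Units.ext
    change MY ^ m = 1
    rw [Matrix.pow_eq_smul_one MY hη1.symm (by simp [MY, hs]) (by simp [MY])
      (by rw [hη.pow_eq_one, one_pow]), one_pow, one_smul]
  have hZn : (X * Y) ^ n ∈ C := by
    have h1 : (MX * MY) ^ n = μ ^ n • (1 : Matrix (Fin 2) (Fin 2) ℂ) := by
      refine Matrix.pow_eq_smul_one (MX * MY) (m := μ * θ) ?_ ?_ ?_ ?_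
      · intro h
        exact hθ1 (mul_left_cancel₀ hμ0 (by rw [mul_one]; exact h.symm))
      · simp [MX, MY, Matrix.mul_apply, Fin.sum_univ_two, hs]
        linear_combination hp'
      · simp [MX, MY, Matrix.mul_apply, Fin.sum_univ_two]
        linear_combination -hμ2
      · rw [mul_pow, hθ.pow_eq_one, mul_one]
    rw [Subgroup.mem_center_iff]
    intro A
    apply Units.ext
    change A.1 * (MX * MY) ^ n = (MX * MY) ^ n * A.1
    rw [h1]
    simp
  refine ⟨GL (Fin 2) ℂ ⧸ C, inferInstance, (X : GL (Fin 2) ℂ ⧸ C), (Y : GL (Fin 2) ℂ ⧸ C),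
    ((X * Y)⁻¹ : GL (Fin 2) ℂ), ?_, ?_, ?_, ?_, ?_⟩
  · rw [← QuotientGroup.mk_mul, ← QuotientGroup.mk_mul, mul_inv_cancel, QuotientGroup.mk_one]
  · rw [← QuotientGroup.mk_pow, hXl, QuotientGroup.mk_one]
  · rw [← QuotientGroup.mk_pow, hYm, QuotientGroup.mk_one]
  · rw [← QuotientGroup.mk_pow, QuotientGroup.eq_one_iff, inv_pow]
    exact C.inv_mem hZn
  · intro t ht
    rw [← QuotientGroup.mk_pow, QuotientGroup.eq_one_iff, Subgroup.mem_center_iff] at ht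
    -- Commuting with one unipotent matrix already forces the diagonal matrix `MX ^ t` to be scalar,
    -- that is `ζ ^ t = 1`.
    let MU : Matrix (Fin 2) (Fin 2) ℂ := !![1, 1; 0, 1]
    have hU : MU.det ≠ 0 := by simp [MU, Matrix.det_fin_two]
    have h1 := congrArg (fun A : GL (Fin 2) ℂ => A.1 0 1)
      (ht (Matrix.GeneralLinearGroup.mkOfDetNeZero MU hU))
    change (MU * MX ^ t) 0 1 = (MX ^ t * MU) 0 1 at h1
    rw [hXp] at h1
    simp [MU, Matrix.mul_apply, Fin.sum_univ_two] at h1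
    exact hζ.dvd_of_pow_eq_one t h1.symm

/-! ### Representations that detect the orders of the elliptic generators -/

namespace SignatureGen
variable {g k : ℕ} {period : Fin k → ℕ}

lemma orderOf_of_x (i : Fin k) (h : ∃ (H : Type) (_ : Group H)
      (Θ : PresentedGroup (relators g period) →* H),
      ∀ t : ℕ, Θ (PresentedGroup.of (x i)) ^ t = 1 → period i ∣ t) :
    orderOf (PresentedGroup.of (x i) : PresentedGroup (relators g period)) = period i := by
  obtain ⟨H, _, Θ, hΘ⟩ := h
  refine Nat.dvd_antisymm (orderOf_dvd_of_pow_eq_one (of_x_pow i)) (hΘ _ ?_)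
  rw [← map_pow, pow_orderOf_eq_one, map_one]

lemma orderOf_of_x_of_genus (hg : 1 ≤ g) (i : Fin k) :
    orderOf (PresentedGroup.of (x i) : PresentedGroup (relators g period)) = period i := by
  apply orderOf_of_x
  obtain ⟨g, rfl⟩ := Nat.exists_eq_add_of_le' hg
  set m := period i with hm
  -- A Heisenberg-type construction: the constant function `X` has order `m`, and its inverse is the
  -- commutator of the identity function `A` with the shift `B`. One handle therefore compensates a
  -- single `x_i`.
  let X : SheetWreath (Multiplicative (ZMod m)) m := ⟨fun _ => Multiplicative.ofAdd 1, 0⟩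
  have hX : ∀ t : ℕ, X ^ t = ⟨fun _ => Multiplicative.ofAdd (t : ZMod m), 0⟩ := by
    intro t
    induction t with
    | zero => rw [pow_zero]; exact SheetWreath.ext (funext fun _ => by simp) rfl
    | succ t ih =>
      rw [pow_succ, ih]
      exact SheetWreath.ext (funext fun _ => by simp [SheetWreath.mul_fn, X])
        (by simp [SheetWreath.mul_shift, X])
  let A : SheetWreath (Multiplicative (ZMod m)) m := ⟨fun j => Multiplicative.ofAdd j, 0⟩
  let B : SheetWreath (Multiplicative (ZMod m)) m := ⟨fun _ => 1, 1⟩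
  have hAB : X * (A⁻¹ * B⁻¹ * A * B) = 1 := by
    refine SheetWreath.ext (funext fun j => ?_) ?_
    · simp only [SheetWreath.mul_fn, SheetWreath.inv_fn, SheetWreath.mul_shift,
        SheetWreath.inv_shift, X, A, B, SheetWreath.one_fn]
      apply Multiplicative.toAdd.injective
      simp
    · simp [SheetWreath.mul_shift, SheetWreath.inv_shift, X, A, B]
  let F : SignatureGen (g + 1) k → SheetWreath (Multiplicative (ZMod m)) m
    | .a j => if j = 0 then A else 1
    | .b j => if j = 0 then B else 1
    | .x j => if j = i then X else 1
  have hF : ∀ r ∈ relators (g + 1) period, FreeGroup.lift F r = 1 := by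
    rintro r (rfl | ⟨j, rfl⟩)
    · have h1 : (List.ofFn fun j : Fin k => F (x j)).prod = X := by
        rw [List.prod_ofFn_telescope _ (fun t => if t ≤ i.val then 1 else X)]
        · simp
        · intro j
          rcases lt_trichotomy j i with h | h | h
          · have h' : j.val < i.val := h
            simp [F, h.ne, h'.le, Nat.succ_le_of_lt h']
          · simp [F, h]
          · have h' : i.val < j.val := h
            simp [F, h.ne', not_le.2 h', not_le.2 (Nat.lt_succ_of_lt h')]
      have h2 : (List.ofFn fun j : Fin (g + 1) => (F (a j))⁻¹ * (F (b j))⁻¹ * F (a j) *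
          F (b j)).prod = A⁻¹ * B⁻¹ * A * B := by
        simp [List.ofFn_succ, F]
      simp only [longRelator, map_mul, map_list_prod, List.map_ofFn, Function.comp_def,
        FreeGroup.lift_apply_of, map_inv, h1, h2]
      exact hAB
    · simp only [map_pow, FreeGroup.lift_apply_of, F]
      split_ifs with h
      · rw [hX, h, ← hm, ZMod.natCast_self]
        rfl
      · simp
  refine ⟨_, inferInstance, PresentedGroup.toGroup hF, fun t ht => ?_⟩
  rw [PresentedGroup.toGroup.of] at ht
  simp only [F, if_true] at ht
  rw [hX] at ht
  have := congrFun (congrArg SheetWreath.fn ht) 0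
  rw [← ZMod.natCast_eq_zero_iff]
  exact Multiplicative.ofAdd.injective this

/-- Three elements with trivial product, of orders dividing three of the periods, define a
representation. -/
lemma exists_hom_of_triple {H : Type} [Group H] {p q r : Fin k} (hpq : p < q) (hqr : q < r)
    {X Y Z : H} (h : X * Y * Z = 1) (hX : X ^ period p = 1) (hY : Y ^ period q = 1)
    (hZ : Z ^ period r = 1) :
    ∃ Θ : PresentedGroup (relators g period) →* H, Θ (PresentedGroup.of (x p)) = X ∧
      Θ (PresentedGroup.of (x q)) = Y ∧ Θ (PresentedGroup.of (x r)) = Z := by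
  let F : SignatureGen g k → H
    | .a _ => 1
    | .b _ => 1
    | .x j => if j = p then X else if j = q then Y else if j = r then Z else 1
  have hF : ∀ r ∈ relators g period, FreeGroup.lift F r = 1 := by
    rintro w (rfl | ⟨j, rfl⟩)
    · have h1 : (List.ofFn fun j : Fin k => F (x j)).prod = 1 := by
        rw [List.prod_ofFn_telescope _ (fun t => if t ≤ p.val then 1 else if t ≤ q.val then X else
          if t ≤ r.val then X * Y else 1)]
        · simp [not_le.2 p.2, not_le.2 q.2, not_le.2 r.2]
        · intro j
          have hpq' : p.val < q.val := hpq
          have hqr' : q.val < r.val := hqr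
          simp only [F, Fin.ext_iff]
          rcases lt_trichotomy j.val p.val with h1 | h1 | h1
          · rw [if_pos (by omega), if_pos (by omega), if_neg (by omega), if_neg (by omega),
              if_neg (by omega), mul_one]
          · rw [if_neg (by omega), if_pos (by omega), if_pos (by omega), if_pos (by omega),
              one_mul]
          rcases lt_trichotomy j.val q.val with h2 | h2 | h2
          · rw [if_neg (by omega), if_pos (by omega), if_neg (by omega), if_pos (by omega),
              if_neg (by omega), if_neg (by omega), if_neg (by omega), mul_one]
          · rw [if_neg (by omega), if_neg (by omega), if_pos (by omega), if_neg (by omega),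
              if_pos (by omega), if_neg (by omega), if_pos (by omega)]
          rcases lt_trichotomy j.val r.val with h3 | h3 | h3
          · rw [if_neg (by omega), if_neg (by omega), if_pos (by omega), if_neg (by omega),
              if_neg (by omega), if_pos (by omega), if_neg (by omega), if_neg (by omega),
              if_neg (by omega), mul_one]
          · rw [if_neg (by omega), if_neg (by omega), if_neg (by omega), if_neg (by omega),
              if_neg (by omega), if_pos (by omega), if_neg (by omega), if_neg (by omega),
              if_pos (by omega), h]
          · rw [if_neg (by omega), if_neg (by omega), if_neg (by omega), if_neg (by omega),
              if_neg (by omega), if_neg (by omega), if_neg (by omega), if_neg (by omega),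
              if_neg (by omega), mul_one]
      simp only [longRelator, map_mul, map_list_prod, List.map_ofFn, Function.comp_def,
        FreeGroup.lift_apply_of, map_inv, h1]
      simp [F]
    · simp only [map_pow, FreeGroup.lift_apply_of, F]
      split_ifs with h1 h2 h3
      · rwa [h1]
      · rwa [h2]
      · rwa [h3]
      · exact one_pow _
  refine ⟨PresentedGroup.toGroup hF, ?_, ?_, ?_⟩
  · rw [PresentedGroup.toGroup.of]; simp [F]
  · rw [PresentedGroup.toGroup.of]; simp [F, hpq.ne']
  · rw [PresentedGroup.toGroup.of]; simp [F, hqr.ne', (hpq.trans hqr).ne']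

lemma orderOf_of_x_of_three_le (hk : 3 ≤ k) (hp : ∀ i, 2 ≤ period i) (i : Fin k) :
    orderOf (PresentedGroup.of (x i) : PresentedGroup (relators g period)) = period i := by
  apply orderOf_of_x
  -- The relation `X Y Z = 1` is invariant under cyclic rotation, so the element of controlled order
  -- can be placed first, second or third among three indices.
  rcases i with ⟨_ | _ | i, hi⟩
  · let q : Fin k := ⟨1, by omega⟩
    let r : Fin k := ⟨2, by omega⟩
    obtain ⟨H, _, X, Y, Z, h, hX, hY, hZ, ht⟩ := exists_triangle (hp ⟨0, hi⟩) (hp q) (hp r)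
    obtain ⟨Θ, h1, -, -⟩ := exists_hom_of_triple (g := g) (p := ⟨0, hi⟩) (q := q) (r := r)
      (by simp [q]) (by simp [q, r]) h hX hY hZ
    exact ⟨H, _, Θ, fun t h => ht t (by rwa [h1] at h)⟩
  · let p : Fin k := ⟨0, by omega⟩
    let r : Fin k := ⟨2, by omega⟩
    obtain ⟨H, _, X, Y, Z, h, hX, hY, hZ, ht⟩ := exists_triangle (hp ⟨0 + 1, hi⟩) (hp r) (hp p)
    have h' : Z * X * Y = 1 := by
      rw [mul_assoc, mul_eq_one_iff_inv_eq]
      exact (eq_inv_of_mul_eq_one_left h ▸ rfl : Z⁻¹ = X * Y)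
    obtain ⟨Θ, -, h1, -⟩ := exists_hom_of_triple (g := g) (p := p) (q := ⟨0 + 1, hi⟩) (r := r)
      (by simp [p]) (by simp [r]) h' hZ hX hY
    exact ⟨H, _, Θ, fun t h => ht t (by rwa [h1] at h)⟩
  · let p : Fin k := ⟨0, by omega⟩
    let q : Fin k := ⟨1, by omega⟩
    obtain ⟨H, _, X, Y, Z, h, hX, hY, hZ, ht⟩ := exists_triangle (hp ⟨i + 1 + 1, hi⟩) (hp p) (hp q)
    have h' : Y * Z * X = 1 := by
      rw [mul_assoc] at h
      exact mul_eq_one_comm.1 h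
    obtain ⟨Θ, -, -, h1⟩ := exists_hom_of_triple (g := g) (p := p) (q := q) (r := ⟨i + 1 + 1, hi⟩)
      (by simp [p, q]) (by simp [q, Fin.lt_def]) h' hY hZ hX
    exact ⟨H, _, Θ, fun t h => ht t (by rwa [h1] at h)⟩

/-- With genus `0` and at most two periods the group is finite. -/
lemma finite_of_lt_three (hk : k < 3) (hp : ∀ i, 2 ≤ period i) :
    Finite (PresentedGroup (relators 0 period)) := by
  have hcl := closure_of_presented 0 period
  have hgen : ∃ y : PresentedGroup (relators 0 period), IsOfFinOrder y ∧
      ∀ z, z ∈ Subgroup.zpowers y := by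
    have hlong : (List.ofFn fun j : Fin k =>
        (PresentedGroup.of (x j) : PresentedGroup (relators 0 period))).prod = 1 := by
      have h1 := wordVal_of_longBlocks (g := 0) (period := period)
      rw [wordVal_longBlocks] at h1
      simpa [longRelator, map_list_prod, List.map_ofFn, Function.comp_def] using h1
    have key : ∀ y : PresentedGroup (relators 0 period),
        (∀ j, PresentedGroup.of (x j) ∈ Subgroup.zpowers y) → ∀ z, z ∈ Subgroup.zpowers y := by
      intro y hy z
      have hz : z ∈ Subgroup.closure (Set.range (PresentedGroup.of :
          SignatureGen 0 k → PresentedGroup (relators 0 period))) := by rw [hcl]; trivial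
      refine (Subgroup.closure_le _).2 ?_ hz
      rintro _ ⟨s, rfl⟩
      rcases s with i | i | j
      · exact i.elim0
      · exact i.elim0
      · exact hy j
    interval_cases k
    · exact ⟨1, IsOfFinOrder.one, key 1 fun j => j.elim0⟩
    · refine ⟨1, IsOfFinOrder.one, key 1 fun j => ?_⟩
      obtain rfl := Subsingleton.elim j 0
      have : (PresentedGroup.of (x 0) : PresentedGroup (relators 0 period)) = 1 := by
        simpa using hlong
      rw [this]
      exact one_mem _
    · refine ⟨PresentedGroup.of (x 0), isOfFinOrder_iff_pow_eq_one.2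
        ⟨period 0, by have := hp 0; omega, of_x_pow 0⟩, key _ fun j => ?_⟩
      have h2 : (PresentedGroup.of (x 0) : PresentedGroup (relators 0 period)) *
          PresentedGroup.of (x 1) = 1 := by
        simpa [List.ofFn_succ] using hlong
      fin_cases j
      · exact Subgroup.mem_zpowers _
      · change PresentedGroup.of (x 1) ∈ _
        rw [eq_inv_of_mul_eq_one_right h2]
        exact inv_mem (Subgroup.mem_zpowers _)
  obtain ⟨y, hy, hz⟩ := hgen
  have : (Subgroup.zpowers y : Set (PresentedGroup (relators 0 period))).Finite :=
    finite_zpowers.2 hy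
  have h3 : (Set.univ : Set (PresentedGroup (relators 0 period))).Finite :=
    this.subset fun z _ => hz z
  exact Set.finite_univ_iff.1 h3

end SignatureGen

/-! ### Counting tuples of elements of given orders with trivial product in a cyclic group -/

namespace CyclicCount

variable {G : Type} [CommGroup G]

/-- The sum of the elements of a subset, in the group algebra. -/
noncomputable def setSum (S : Finset G) : MonoidAlgebra ℚ G := ∑ x ∈ S, MonoidAlgebra.of ℚ G x

lemma coeff_setSum [DecidableEq G] (S : Finset G) (x : G) :
    (setSum S).coeff x = if x ∈ S then 1 else 0 := by
  classical
  simp [setSum, MonoidAlgebra.of_apply, Finsupp.single_apply, Finset.sum_apply']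

lemma setSum_mul_setSum (S T : Finset G) :
    setSum S * setSum T = ∑ x ∈ S ×ˢ T, MonoidAlgebra.of ℚ G (x.1 * x.2) := by
  simp only [setSum, Finset.sum_mul_sum, Finset.sum_product, map_mul]

lemma eq_one_of_coprime {d d' : ℕ} (h : d.Coprime d') {u : G} (h1 : u ^ d = 1) (h2 : u ^ d' = 1) :
    u = 1 := by
  have := Nat.dvd_gcd (orderOf_dvd_of_pow_eq_one h1) (orderOf_dvd_of_pow_eq_one h2)
  rw [h.gcd_eq_one, Nat.dvd_one] at this
  exact orderOf_eq_one_iff.1 this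

lemma exists_mul_of_coprime {d d' : ℕ} (h : d.Coprime d') {y : G} (hy : y ^ (d * d') = 1) :
    ∃ u v : G, u ^ d = 1 ∧ v ^ d' = 1 ∧ u * v = y := by
  have hb := Nat.gcd_eq_gcd_ab d d'
  rw [h.gcd_eq_one] at hb
  refine ⟨y ^ ((d' : ℤ) * d.gcdB d'), y ^ ((d : ℤ) * d.gcdA d'), ?_, ?_, ?_⟩
  · rw [← zpow_natCast, ← zpow_mul]
    have : (d' : ℤ) * d.gcdB d' * d = ((d * d' : ℕ) : ℤ) * d.gcdB d' := by push_cast; ring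
    rw [this, zpow_mul, zpow_natCast, hy, one_zpow]
  · rw [← zpow_natCast, ← zpow_mul]
    have : (d : ℤ) * d.gcdA d' * d' = ((d * d' : ℕ) : ℤ) * d.gcdA d' := by push_cast; ring
    rw [this, zpow_mul, zpow_natCast, hy, one_zpow]
  · rw [← zpow_add, add_comm, ← hb]
    simp

/-- An element killed by `d * d'` is uniquely a product of elements killed by `d` and by `d'`;
multiplication thus matches `S × T` with `U`. -/
lemma setSum_mul_of_coprime {d d' : ℕ} (h : d.Coprime d') {S T U : Finset G}
    (hS : ∀ u ∈ S, u ^ d = 1) (hT : ∀ v ∈ T, v ^ d' = 1) (hU : ∀ y ∈ U, y ^ (d * d') = 1)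
    (hmem : ∀ u v, u ^ d = 1 → v ^ d' = 1 → (u * v ∈ U ↔ u ∈ S ∧ v ∈ T)) :
    setSum S * setSum T = setSum U := by
  rw [setSum_mul_setSum, setSum]
  refine Finset.sum_bij (fun x _ => x.1 * x.2) ?_ ?_ ?_ ?_
  · rintro ⟨u, v⟩ hx
    rw [Finset.mem_product] at hx
    exact (hmem u v (hS u hx.1) (hT v hx.2)).2 hx
  · rintro ⟨u, v⟩ hx ⟨u', v'⟩ hx' heq
    rw [Finset.mem_product] at hx hx'
    simp only at heq
    have h1 : u * u'⁻¹ = v' * v⁻¹ := by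
      rw [mul_inv_eq_iff_eq_mul, mul_assoc, mul_comm v⁻¹, ← mul_assoc, eq_mul_inv_iff_mul_eq, heq,
        mul_comm]
    have h2 : u * u'⁻¹ = 1 := by
      refine eq_one_of_coprime h ?_ ?_
      · rw [mul_pow, inv_pow, hS u hx.1, hS u' hx'.1, inv_one, one_mul]
      · rw [h1, mul_pow, inv_pow, hT v hx.2, hT v' hx'.2, inv_one, one_mul]
    rw [h2] at h1
    rw [mul_inv_eq_one.1 h2, mul_inv_eq_one.1 h1.symm]
  · intro y hy
    obtain ⟨u, v, hu, hv, rfl⟩ := exists_mul_of_coprime h (hU y hy)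
    exact ⟨(u, v), Finset.mem_product.2 ((hmem u v hu hv).1 hy), rfl⟩
  · intro x _
    rfl

variable [Fintype G] [DecidableEq G]

/-- The elements of order `d`. -/
noncomputable def orderSet (G : Type) [CommGroup G] [Fintype G] [DecidableEq G] (d : ℕ) :
    Finset G :=
  Finset.univ.filter fun x => orderOf x = d

/-- The elements killed by `d`. -/
noncomputable def torsionSet (G : Type) [CommGroup G] [Fintype G] [DecidableEq G] (d : ℕ) :
    Finset G :=
  Finset.univ.filter fun x => x ^ d = 1

@[simp] lemma mem_orderSet {d : ℕ} {x : G} : x ∈ orderSet G d ↔ orderOf x = d := by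
  simp [orderSet]

@[simp] lemma mem_torsionSet {d : ℕ} {x : G} : x ∈ torsionSet G d ↔ x ^ d = 1 := by
  simp [torsionSet]

lemma setSum_orderSet_mul {d d' : ℕ} (h : d.Coprime d') :
    setSum (orderSet G (d * d')) = setSum (orderSet G d) * setSum (orderSet G d') := by
  symm
  refine setSum_mul_of_coprime h ?_ ?_ ?_ ?_
  · intro u hu
    rw [← mem_orderSet.1 hu, pow_orderOf_eq_one]
  · intro u hu
    rw [← mem_orderSet.1 hu, pow_orderOf_eq_one]
  · intro u hu
    rw [← mem_orderSet.1 hu, pow_orderOf_eq_one]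
  · intro u v hu hv
    have hu' := orderOf_dvd_of_pow_eq_one hu
    have hv' := orderOf_dvd_of_pow_eq_one hv
    have hco : (orderOf u).Coprime (orderOf v) := h.of_dvd hu' hv'
    simp only [mem_orderSet, (Commute.all u v).orderOf_mul_eq_mul_orderOf_of_coprime hco]
    constructor
    · intro heq
      constructor
      · refine Nat.dvd_antisymm hu' ?_
        refine Nat.Coprime.dvd_of_dvd_mul_right (h.of_dvd_right hv') ?_
        rw [heq]; exact dvd_mul_right _ _
      · refine Nat.dvd_antisymm hv' ?_
        refine Nat.Coprime.dvd_of_dvd_mul_left (h.symm.of_dvd_right hu') ?_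
        rw [heq]; exact dvd_mul_left _ _
    · rintro ⟨h1, h2⟩
      rw [h1, h2]

lemma setSum_torsionSet_mul {d d' : ℕ} (h : d.Coprime d') :
    setSum (torsionSet G d) * setSum (torsionSet G d') = setSum (torsionSet G (d * d')) := by
  refine setSum_mul_of_coprime h (by simp) (by simp) (by simp) ?_
  intro u v hu hv
  simp only [mem_torsionSet, hu, hv, and_self, iff_true]
  rw [mul_pow, pow_mul, hu, one_pow, mul_comm d, pow_mul, hv, one_pow, one_mul]

lemma setSum_orderSet_one : setSum (orderSet G 1) = 1 := by
  have : orderSet G 1 = {1} := by ext x; simp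
  rw [this, setSum, Finset.sum_singleton, map_one]

lemma setSum_torsionSet_one : setSum (torsionSet G 1) = 1 := by
  have : torsionSet G 1 = {1} := by ext x; simp
  rw [this, setSum, Finset.sum_singleton, map_one]

/-- Translation by an element of a subgroup permutes it, so every element of `S` fixes the subgroup
sum. -/
lemma setSum_mul_torsionSet {d : ℕ} {S : Finset G} (hS : ∀ u ∈ S, u ^ d = 1) :
    setSum S * setSum (torsionSet G d) = (S.card : ℚ) • setSum (torsionSet G d) := by
  have : ∀ u ∈ S, MonoidAlgebra.of ℚ G u * setSum (torsionSet G d) = setSum (torsionSet G d) := by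
    intro u hu
    rw [setSum, Finset.mul_sum]
    refine Finset.sum_bij (fun x _ => u * x) ?_ ?_ ?_ ?_
    · intro x hx
      rw [mem_torsionSet] at hx ⊢
      rw [mul_pow, hS u hu, hx, one_mul]
    · intro x _ y _ h
      exact mul_left_cancel h
    · intro y hy
      rw [mem_torsionSet] at hy
      refine ⟨u⁻¹ * y, ?_, by simp⟩
      rw [mem_torsionSet, mul_pow, inv_pow, hS u hu, hy, inv_one, one_mul]
    · intro x _
      rw [map_mul]
  nth_rw 1 [setSum]
  rw [Finset.sum_mul, Finset.sum_congr rfl this, Finset.sum_const, Nat.cast_smul_eq_nsmul]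

lemma setSum_orderSet_prime_pow {p : ℕ} (hp : p.Prime) (w : ℕ) :
    setSum (orderSet G (p ^ (w + 1))) =
      setSum (torsionSet G (p ^ (w + 1))) - setSum (torsionSet G (p ^ w)) := by
  have hsub : torsionSet G (p ^ w) ⊆ torsionSet G (p ^ (w + 1)) := by
    intro x hx
    rw [mem_torsionSet] at hx ⊢
    rw [pow_succ, pow_mul, hx, one_pow]
  have : orderSet G (p ^ (w + 1)) = torsionSet G (p ^ (w + 1)) \ torsionSet G (p ^ w) := by
    ext x
    rw [Finset.mem_sdiff, mem_orderSet, mem_torsionSet, mem_torsionSet]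
    constructor
    · intro h
      refine ⟨by rw [← h, pow_orderOf_eq_one], fun h' => ?_⟩
      have := orderOf_dvd_of_pow_eq_one h'
      rw [h, Nat.pow_dvd_pow_iff_le_right hp.one_lt] at this
      omega
    · rintro ⟨h1, h2⟩
      have := Fact.mk hp
      exact orderOf_eq_prime_pow h2 h1
  rw [this, eq_sub_iff_add_eq, setSum, setSum, setSum, Finset.sum_sdiff hsub]

/-- Subgroup sums of coprime exponents multiply to subgroup sums, and each has coefficient 1 at the
identity; so every prime contributes the sum of its two coefficients. The spare factor with exponent
`d` carries the induction. -/
lemma coeff_one_prod {S : Finset ℕ} (hS : ∀ p ∈ S, p.Prime) (a b : ℕ → ℚ) (u v : ℕ → ℕ) (d : ℕ)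
    (hd : ∀ p ∈ S, p.Coprime d) :
    ((∏ p ∈ S, (a p • setSum (torsionSet G (p ^ u p)) + b p • setSum (torsionSet G (p ^ v p)))) *
      setSum (torsionSet G d)).coeff 1 = ∏ p ∈ S, (a p + b p) := by
  induction S using Finset.induction_on generalizing d with
  | empty => simp [coeff_setSum]
  | insert p S hp ih =>
    have hpd := hd p (Finset.mem_insert_self _ _)
    have hS' : ∀ q ∈ S, q.Prime := fun q hq => hS q (Finset.mem_insert_of_mem hq)
    have hco : ∀ j, ∀ q ∈ S, q.Coprime (p ^ j * d) := by
      intro j q hq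
      refine Nat.Coprime.mul_right (Nat.Coprime.pow_right _ ?_)
        (hd q (Finset.mem_insert_of_mem hq))
      refine (Nat.coprime_primes (hS' q hq) (hS p (Finset.mem_insert_self _ _))).2 ?_
      rintro rfl
      exact hp hq
    rw [Finset.prod_insert hp, Finset.prod_insert hp, mul_comm (_ + _), mul_assoc, add_mul, mul_add,
      smul_mul_assoc, smul_mul_assoc, setSum_torsionSet_mul (hpd.pow_left _),
      setSum_torsionSet_mul (hpd.pow_left _), mul_smul_comm, mul_smul_comm]
    rw [MonoidAlgebra.coeff_add, MonoidAlgebra.coeff_smul, MonoidAlgebra.coeff_smul,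
      Finsupp.add_apply, Finsupp.smul_apply, Finsupp.smul_apply, ih hS' _ (hco _),
      ih hS' _ (hco _), smul_eq_mul, smul_eq_mul, ← add_mul]

/-- The number of tuples of elements of orders `n_i` with trivial product, as a coefficient. -/
lemma card_tuples {k : ℕ} (m : Fin k → ℕ) :
    ((Finset.univ.filter fun y : Fin k → G => (∀ i, orderOf (y i) = m i) ∧ ∏ i, y i = 1).card : ℚ) =
      (∏ i, setSum (orderSet G (m i))).coeff 1 := by
  simp only [setSum]
  rw [Finset.prod_univ_sum]
  simp only [← map_prod]
  rw [MonoidAlgebra.coeff_sum, Finsupp.finsetSum_apply]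
  simp only [MonoidAlgebra.of_apply, MonoidAlgebra.coeff_single, Finsupp.single_apply]
  rw [← Finset.sum_filter, Finset.sum_const, nsmul_eq_mul, mul_one]
  congr 2
  ext y
  simp [Fintype.mem_piFinset]

/-! ### Prime-power factors in a cyclic group -/

variable [IsCyclic G]

lemma card_orderSet {d : ℕ} (hd : d ∣ Fintype.card G) : (orderSet G d).card = d.totient :=
  IsCyclic.card_orderOf_eq_totient hd

lemma card_torsionSet {d : ℕ} (hd : d ∣ Fintype.card G) : (torsionSet G d).card = d := by
  have := IsCyclic.card_powMonoidHom_ker (G := G) d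
  rw [Nat.card_eq_fintype_card (α := G), Nat.gcd_eq_right hd] at this
  nth_rw 2 [← this]
  rw [torsionSet, Nat.card_eq_fintype_card, Fintype.card_subtype]
  congr 1
  ext x
  simp [MonoidHom.mem_ker]

/-- Powers of the sum of the elements of order `p ^ (w + 1)`. -/
lemma setSum_orderSet_pow {p w : ℕ} (hp : p.Prime) (hd : p ^ (w + 1) ∣ Fintype.card G) (e : ℕ) :
    setSum (orderSet G (p ^ (w + 1))) ^ (e + 1) =
      (((p : ℚ) ^ w * (p - 1)) ^ (e + 1) / p ^ (w + 1) - (-(p : ℚ) ^ w) ^ (e + 1) / p ^ (w + 1)) •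
          setSum (torsionSet G (p ^ (w + 1))) +
        ((-(p : ℚ) ^ w) ^ (e + 1) / p ^ w) • setSum (torsionSet G (p ^ w)) := by
  have hp0 : (p : ℚ) ≠ 0 := by exact_mod_cast hp.ne_zero
  have hd' : p ^ w ∣ Fintype.card G := (pow_dvd_pow p (Nat.le_succ w)).trans hd
  set H := setSum (torsionSet G (p ^ (w + 1))) with hH
  set H' := setSum (torsionSet G (p ^ w)) with hH'
  have h1 : H * H = (p : ℚ) ^ (w + 1) • H := by
    have := setSum_mul_torsionSet (G := G) (d := p ^ (w + 1)) (S := torsionSet G (p ^ (w + 1)))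
      (by simp)
    rw [card_torsionSet hd] at this
    rw [hH, this]; push_cast; rfl
  have h2 : H' * H = (p : ℚ) ^ w • H := by
    have := setSum_mul_torsionSet (G := G) (d := p ^ (w + 1)) (S := torsionSet G (p ^ w)) (by
      intro u hu
      rw [mem_torsionSet] at hu
      rw [pow_succ, pow_mul, hu, one_pow])
    rw [card_torsionSet hd'] at this
    rw [hH, hH', this]; push_cast; rfl
  have h3 : H' * H' = (p : ℚ) ^ w • H' := by
    have := setSum_mul_torsionSet (G := G) (d := p ^ w) (S := torsionSet G (p ^ w)) (by simp)
    rw [card_torsionSet hd'] at this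
    rw [hH', this]; push_cast; rfl
  -- `H / p^(w+1)` and `H' / p^w - H / p^(w+1)` are orthogonal idempotents, on which `H - H'` acts
  -- by `p^w (p - 1)` and `-p^w`. The claim is the resulting formula for positive powers.
  rw [setSum_orderSet_prime_pow hp w, ← hH, ← hH']
  induction e with
  | zero =>
    have c1 : ((p : ℚ) ^ w * (p - 1)) ^ (0 + 1) / p ^ (w + 1) -
        (-(p : ℚ) ^ w) ^ (0 + 1) / p ^ (w + 1) = 1 := by
      field_simp
      ring
    have c2 : (-(p : ℚ) ^ w) ^ (0 + 1) / p ^ w = -1 := by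
      rw [zero_add, pow_one]
      field_simp
    rw [c1, c2, zero_add, pow_one]
    module
  | succ e ih =>
    rw [pow_succ, ih, mul_sub, add_mul, add_mul, smul_mul_assoc, smul_mul_assoc, smul_mul_assoc,
      smul_mul_assoc, h1, h2, h3, mul_comm H H', h2, smul_smul, smul_smul, smul_smul, smul_smul]
    set A : ℚ := ((p : ℚ) ^ w * (p - 1)) ^ (e + 1) / p ^ (w + 1) -
      (-(p : ℚ) ^ w) ^ (e + 1) / p ^ (w + 1) with hA
    set B : ℚ := (-(p : ℚ) ^ w) ^ (e + 1) / p ^ w with hB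
    have c1 : ((p : ℚ) ^ w * (p - 1)) ^ (e + 1 + 1) / p ^ (w + 1) -
        (-(p : ℚ) ^ w) ^ (e + 1 + 1) / p ^ (w + 1) =
          A * p ^ (w + 1) + B * p ^ w - A * p ^ w := by
      rw [hA, hB, pow_succ _ (e + 1), pow_succ _ (e + 1)]
      field_simp
      ring
    have c2 : (-(p : ℚ) ^ w) ^ (e + 1 + 1) / p ^ w = -(B * p ^ w) := by
      rw [hB, pow_succ _ (e + 1)]
      field_simp
    rw [c1, c2]
    module

/-- The product over a family of orders `p ^ r i`, at least one of which is the largest. -/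
lemma exists_prod_prime_pow {ι : Type} [Fintype ι] {p w : ℕ} (hp : p.Prime)
    (hd : p ^ (w + 1) ∣ Fintype.card G) (r : ι → ℕ) (hr : ∀ i, r i ≤ w + 1)
    {e : ℕ} (he : (Finset.univ.filter fun i => r i = w + 1).card = e) (he0 : e ≠ 0) :
    ∃ a b : ℚ, ∏ i, setSum (orderSet G (p ^ r i)) =
        a • setSum (torsionSet G (p ^ (w + 1))) + b • setSum (torsionSet G (p ^ w)) ∧
      a + b = (∏ i, ((p ^ r i).totient : ℚ)) / p ^ (w + 1) *
        (1 - (-1) ^ (e - 1) / ((p : ℚ) - 1) ^ (e - 1)) := by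
  classical
  have hp0 : (p : ℚ) ≠ 0 := by exact_mod_cast hp.ne_zero
  have hp1 : (p : ℚ) - 1 ≠ 0 := sub_ne_zero.2 (by exact_mod_cast hp.ne_one)
  obtain ⟨e, rfl⟩ := Nat.exists_eq_succ_of_ne_zero he0
  -- An element of order `p ^ r` with `r ≤ w` lies in both subgroups, so such a factor acts as
  -- multiplication by its number of terms, a totient.
  have hlow : ∀ (S : Finset ι), (∀ i ∈ S, r i ≤ w) → ∀ a b : ℚ,
      (∏ i ∈ S, setSum (orderSet G (p ^ r i))) *
        (a • setSum (torsionSet G (p ^ (w + 1))) + b • setSum (torsionSet G (p ^ w))) =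
      ((∏ i ∈ S, ((p ^ r i).totient : ℚ)) * a) • setSum (torsionSet G (p ^ (w + 1))) +
        ((∏ i ∈ S, ((p ^ r i).totient : ℚ)) * b) • setSum (torsionSet G (p ^ w)) := by
    intro S
    induction S using Finset.induction_on with
    | empty => simp
    | insert i S hi ih =>
      intro hS a b
      have hri := hS i (Finset.mem_insert_self _ _)
      have hc : (orderSet G (p ^ r i)).card = (p ^ r i).totient :=
        card_orderSet ((pow_dvd_pow p (by omega)).trans hd)
      have hm : ∀ j, r i ≤ j → setSum (orderSet G (p ^ r i)) * setSum (torsionSet G (p ^ j)) =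
          ((p ^ r i).totient : ℚ) • setSum (torsionSet G (p ^ j)) := by
        intro j hj
        rw [← hc]
        refine setSum_mul_torsionSet fun u hu => ?_
        obtain ⟨c, hc⟩ := pow_dvd_pow p hj
        rw [hc, pow_mul, ← mem_orderSet.1 hu, pow_orderOf_eq_one, one_pow]
      rw [Finset.prod_insert hi, mul_assoc, ih (fun j hj => hS j (Finset.mem_insert_of_mem hj)),
        mul_add, mul_smul_comm, mul_smul_comm, hm _ (by omega), hm _ hri, smul_smul, smul_smul,
        Finset.prod_insert hi]
      congr 2 <;> ring
  have htop : ∏ i with r i = w + 1, setSum (orderSet G (p ^ r i)) =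
      setSum (orderSet G (p ^ (w + 1))) ^ (e + 1) := by
    rw [Finset.prod_congr rfl (g := fun _ => setSum (orderSet G (p ^ (w + 1)))), Finset.prod_const,
      he]
    intro i hi
    rw [(Finset.mem_filter.1 hi).2]
  have htop' : ∏ i with r i = w + 1, ((p ^ r i).totient : ℚ) =
      ((p : ℚ) ^ w * (p - 1)) ^ (e + 1) := by
    rw [Finset.prod_congr rfl (g := fun _ => (p : ℚ) ^ w * (p - 1)), Finset.prod_const, he]
    intro i hi
    rw [(Finset.mem_filter.1 hi).2, Nat.totient_prime_pow_succ hp, Nat.cast_mul,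
      Nat.cast_pred hp.pos, Nat.cast_pow]
  have hlow' := hlow (Finset.univ.filter fun i => ¬ r i = w + 1) (by
    intro i hi
    have h1 := (Finset.mem_filter.1 hi).2
    have h2 := hr i
    omega)
  refine ⟨(∏ i with ¬ r i = w + 1, ((p ^ r i).totient : ℚ)) *
      (((p : ℚ) ^ w * (p - 1)) ^ (e + 1) / p ^ (w + 1) - (-(p : ℚ) ^ w) ^ (e + 1) / p ^ (w + 1)),
    (∏ i with ¬ r i = w + 1, ((p ^ r i).totient : ℚ)) * ((-(p : ℚ) ^ w) ^ (e + 1) / p ^ w), ?_, ?_⟩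
  · rw [← Finset.prod_filter_mul_prod_filter_not Finset.univ (fun i => r i = w + 1), htop,
      setSum_orderSet_pow hp hd, mul_comm, hlow']
  · rw [← Finset.prod_filter_mul_prod_filter_not Finset.univ (fun i => r i = w + 1), htop',
      Nat.succ_sub_one, neg_pow ((p : ℚ) ^ w) (e + 1), mul_pow]
    field_simp
    ring

/-- The number of tuples of elements of orders `n_i` with trivial product in a cyclic group whose
order is divisible by all `n_i`. -/
theorem card_tuples_eq {k : ℕ} (period : Fin k → ℕ) (hpos : ∀ i, period i ≠ 0)
    (hdvd : Finset.univ.lcm period ∣ Fintype.card G) :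
    ((Finset.univ.filter fun y : Fin k → G =>
        (∀ i, orderOf (y i) = period i) ∧ ∏ i, y i = 1).card : ℚ) =
      (∏ i, (Nat.totient (period i) : ℚ)) / (Finset.univ.lcm period : ℕ) *
        ∏ p ∈ (Finset.univ.lcm period).primeFactors,
          (1 - (-1) ^ (periodCount period p - 1) / ((p : ℚ) - 1) ^ (periodCount period p - 1)) := by
  set N := Finset.univ.lcm period with hN
  have hN0 : N ≠ 0 := by
    intro h
    rw [hN, Finset.lcm_eq_zero_iff] at h
    obtain ⟨i, -, hi⟩ := h
    exact hpos i hi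
  have hiN : ∀ i, period i ∣ N := fun i => Finset.dvd_lcm (Finset.mem_univ i)
  have hsupp : ∀ i, (period i).factorization.support ⊆ N.primeFactors := fun i =>
    Nat.primeFactors_mono (hiN i) hN0
  have hE : ∀ i, setSum (orderSet G (period i)) =
      ∏ p ∈ N.primeFactors, setSum (orderSet G (p ^ (period i).factorization p)) := by
    intro i
    rw [Nat.multiplicative_factorization (fun d => setSum (orderSet G d))
      (fun x y h => setSum_orderSet_mul h) setSum_orderSet_one (hpos i)]
    exact Finsupp.prod_of_support_subset _ (hsupp i) _ (fun p _ => by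
      rw [pow_zero, setSum_orderSet_one])
  have hφ : ∀ i, ((period i).totient : ℚ) =
      ∏ p ∈ N.primeFactors, ((p ^ (period i).factorization p).totient : ℚ) := by
    intro i
    rw [Nat.multiplicative_factorization (fun d => (d.totient : ℚ))
      (fun x y h => by rw [Nat.totient_mul h, Nat.cast_mul]) (by simp) (hpos i)]
    exact Finsupp.prod_of_support_subset _ (hsupp i) _ (fun p _ => by simp)
  have hlocal : ∀ p ∈ N.primeFactors, ∃ a b : ℚ,
      ∏ i, setSum (orderSet G (p ^ (period i).factorization p)) =
        a • setSum (torsionSet G (p ^ N.factorization p)) +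
          b • setSum (torsionSet G (p ^ (N.factorization p - 1))) ∧
      a + b = (∏ i, ((p ^ (period i).factorization p).totient : ℚ)) / p ^ N.factorization p *
        (1 - (-1) ^ (periodCount period p - 1) / ((p : ℚ) - 1) ^ (periodCount period p - 1)) := by
    intro p hp
    have hpp := Nat.prime_of_mem_primeFactors hp
    have hw : N.factorization p ≠ 0 := by
      have := (hpp.dvd_iff_one_le_factorization hN0).1 (Nat.dvd_of_mem_primeFactors hp)
      omega
    obtain ⟨w, hw⟩ := Nat.exists_eq_succ_of_ne_zero hw
    have hle : ∀ i, (period i).factorization p ≤ N.factorization p := fun i =>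
      (Nat.factorization_le_iff_dvd (hpos i) hN0).2 (hiN i) p
    have hcount : ∀ i, ¬ p ∣ N / period i ↔ (period i).factorization p = N.factorization p := by
      intro i
      have h0 : N / period i ≠ 0 := (Nat.div_pos (Nat.le_of_dvd (Nat.pos_of_ne_zero hN0) (hiN i))
        (Nat.pos_of_ne_zero (hpos i))).ne'
      rw [hpp.dvd_iff_one_le_factorization h0, Nat.factorization_div (hiN i), Finsupp.tsub_apply]
      have := hle i
      omega
    have hpc : (Finset.univ.filter fun i => (period i).factorization p = w + 1).card =
        periodCount period p := by
      rw [periodCount]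
      congr 1
      refine Finset.filter_congr fun i _ => ?_
      rw [hcount, hw]
    rw [hw]
    refine exists_prod_prime_pow hpp ?_ _ (fun i => (hle i).trans_eq hw) hpc ?_
    · have := (Nat.ordProj_dvd N p).trans hdvd
      rwa [hw] at this
    · rw [← hpc]
      intro h0
      rw [Finset.card_eq_zero, Finset.filter_eq_empty_iff] at h0
      -- Some period has the full `p`-part of `N`: otherwise `N / p` would be a common multiple of
      -- all periods.
      have hall : N ∣ N / p := by
        rw [hN]
        refine Finset.lcm_dvd fun i _ => ?_
        rw [← hN]
        have hpi : p ∣ N / period i := by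
          by_contra h
          exact h0 (Finset.mem_univ i) (((hcount i).1 h).trans hw)
        obtain ⟨c, hc⟩ := hpi
        have h1 : N = period i * (p * c) := by rw [← hc, Nat.mul_div_cancel' (hiN i)]
        refine ⟨c, ?_⟩
        rw [h1, ← mul_assoc, mul_comm (period i) p, mul_assoc, Nat.mul_div_cancel_left _ hpp.pos]
      have h1 := Nat.le_of_dvd (Nat.div_pos (Nat.le_of_dvd (Nat.pos_of_ne_zero hN0)
        (Nat.dvd_of_mem_primeFactors hp)) hpp.pos) hall
      exact absurd (Nat.div_lt_self (Nat.pos_of_ne_zero hN0) hpp.one_lt) (by omega)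
  choose! a b hab using hlocal
  rw [card_tuples, Finset.prod_congr rfl (fun i _ => hE i), Finset.prod_comm,
    Finset.prod_congr rfl (fun p hp => (hab p hp).1)]
  have := coeff_one_prod (G := G) (S := N.primeFactors)
    (fun p hp => Nat.prime_of_mem_primeFactors hp)
    a b (fun p => N.factorization p) (fun p => N.factorization p - 1) 1 (by simp)
  rw [setSum_torsionSet_one, mul_one] at this
  rw [this, Finset.prod_congr rfl (fun p hp => (hab p hp).2), Finset.prod_mul_distrib,
    Finset.prod_div_distrib, Finset.prod_comm, Finset.prod_congr rfl (fun i _ => (hφ i).symm)]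
  congr 2
  have h1 : N.factorization.prod (fun p k => p ^ k) = N := Nat.prod_factorization_pow_eq_self hN0
  conv_rhs => rw [← h1]
  rw [Finsupp.prod, Nat.support_factorization]
  push_cast
  rfl

end CyclicCount

/-! ### Generating a cyclic group -/

namespace CyclicCount

variable {G : Type} [CommGroup G] [Fintype G]

/-- For `d` dividing the group order, the equation with exponent `Fintype.card G / d` says that `d`
divides the index of the subgroup generated by `x`; distinct primes divide it together exactly when
their product does. -/
lemma pow_card_div_prod_eq_one_iff {T : Finset ℕ} (hT : T ⊆ (Fintype.card G).primeFactors) (x : G) :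
    x ^ (Fintype.card G / ∏ p ∈ T, p) = 1 ↔ ∀ p ∈ T, x ^ (Fintype.card G / p) = 1 := by
  have key : ∀ d, d ∣ Fintype.card G →
      (x ^ (Fintype.card G / d) = 1 ↔ d ∣ Fintype.card G / orderOf x) := by
    intro d hd
    rw [← orderOf_dvd_iff_pow_eq_one, Nat.dvd_div_iff_mul_dvd hd,
      Nat.dvd_div_iff_mul_dvd (orderOf_dvd_card), mul_comm]
  have hprod : ∏ p ∈ T, p ∣ Fintype.card G :=
    (Finset.prod_dvd_prod_of_subset _ _ _ hT).trans (Nat.prod_primeFactors_dvd _)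
  rw [key _ hprod]
  constructor
  · intro h p hp
    rw [key p (Nat.dvd_of_mem_primeFactors (hT hp))]
    exact (Finset.dvd_prod_of_mem _ hp).trans h
  · intro h
    refine Finset.prod_primes_dvd _ (fun p hp => (Nat.prime_of_mem_primeFactors (hT hp)).prime) ?_
    intro p hp
    rw [← key p (Nat.dvd_of_mem_primeFactors (hT hp))]
    exact h p hp

variable [IsCyclic G]

/-- A homomorphism to a cyclic group is onto if and only if its image is in none of the subgroups of
prime index. -/
lemma surjective_iff {Γ : Type*} [Group Γ] (φ : Γ →* G) {S : Set Γ} (hS : Subgroup.closure S = ⊤) :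
    Function.Surjective φ ↔
      ∀ p ∈ (Fintype.card G).primeFactors, ∃ s ∈ S, φ s ^ (Fintype.card G / p) ≠ 1 := by
  constructor
  · intro h p hp
    by_contra! hcon
    have hpp := Nat.prime_of_mem_primeFactors hp
    -- This kernel is the subgroup of index `p`.
    have hle : φ.range ≤ (powMonoidHom (Fintype.card G / p) : G →* G).ker := by
      rw [MonoidHom.range_eq_map, ← hS, MonoidHom.map_closure, Subgroup.closure_le]
      rintro _ ⟨s, hs, rfl⟩
      exact hcon s hs
    rw [MonoidHom.range_eq_top.2 h] at hle
    obtain ⟨c, hc⟩ := IsCyclic.exists_ofOrder_eq_natCard (α := G)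
    rw [Nat.card_eq_fintype_card] at hc
    have h1 : c ^ (Fintype.card G / p) = 1 := hle (Subgroup.mem_top c)
    have h2 := Nat.le_of_dvd (Nat.div_pos (Nat.le_of_dvd Fintype.card_pos
      (Nat.dvd_of_mem_primeFactors hp)) hpp.pos) (orderOf_dvd_of_pow_eq_one h1)
    rw [hc] at h2
    exact absurd (Nat.div_lt_self (Fintype.card_pos (α := G)) hpp.one_lt) (by omega)
  · intro h
    rw [← MonoidHom.range_eq_top]
    by_contra hne
    have hi : φ.range.index ≠ 1 := fun h1 => hne (Subgroup.index_eq_one.1 h1)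
    obtain ⟨p, hp, hpd⟩ := Nat.exists_prime_and_dvd hi
    have hcard := φ.range.card_mul_index
    rw [Nat.card_eq_fintype_card (α := G)] at hcard
    obtain ⟨c, hc⟩ := hpd
    obtain ⟨s, -, hs⟩ := h p (Nat.mem_primeFactors.2
      ⟨hp, (Dvd.intro _ hc.symm).trans (hcard ▸ dvd_mul_left _ _), Fintype.card_pos.ne'⟩)
    refine hs ?_
    have h1 : (φ s) ^ Nat.card φ.range = 1 := by
      have := pow_card_eq_one' (x := (⟨φ s, s, rfl⟩ : φ.range))
      exact congrArg Subtype.val this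
    rw [← hcard, hc, mul_left_comm, Nat.mul_div_cancel_left _ hp.pos, pow_mul, h1, one_pow]

/-- The number of tuples which are contained in none of the subgroups whose index belongs to a given
set of primes. -/
theorem card_tuples_not_mem {ι : Type} [Fintype ι] [DecidableEq ι] {P : Finset ℕ} [DecidableEq G]
    (hP : P ⊆ (Fintype.card G).primeFactors) :
    ((Finset.univ.filter fun y : ι → G =>
        ∀ p ∈ P, ∃ j, y j ^ (Fintype.card G / p) ≠ 1).card : ℚ) =
      (Fintype.card G : ℚ) ^ Fintype.card ι * ∏ p ∈ P, (1 - 1 / (p : ℚ) ^ Fintype.card ι) := by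
  -- Inclusion–exclusion: the indicator is a product of one minus the indicators of the subgroups.
  -- For a set `T` of primes, the subgroups intersect in the one whose index is the product of `T`.
  have hind : ∀ y : ι → G, (if ∀ p ∈ P, ∃ j, y j ^ (Fintype.card G / p) ≠ 1 then (1 : ℚ) else 0) =
      ∏ p ∈ P, (1 + if ∀ j, y j ^ (Fintype.card G / p) = 1 then (-1 : ℚ) else 0) := by
    intro y
    split_ifs with h
    · symm
      refine Finset.prod_eq_one fun p hp => ?_
      obtain ⟨j, hj⟩ := h p hp
      rw [if_neg fun h' => hj (h' j), add_zero]
    · push Not at h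
      obtain ⟨p, hp, h⟩ := h
      symm
      refine Finset.prod_eq_zero hp ?_
      rw [if_pos h]
      norm_num
  have hcount : ∀ T ∈ P.powerset, ∑ y : ι → G,
      ∏ p ∈ T, (if ∀ j, y j ^ (Fintype.card G / p) = 1 then (-1 : ℚ) else 0) =
        (Fintype.card G : ℚ) ^ Fintype.card ι * ∏ p ∈ T, (-(1 / (p : ℚ) ^ Fintype.card ι)) := by
    intro T hTP
    have hT := (Finset.mem_powerset.1 hTP).trans hP
    have hprod : ∏ p ∈ T, p ∣ Fintype.card G :=
      (Finset.prod_dvd_prod_of_subset _ _ _ hT).trans (Nat.prod_primeFactors_dvd _)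
    have hne : ∏ p ∈ T, (p : ℚ) ≠ 0 := Finset.prod_ne_zero_iff.2 fun p hp => by
      exact_mod_cast (Nat.prime_of_mem_primeFactors (hT hp)).ne_zero
    have h1 : ∀ y : ι → G,
        ∏ p ∈ T, (if ∀ j, y j ^ (Fintype.card G / p) = 1 then (-1 : ℚ) else 0) =
          if y ∈ Fintype.piFinset fun _ : ι => torsionSet G (Fintype.card G / ∏ p ∈ T, p)
            then (-1 : ℚ) ^ T.card else 0 := by
      intro y
      simp only [Fintype.mem_piFinset, mem_torsionSet, pow_card_div_prod_eq_one_iff hT]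
      split_ifs with h
      · rw [Finset.prod_congr rfl (fun p hp => if_pos fun j => h j p hp), Finset.prod_const]
      · push Not at h
        obtain ⟨j, p, hp, h⟩ := h
        exact Finset.prod_eq_zero hp (if_neg fun h' => h (h' j))
    rw [Finset.sum_congr rfl (fun y _ => h1 y), Finset.sum_ite_mem, Finset.univ_inter,
      Finset.sum_const, Fintype.card_piFinset, Finset.prod_const, Finset.card_univ,
      card_torsionSet (Nat.div_dvd_of_dvd hprod), nsmul_eq_mul, Nat.cast_pow,
      Nat.cast_div hprod (by rwa [Nat.cast_prod]), Finset.prod_neg,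
      Finset.prod_div_distrib, Finset.prod_const_one, Finset.prod_pow, Nat.cast_prod, div_pow]
    ring
  rw [← Finset.sum_boole, Finset.sum_congr rfl (fun y _ => hind y)]
  simp only [Finset.prod_one_add, sub_eq_add_neg]
  rw [Finset.sum_comm, Finset.sum_congr rfl hcount, Finset.mul_sum]

end CyclicCount

/-! ### Subgroups of finite index of Fuchsian groups -/

/-- Orbit–stabilizer, with infinite orbits and infinite indices both recorded as 0. Finiteness of
orbits thus becomes a statement about relative indices, which compose. -/
lemma finite_orbit_iff {G X : Type*} [Group G] [MulAction G X] (K : Subgroup G) (z : X) :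
    (MulAction.orbit K z).Finite ↔ (MulAction.stabilizer G z).relIndex K ≠ 0 := by
  have h : (MulAction.stabilizer G z).subgroupOf K = MulAction.stabilizer K z := rfl
  rw [Subgroup.relIndex, h, MulAction.index_stabilizer]
  refine ⟨fun hf => ?_, Set.finite_of_ncard_ne_zero⟩
  rw [ne_eq, Set.ncard_eq_zero hf]
  exact (MulAction.nonempty_orbit z).ne_empty

lemma finite_orbit_of_relIndex {G X : Type*} [Group G] [MulAction G X] {K L : Subgroup G}
    (h : K.relIndex L ≠ 0) {z : X} (hz : (MulAction.orbit K z).Finite) :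
    (MulAction.orbit L z).Finite := by
  rw [finite_orbit_iff] at hz ⊢
  exact Subgroup.relIndex_ne_zero_trans hz h

lemma IsElementary.of_relIndex {Γ' Γ : Subgroup PSL(2, ℝ)} (h : Γ'.relIndex Γ ≠ 0)
    (he : IsElementary Γ') : IsElementary Γ := by
  refine he.imp ?_ ?_
  · rintro ⟨z, hz⟩
    refine ⟨z, finite_orbit_of_relIndex ?_ hz⟩
    rw [preimageSL, preimageSL, Subgroup.relIndex_comap,
      Subgroup.map_comap_eq_self_of_surjective (QuotientGroup.mk'_surjective _)]
    exact h
  · rintro ⟨p, hp⟩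
    exact ⟨p, finite_orbit_of_relIndex h hp⟩

lemma IsElementary.of_finite {Γ : Subgroup PSL(2, ℝ)} [Finite Γ] : IsElementary Γ :=
  Or.inr ⟨Projectivization.mk ℝ ![1, 0] (by simp), Set.finite_range _⟩

lemma IsFuchsian.of_relIndex {Γ' Γ : Subgroup PSL(2, ℝ)} (hle : Γ' ≤ Γ) (h : Γ'.relIndex Γ ≠ 0)
    (hΓ : IsFuchsian Γ) : IsFuchsian Γ' where
  fg := by
    have := (Group.fg_iff_subgroup_fg Γ).2 hΓ.fg
    have : (Γ'.subgroupOf Γ).FiniteIndex := ⟨h⟩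
    have h1 : Group.FG (Γ'.subgroupOf Γ) := Subgroup.fg_of_index_ne_zero _
    have h2 : Group.FG Γ' := Group.fg_of_surjective
      (f := (Subgroup.subgroupOfEquivOfLe hle).toMonoidHom)
      (Subgroup.subgroupOfEquivOfLe hle).surjective
    exact (Group.fg_iff_subgroup_fg Γ').1 h2
  nonelementary := fun he => hΓ.nonelementary (he.of_relIndex h)
  discrete := by
    have := hΓ.discrete
    exact DiscreteTopology.of_subset (s := (Γ : Set PSL(2, ℝ))) (t := Γ') this hle

/-! ### Surface-kernel epimorphisms to cyclic groups -/

namespace IsCocompactFuchsian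

open SignatureGen

variable {Γ : Subgroup PSL(2, ℝ)} {g k : ℕ} {period : Fin k → ℕ}

/-- In a co-compact Fuchsian group the canonical generators have the expected orders. -/
lemma orderOf_of_x (hΓ : IsCocompactFuchsian Γ g period) (i : Fin k) :
    orderOf (PresentedGroup.of (x i) : PresentedGroup (relators g period)) = period i := by
  by_cases hg : 1 ≤ g
  · exact orderOf_of_x_of_genus hg i
  by_cases hk : 3 ≤ k
  · exact orderOf_of_x_of_three_le hk hΓ.two_le_period i
  obtain rfl : g = 0 := by omega
  obtain ⟨e⟩ := hΓ.presentation
  have := finite_of_lt_three (by omega) hΓ.two_le_period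
  have : Finite Γ := Finite.of_equiv _ e.toEquiv
  exact absurd .of_finite hΓ.fuchsian.nonelementary

/-- Torsion-freeness of surface groups gives one direction and the cyclic cover the other; the
Fuchsian conditions on the kernel follow from finite index. -/
lemma isSurfaceKernelEpi_iff (hΓ : IsCocompactFuchsian Γ g period)
    (e : PresentedGroup (relators g period) ≃* Γ) {n : ℕ} [NeZero n]
    (φ : Γ →* Multiplicative (ZMod n)) :
    IsSurfaceKernelEpi φ ↔
      Function.Surjective φ ∧ ∀ i, orderOf (φ (e (PresentedGroup.of (x i)))) = period i := by
  constructor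
  · rintro ⟨hs, m, hm⟩
    refine ⟨hs, fun i => ?_⟩
    obtain ⟨f⟩ := hm.presentation
    set u := e (PresentedGroup.of (x i)) with hu
    have hui : orderOf u = period i := by
      rw [hu, MulEquiv.orderOf_eq, hΓ.orderOf_of_x]
    have hi : period i ≠ 0 := by have := hΓ.two_le_period i; omega
    set d := orderOf (φ u) with hd
    have hker : u ^ d ∈ φ.ker := by rw [MonoidHom.mem_ker, map_pow, hd, pow_orderOf_eq_one]
    have hmem : ((u ^ d : Γ) : PSL(2, ℝ)) ∈ φ.ker.map Γ.subtype := ⟨u ^ d, hker, rfl⟩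
    -- The power of `u` that falls into the kernel is torsion, hence trivial. So `φ` does not lower
    -- the order of `u`.
    have hpow : (u ^ d) ^ period i = 1 := by
      rw [← pow_mul, mul_comm, pow_mul, ← hui, pow_orderOf_eq_one, one_pow]
    have hpow' : ((u ^ d : Γ) : PSL(2, ℝ)) ^ period i = 1 := congrArg Subtype.val hpow
    have htriv : f.symm ⟨_, hmem⟩ = 1 := by
      refine SurfaceGroup.eq_one_of_pow_eq_one _ hi ?_
      rw [← map_pow, EmbeddingLike.map_eq_one_iff]
      exact Subtype.ext hpow'
    rw [EmbeddingLike.map_eq_one_iff] at htriv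
    have htriv' : ((u ^ d : Γ) : PSL(2, ℝ)) = 1 := congrArg Subtype.val htriv
    have h1 : u ^ d = 1 := Subtype.ext htriv'
    refine Nat.dvd_antisymm ?_ ?_
    · rw [← hui]; exact orderOf_map_dvd φ u
    · rw [← hui]; exact orderOf_dvd_of_pow_eq_one h1
  · rintro ⟨hs, ho⟩
    refine ⟨hs, ?_⟩
    obtain ⟨m, ⟨f⟩⟩ := exists_ker_mulEquiv (ψ := φ.comp e.toMonoidHom) (hs.comp e.surjective) ho
    have hind : (φ.ker.map Γ.subtype).relIndex Γ ≠ 0 := by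
      have : (φ.ker.map Γ.subtype).subgroupOf Γ = φ.ker :=
        Subgroup.comap_map_eq_self_of_injective Γ.subtype_injective _
      rw [Subgroup.relIndex, this]
      exact Subgroup.FiniteIndex.index_ne_zero
    refine ⟨m, hΓ.fuchsian.of_relIndex (Subgroup.map_subtype_le _) hind, fun i => i.elim0, ⟨?_⟩⟩
    have hcomap : (φ.comp e.toMonoidHom).ker = φ.ker.comap e.toMonoidHom := rfl
    have hmap : (φ.comp e.toMonoidHom).ker.map e.toMonoidHom = φ.ker := by
      rw [hcomap, Subgroup.map_comap_eq_self_of_surjective e.surjective]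
    exact (f.trans (((φ.comp e.toMonoidHom).ker.equivMapOfInjective e.toMonoidHom e.injective).trans
      (MulEquiv.subgroupCongr hmap))).trans
      (φ.ker.equivMapOfInjective Γ.subtype Γ.subtype_injective)

lemma surjective_iff (e : PresentedGroup (relators g period) ≃* Γ) {n : ℕ} [NeZero n]
    (hdvd : Finset.univ.lcm period ∣ n) (φ : Γ →* Multiplicative (ZMod n))
    (hφ : ∀ i, orderOf (φ (e (PresentedGroup.of (x i)))) = period i) :
    Function.Surjective φ ↔ ∀ p ∈ (n / Finset.univ.lcm period).primeFactors, ∃ j : Fin g ⊕ Fin g,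
      φ (e (PresentedGroup.of (j.elim a b))) ^ (n / p) ≠ 1 := by
  have hcard : Fintype.card (Multiplicative (ZMod n)) = n := by
    rw [Fintype.card_multiplicative, ZMod.card]
  have hcl : Subgroup.closure (e.toMonoidHom '' Set.range (PresentedGroup.of : SignatureGen g k →
      PresentedGroup (relators g period))) = ⊤ := by
    rw [← MonoidHom.map_closure, closure_of_presented, ← MonoidHom.range_eq_map,
      MonoidHom.range_eq_top.2 e.surjective]
  have hN0 : n / Finset.univ.lcm period ≠ 0 :=
    (Nat.div_pos (Nat.le_of_dvd (NeZero.pos n) hdvd)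
      (Nat.pos_of_dvd_of_pos hdvd (NeZero.pos n))).ne'
  rw [CyclicCount.surjective_iff φ hcl, hcard]
  constructor
  · intro h p hp
    have hpn : p ∈ n.primeFactors :=
      Nat.primeFactors_mono (Nat.div_dvd_of_dvd hdvd) (NeZero.ne n) hp
    obtain ⟨_, ⟨_, ⟨s, rfl⟩, rfl⟩, hs⟩ := h p hpn
    rcases s with i | i | i
    · exact ⟨Sum.inl i, hs⟩
    · exact ⟨Sum.inr i, hs⟩
    -- As `p` divides `n / N`, all periods divide `n / p`. The images of the `x_i` lie in the
    -- subgroup of index `p` and cannot be the witness.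
    · refine absurd ?_ hs
      refine orderOf_dvd_iff_pow_eq_one.1 ?_
      refine (hφ i).dvd.trans ((Finset.dvd_lcm (Finset.mem_univ i)).trans ?_)
      rw [Nat.dvd_div_iff_mul_dvd (Nat.dvd_of_mem_primeFactors hpn), mul_comm,
        ← Nat.dvd_div_iff_mul_dvd hdvd]
      exact Nat.dvd_of_mem_primeFactors hp
  · intro h p hp
    by_cases hpN : p ∈ (n / Finset.univ.lcm period).primeFactors
    · obtain ⟨j, hj⟩ := h p hpN
      exact ⟨_, ⟨_, ⟨j.elim a b, rfl⟩, rfl⟩, hj⟩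
    -- If all `x_i` had images in the subgroup of index `p`, then `N` would divide `n / p`, and `p`
    -- would divide `n / N`. For the other primes the `x_i` therefore suffice.
    · by_contra! hcon
      refine hpN (Nat.mem_primeFactors.2 ⟨Nat.prime_of_mem_primeFactors hp, ?_, hN0⟩)
      rw [Nat.dvd_div_iff_mul_dvd hdvd, mul_comm,
        ← Nat.dvd_div_iff_mul_dvd (Nat.dvd_of_mem_primeFactors hp)]
      refine Finset.lcm_dvd fun i _ => ?_
      rw [← hφ i]
      exact orderOf_dvd_of_pow_eq_one (hcon _ ⟨_, ⟨x i, rfl⟩, rfl⟩)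

/-- The images of the canonical generators under a homomorphism to an abelian group: those of the
`a_i` and `b_i`, and those of the `x_i`. -/
def genImages {A : Type*} [CommGroup A] (e : PresentedGroup (relators g period) ≃* Γ) (φ : Γ →* A) :
    (Fin g ⊕ Fin g → A) × (Fin k → A) :=
  (fun j => φ (e (PresentedGroup.of (j.elim a b))), fun i => φ (e (PresentedGroup.of (x i))))

lemma genImages_injective {A : Type*} [CommGroup A]
    (e : PresentedGroup (relators g period) ≃* Γ) :
    Function.Injective (genImages e : (Γ →* A) → _) := by
  intro φ φ' h
  have h1 : φ.comp e.toMonoidHom = φ'.comp e.toMonoidHom := by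
    refine PresentedGroup.ext fun s => ?_
    rcases s with i | i | i
    · exact congrFun (congrArg Prod.fst h) (Sum.inl i)
    · exact congrFun (congrArg Prod.fst h) (Sum.inr i)
    · exact congrFun (congrArg Prod.snd h) i
  ext u
  have := DFunLike.congr_fun h1 (e.symm u)
  simpa using this

lemma lift_longRelator {A : Type*} [CommGroup A] (f : SignatureGen g k → A) :
    FreeGroup.lift f (longRelator g k) = ∏ i, f (x i) := by
  have h : (List.ofFn fun i : Fin g => (f (a i))⁻¹ * (f (b i))⁻¹ * f (a i) * f (b i)).prod = 1 := by
    rw [List.prod_ofFn]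
    refine Finset.prod_eq_one fun i _ => ?_
    rw [mul_right_comm _ (f (b i))⁻¹, inv_mul_cancel, one_mul, inv_mul_cancel]
  rw [longRelator, map_mul, map_list_prod, map_list_prod, List.map_ofFn, List.map_ofFn]
  simp only [Function.comp_def, map_mul, map_inv, FreeGroup.lift_apply_of]
  rw [h, mul_one, List.prod_ofFn]

/-- Commutators vanish in an abelian group, so the relations do not involve `y`. -/
lemma mem_range_genImages {A : Type*} [CommGroup A]
    (e : PresentedGroup (relators g period) ≃* Γ) (y : Fin g ⊕ Fin g → A) (z : Fin k → A) :
    (∃ φ : Γ →* A, genImages e φ = (y, z)) ↔ (∀ i, z i ^ period i = 1) ∧ ∏ i, z i = 1 := by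
  constructor
  · rintro ⟨φ, h⟩
    obtain rfl := congrArg Prod.snd h
    have hr : ∀ r ∈ relators g period,
        FreeGroup.lift (fun s => φ (e (PresentedGroup.of s))) r = 1 := by
      intro r hr
      have : FreeGroup.lift (fun s => φ (e (PresentedGroup.of s))) =
          (φ.comp e.toMonoidHom).comp (PresentedGroup.mk (relators g period)) := by
        ext s
        simp [PresentedGroup.of]
      rw [this, MonoidHom.comp_apply, PresentedGroup.one_of_mem hr, map_one]
    constructor
    · intro i
      have := hr _ (Set.mem_insert_of_mem _ ⟨i, rfl⟩)
      simpa [genImages] using this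
    · have := hr _ (Set.mem_insert _ _)
      rwa [lift_longRelator] at this
  · rintro ⟨h1, h2⟩
    let f : SignatureGen g k → A
      | a i => y (Sum.inl i)
      | b i => y (Sum.inr i)
      | x i => z i
    have hr : ∀ r ∈ relators g period, FreeGroup.lift f r = 1 := by
      rintro r (rfl | ⟨i, rfl⟩)
      · rw [lift_longRelator]; exact h2
      · rw [map_pow, FreeGroup.lift_apply_of]; exact h1 i
    refine ⟨(PresentedGroup.toGroup hr).comp e.symm.toMonoidHom, ?_⟩
    refine Prod.ext (funext fun j => ?_) (funext fun i => ?_)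
    · rcases j with i | i <;> simp [genImages, f]
    · simp [genImages, f]

end IsCocompactFuchsian

open SignatureGen in
theorem IsCocompactFuchsian.image_genImages {Γ : Subgroup PSL(2, ℝ)} {g k : ℕ} {period : Fin k → ℕ}
    (hΓ : IsCocompactFuchsian Γ g period) (e : PresentedGroup (relators g period) ≃* Γ)
    {n : ℕ} [NeZero n] (hdvd : Finset.univ.lcm period ∣ n) :
    genImages e '' {φ : Γ →* Multiplicative (ZMod n) | IsSurfaceKernelEpi φ} =
      ((Finset.univ.filter fun y : Fin g ⊕ Fin g → Multiplicative (ZMod n) =>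
          ∀ p ∈ (n / Finset.univ.lcm period).primeFactors, ∃ j, y j ^ (n / p) ≠ 1) ×ˢ
        (Finset.univ.filter fun z : Fin k → Multiplicative (ZMod n) =>
          (∀ i, orderOf (z i) = period i) ∧ ∏ i, z i = 1) : Finset _) := by
  ext ⟨y, z⟩
  simp only [Set.mem_image, Set.mem_ofPred_eq, Finset.coe_product, Set.mem_prod, Finset.mem_coe,
    Finset.mem_filter, Finset.mem_univ, true_and]
  constructor
  · rintro ⟨φ, hφ, h⟩
    rw [hΓ.isSurfaceKernelEpi_iff e] at hφ
    have hs := (surjective_iff e hdvd φ hφ.2).1 hφ.1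
    have hm := ((mem_range_genImages e y z).1 ⟨φ, h⟩).2
    obtain rfl := congrArg Prod.fst h
    obtain rfl := congrArg Prod.snd h
    exact ⟨hs, hφ.2, hm⟩
  · rintro ⟨hy, hz, hm⟩
    obtain ⟨φ, h⟩ := (mem_range_genImages e y z).2
      ⟨fun i => by rw [← hz i, pow_orderOf_eq_one], hm⟩
    refine ⟨φ, ?_, h⟩
    obtain rfl := congrArg Prod.fst h
    obtain rfl := congrArg Prod.snd h
    rw [hΓ.isSurfaceKernelEpi_iff e]
    exact ⟨(surjective_iff e hdvd φ hz).2 hy, hz⟩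

theorem theorem4p3 (Γ : Subgroup PSL(2, ℝ)) (g k : ℕ) (period : Fin k → ℕ)
    (hΓ : IsCocompactFuchsian Γ g period) (N : ℕ) (hN : N = Finset.univ.lcm period)
    (n : ℕ) (hn : 0 < n) :
    (¬ N ∣ n → ¬ ∃ φ : Γ →* Multiplicative (ZMod n), IsSurfaceKernelEpi φ) ∧
    (N ∣ n →
      {φ : Γ →* Multiplicative (ZMod n) | IsSurfaceKernelEpi φ}.Finite ∧
      ({φ : Γ →* Multiplicative (ZMod n) | IsSurfaceKernelEpi φ}.ncard : ℚ) =
        (n : ℚ) ^ (2 * g) / N * (∏ i, (Nat.totient (period i) : ℚ)) *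
          (∏ p ∈ (n / N).primeFactors, (1 - 1 / (p : ℚ) ^ (2 * g))) *
          ∏ p ∈ N.primeFactors,
            (1 - (-1) ^ (periodCount period p - 1) /
              ((p : ℚ) - 1) ^ (periodCount period p - 1))) := by
  have : NeZero n := ⟨hn.ne'⟩
  obtain ⟨e⟩ := hΓ.presentation
  have hcard : Fintype.card (Multiplicative (ZMod n)) = n := by
    rw [Fintype.card_multiplicative, ZMod.card]
  subst hN
  refine ⟨fun hndvd => ?_, fun hdvd => ?_⟩
  · rintro ⟨φ, hφ⟩
    refine hndvd (Finset.lcm_dvd fun i _ => ?_)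
    rw [← ((hΓ.isSurfaceKernelEpi_iff e φ).1 hφ).2 i]
    exact orderOf_dvd_card.trans hcard.dvd
  · have himg := hΓ.image_genImages e hdvd
    have hinj := IsCocompactFuchsian.genImages_injective (A := Multiplicative (ZMod n)) e
    refine ⟨Set.Finite.of_finite_image (himg ▸ Finset.finite_toSet _) hinj.injOn, ?_⟩
    have hy := CyclicCount.card_tuples_not_mem (G := Multiplicative (ZMod n)) (ι := Fin g ⊕ Fin g)
      (P := (n / Finset.univ.lcm period).primeFactors)
      (by rw [hcard]; exact Nat.primeFactors_mono (Nat.div_dvd_of_dvd hdvd) hn.ne')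
    have hz := CyclicCount.card_tuples_eq (G := Multiplicative (ZMod n)) period
      (fun i => by have := hΓ.two_le_period i; omega) (by rwa [hcard])
    rw [hcard, Fintype.card_sum, Fintype.card_fin, ← two_mul] at hy
    rw [← Set.ncard_image_of_injective _ hinj, himg, Set.ncard_coe_finset, Finset.card_product,
      Nat.cast_mul, hy, hz]
    ring
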